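/- **Setting.** Let $\lambda$ be a Dyck path of size $n\ge 0$ and $T$ the planar rooted tree with $n$ edges corresponding to it; the edges of $T$ are the chord pairs $(i,j)$ of $\lambda$ (an up step $i$ together with its matching down step $j$). The edge $(i,j)$ is below $(i',j')$ if $i'<i$ and $j<j'$, and strictly left to $(i',j')$ if $j<i'$. A decreasing label $L$ of $T$ is a bijection from the edges onto $\{1,\dots,n\}$ whose values decrease from the root to the leaves. It contains a $312$-pattern if there are edges $e_1,e_2,e_3$, with $e_1$ strictly right to $e_2$ and $e_2$ strictly right to $e_3$, such that $L(e_2)<L(e_3)<L(e_1)$; otherwise it is $312$-avoiding. Write $L\lessdot L'$ if $L'$ is obtained from $L$ by exchanging the labels of two edges $e_l,e_r$, where $e_l$ is strictly left to $e_r$, $L(e_l)<L(e_r)$, and no edge that is strictly right to $e_l$ and strictly left to $e_r$ has a label in $[L(e_l),L(e_r)]$; let $\le$ be the reflexive transitive closure of $\lessdot$ on decreasing labels. Let $h_L(e)$ be the number of edges that precede $e$ in pre-order and have a smaller label than $e$, and $\mathrm{inv}(L)=\sum_e h_L(e)$. Put $$Z(L_0,T)=\sum_{L\ge L_0}q^{\mathrm{inv}(L)}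 .$$ A Dyck tile of size $m$ is a ribbon of $2m+1$ unit boxes whose centres form a Dyck path of size $m$; its weight is $m+1$, and it is trivial if $m=0$. A Dyck tiling $D$ above $\lambda$ is a tiling by Dyck tiles of the region between $\lambda$ and a Dyck path $\mu$ above $\lambda$ which is cover-inclusive: each tile, moved straight downward by one box, is contained in another tile or lies below $\lambda$. Its weight $\mathrm{wt}(D)$ is the sum of the weights of its tiles; $D$ is trivial if all its tiles are trivial. The Hermite history of $D$ associates to each up step $u$ of $\lambda$ a line: it starts at $u$, or, as long as the tile on the upper left side of the current up step is one whose right-most south-east edge is elsewhere, at the up step straight above; from there it passes through successive tiles, each from its right-most south-east edge to its left-most north-west edge. The label of $D$ is the decreasing label $L$ such that, for each edge $e$, $h_L(e)$ is the sum of the weights of the tiles in the line associated to the up step of $e$. For a trivial Dyck tiling $D_0$, let $u_1,\dots,u_n$ be the up steps of $\lambda$ from the last one to the first one, $x(u_i)$ the number of down steps before $u_i$, and $\mu_i$ the number of tiles in the line associated to $u_i$. Put $c_1=(0,0)$, $c_{i+1}=c_i+(1,1)+(x(u_i)-x(u_{i+1}),0)$, $d_i=c_i-(0,1)+(\mu_i,0)$,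 and $$Y=q^{-\sum_{i}(i-1)\mu_i}\,\det\bigl(\mathrm{wt}(c_i\to d_j)\bigr)_{1\le i,j\le n},$$ where $\mathrm{wt}(c\to d)$ is the sum, over all lattice paths from $c$ to $d$ with right and down steps, of the product of $q^{y(r)+1}$ over the right steps $r$ of the path, $y(r)$ being the height of $r$. **Proposition.** Let $L_0$ be a $312$-avoiding decreasing label of $T$. There is exactly one Dyck tiling $D_0$ above $\lambda$ with label $L_0$, and $D_0$ is trivial. Let $Y(L_0,T)$ be the determinant $Y$ of $D_0$ and $W(L_0,T):=Z(L_0,T)-Y(L_0,T)$. Then $W(L_0,T)\in\mathbb{N}[q]$. Moreover, $W(L_0,T)$ is the generating function $\sum_D q^{\mathrm{wt}(D)}$ of the (finitely many) Dyck tilings $D$ above $\lambda$ that have a label $L\ge L_0$ and contain at least one non-trivial Dyck tile, and the label of each of these tilings contains at least one $312$-pattern. -/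

import Mathlib

open DyckStep LaurentPolynomial

noncomputable section

/-! ### Dyck paths, planar rooted trees and decreasing labels

A planar rooted tree with `n` edges is identified with a Dyck path of size `n` (`DyckWord`, steps
`U` and `D`); its edges are the chord pairs of the path. -/

/-- The steps `i, i + 1, ..., j` of a path. -/
def DyckWord.segment (w : DyckWord) (i j : ℕ) : List DyckStep :=
  (w.toList.drop i).take (j + 1 - i)

/-- `(i, j)` is a balanced pair: the step `i` is `U`, and there are as many `U` as `D` among the
steps `i, ..., j`. -/
def DyckWord.IsBalancedPair (w : DyckWord) (i j : ℕ) : Prop :=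
  w.toList[i]? = some U ∧ (w.segment i j).count U = (w.segment i j).count D

/-- `(i, j)` is a chord pair: the step `j` is `D`, and `i` is the maximal index `i < j` for which
`(i, j)` is balanced. (Steps are numbered from `0`.) -/
def DyckWord.IsChordPair (w : DyckWord) (i j : ℕ) : Prop :=
  w.toList[j]? = some D ∧ i < j ∧ w.IsBalancedPair i j ∧
    ∀ k, i < k → k < j → ¬ w.IsBalancedPair k j

/-- The edges of the planar rooted tree of the Dyck path `w`. -/
def TreeEdge (w : DyckWord) : Type :=
  {c : Fin w.toList.length × Fin w.toList.length // w.IsChordPair c.1 c.2}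

namespace TreeEdge

variable {w : DyckWord}

open Classical in
instance : Fintype (TreeEdge w) :=
  inferInstanceAs
    (Fintype {c : Fin w.toList.length × Fin w.toList.length // w.IsChordPair c.1 c.2})

open Classical in
instance : DecidableEq (TreeEdge w) := inferInstance

/-- The position of the up step of the chord. -/
def opening (e : TreeEdge w) : ℕ := e.1.1

/-- The position of the down step of the chord. -/
def closing (e : TreeEdge w) : ℕ := e.1.2

/-- The edge `e` is a proper descendant of the edge `f`, i.e. `f ≠ e` lies between `e` and the
root. -/
def IsBelow (e f : TreeEdge w) : Prop := f.opening < e.opening ∧ e.closing < f.closing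

/-- The edge `e` is strictly left to the edge `f`. -/
def StrictlyLeft (e f : TreeEdge w) : Prop := e.closing < f.opening

/-- The number of up steps before the up step of `e`. -/
def row (e : TreeEdge w) : ℕ := (w.toList.take e.opening).count U

end TreeEdge

/-- Decreasing labels of the tree of `w`: bijections from the edges to an `n`-element chain (the
labels `1, ..., n` are written as `0, ..., n - 1`) that decrease from the root to the leaves. -/
def DecreasingLabel (w : DyckWord) : Type :=
  {L : TreeEdge w ≃ Fin w.semilength // ∀ e f : TreeEdge w, e.IsBelow f → L e < L f}

namespace DecreasingLabel

variable {w : DyckWord}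

instance : CoeFun (DecreasingLabel w) (fun _ => TreeEdge w → Fin w.semilength) :=
  ⟨fun L => L.1⟩

open Classical in
instance : Fintype (DecreasingLabel w) :=
  inferInstanceAs
    (Fintype {L : TreeEdge w ≃ Fin w.semilength // ∀ e f : TreeEdge w, e.IsBelow f → L e < L f})

/-- The label contains a `312`-pattern: edges `e₁, e₂, e₃`, each strictly right to the next one,
with `L e₂ < L e₃ < L e₁`. -/
def Contains312 (L : DecreasingLabel w) : Prop :=
  ∃ e₁ e₂ e₃ : TreeEdge w, e₂.StrictlyLeft e₁ ∧ e₃.StrictlyLeft e₂ ∧ L e₂ < L e₃ ∧ L e₃ < L e₁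

/-- The covering relation: `L'` arises from `L` by exchanging the labels of an edge `l` and of an
edge `r` strictly right to it, where `L l < L r` and no edge strictly between them has a label in
`[L l, L r]`. -/
def CoveredBy (L L' : DecreasingLabel w) : Prop :=
  ∃ l r : TreeEdge w, l.StrictlyLeft r ∧
    (∀ e, e ≠ l → e ≠ r → L e = L' e) ∧
    L l < L r ∧ L' r = L l ∧ L' l = L r ∧
    ¬ ∃ c : TreeEdge w, l.StrictlyLeft c ∧ c.StrictlyLeft r ∧ L c ∈ Set.Icc (L l) (L r)

/-- The order of the poset of labels: `L ≤ L'` if `L'` is reached from `L` by finitely many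
covers. -/
def Le (L L' : DecreasingLabel w) : Prop := Relation.ReflTransGen CoveredBy L L'

open Classical in
/-- The entry at the edge `e` of the Lehmer code of the label: the number of smaller labels before
`e` in the pre-order word read from left to right (equivalently, after `e` in the post-order word
read from right to left). -/
def code (L : DecreasingLabel w) (e : TreeEdge w) : ℕ :=
  (Finset.univ.filter fun f : TreeEdge w => f.opening < e.opening ∧ L f < L e).card

/-- The inversion number `∑ᵢ #{j < i : ωⱼ < ωᵢ}` of the pre-order word `ω` of the label. -/
def inv (L : DecreasingLabel w) : ℕ := ∑ e : TreeEdge w, L.code e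

open Classical in
/-- The generating function `Z(L, T)` of the labels above `L`. -/
def Z (L : DecreasingLabel w) : ℤ[T;T⁻¹] :=
  ∑ L' ∈ Finset.univ.filter (fun L' : DecreasingLabel w => L.Le L'), T (L'.inv : ℤ)

end DecreasingLabel

/-! ### Cover-inclusive Dyck tilings

Paths are drawn in the plane with `U = (0, 1)` and `D = (1, 0)` (the usual picture, rotated by 45
degrees clockwise). The unit box `[d, d + 1] × [u, u + 1]` is denoted by `(d, u)`, and the unit up
step from `(d, u)` to `(d, u + 1)` also by `(d, u)`. In the usual picture, the translation by
`(1, -1)` moves straight downward. -/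

open Classical in
/-- The number of down steps before the up step number `r` (counted from `0`), i.e. the
`x`-coordinate of this up step. -/
def DyckWord.upCol (w : DyckWord) (r : ℕ) : ℕ :=
  (Finset.univ.filter fun j : Fin w.toList.length =>
    w.toList[j] = D ∧ (w.toList.take j).count U ≤ r).card

/-- The box `b` lies above the path `w`: it is to the left of the up step of `w` in its row. -/
def DyckWord.BoxAbove (w : DyckWord) (b : ℤ × ℤ) : Prop :=
  ∃ r : ℕ, r < w.semilength ∧ b.2 = r ∧ b.1 < w.upCol r

/-- A Dyck tile: a ribbon of boxes which form a Dyck path that starts at the box `start`. -/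
structure DyckTile where
  start : ℤ × ℤ
  path : DyckWord

namespace DyckTile

/-- The boxes of the tile. -/
def boxes (t : DyckTile) : Set (ℤ × ℤ) :=
  {b | ∃ k ≤ t.path.toList.length,
    b = t.start + (((t.path.toList.take k).count D : ℤ), ((t.path.toList.take k).count U : ℤ))}

/-- The size of the tile. -/
def size (t : DyckTile) : ℕ := t.path.semilength

/-- The weight of the tile. -/
def weight (t : DyckTile) : ℕ := t.size + 1

/-- The left-most north-west edge of the tile (in the usual picture), i.e. the left side of its
first box. -/
def exitEdge (t : DyckTile) : ℤ × ℤ := t.start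

/-- The right-most south-east edge of the tile (in the usual picture), i.e. the right side of its
last box. -/
def entryEdge (t : DyckTile) : ℤ × ℤ := t.start + ((t.size : ℤ) + 1, (t.size : ℤ))

end DyckTile

/-- The cover-inclusive Dyck tilings above the Dyck path `w`. -/
structure DyckTiling (w : DyckWord) where
  /-- The top path. -/
  top : DyckWord
  /-- The tiles. -/
  tiles : Finset DyckTile
  semilength_top : top.semilength = w.semilength
  top_above : ∀ k, (w.toList.take k).count U ≤ (top.toList.take k).count U
  disjoint : (tiles : Set DyckTile).PairwiseDisjoint DyckTile.boxes
  union : (⋃ t ∈ tiles, t.boxes) = {b | w.BoxAbove b ∧ ¬ top.BoxAbove b}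
  /-- A tile that is moved straight downward is contained in another tile or is below `w`. -/
  cover_inclusive : ∀ t ∈ tiles,
    (∃ t' ∈ tiles, ∀ b ∈ t.boxes, b + (1, -1) ∈ t'.boxes) ∨
      ∀ b ∈ t.boxes, ¬ w.BoxAbove (b + (1, -1))

namespace DyckTiling

variable {w : DyckWord}

/-- The tiling has only trivial tiles, i.e. tiles of size zero. -/
def IsTrivial (D : DyckTiling w) : Prop := ∀ t ∈ D.tiles, t.size = 0

/-- The weight of the tiling. -/
def weight (D : DyckTiling w) : ℕ := ∑ t ∈ D.tiles, t.weight

/-- The box to the left of the up step `v` is in a tile which is not entered at `v` (so that the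
line in this tile belongs to another up step), and `v'` is straight above `v`. -/
def Lift (D : DyckTiling w) (v v' : ℤ × ℤ) : Prop :=
  (∃ t ∈ D.tiles, v + (-1, 0) ∈ t.boxes ∧ t.entryEdge ≠ v) ∧ v' = v + (-1, 1)

/-- A tile is entered at `v` and left at `v'`. -/
def Cross (D : DyckTiling w) (v v' : ℤ × ℤ) : Prop :=
  ∃ t ∈ D.tiles, t.entryEdge = v ∧ t.exitEdge = v'

/-- The line of the Hermite history that is associated to the up step `v` of `w` passes through the
tile `t`: the line starts at the first point straight above `v` where no tile is in its way, and
then passes through tiles from the south-east edge to the left-most north-west edge. -/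
def LineMeets (D : DyckTiling w) (v : ℤ × ℤ) (t : DyckTile) : Prop :=
  ∃ v', Relation.ReflTransGen D.Lift v v' ∧ Relation.ReflTransGen D.Cross v' t.entryEdge

open Classical in
/-- The tiles in the line of the Hermite history associated to the up step number `r` of `w`. -/
def lineTiles (D : DyckTiling w) (r : ℕ) : Finset DyckTile :=
  D.tiles.filter fun t => D.LineMeets ((w.upCol r : ℤ), (r : ℤ)) t

/-- `L` is the decreasing label of the tiling `D`: its Lehmer code is the Hermite history of `D`,
which assigns to each up step the sum of the weights of the tiles in its line. -/
def HasLabel (D : DyckTiling w) (L : DecreasingLabel w) : Prop :=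
  ∀ e : TreeEdge w, L.code e = ∑ t ∈ D.lineTiles e.row, t.weight

end DyckTiling

/-! ### The Lindström–Gessel–Viennot determinant -/

/-- Steps of right-down lattice paths. -/
inductive RDStep
  | right
  | down

/-- All lattice paths with `a` right steps and `b` down steps. -/
def rdPaths : ℕ → ℕ → List (List RDStep)
  | 0, 0 => [[]]
  | a + 1, 0 => (rdPaths a 0).map (RDStep.right :: ·)
  | 0, b + 1 => (rdPaths 0 b).map (RDStep.down :: ·)
  | a + 1, b + 1 =>
    (rdPaths a (b + 1)).map (RDStep.right :: ·) ++ (rdPaths (a + 1) b).map (RDStep.down :: ·)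

/-- The weight of a lattice path that starts at height `y`: the product of `q ^ (y(r) + 1)` over
its right steps `r`. -/
def rdWeight : ℤ → List RDStep → ℤ[T;T⁻¹]
  | _, [] => 1
  | y, RDStep.right :: p => T (y + 1) * rdWeight y p
  | y, RDStep.down :: p => rdWeight (y - 1) p

open Classical in
/-- The sum of the weights of all right-down lattice paths from `a` to `b`. -/
def rdWeightSum (a b : ℤ × ℤ) : ℤ[T;T⁻¹] :=
  if a.1 ≤ b.1 ∧ b.2 ≤ a.2 then
    ((rdPaths (b.1 - a.1).toNat (a.2 - b.2).toNat).map (rdWeight a.2)).sum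
  else 0

namespace DyckTiling

variable {w : DyckWord}

/-- The `x`-coordinate of the up step number `i` (from `0`) of `w`, counted from the top. -/
def stepX (w : DyckWord) (i : ℕ) : ℤ := w.upCol (w.semilength - 1 - i)

/-- The number of tiles associated to the up step number `i` (from `0`), counted from the top. -/
def stepTiles (D : DyckTiling w) (i : ℕ) : ℕ := (D.lineTiles (w.semilength - 1 - i)).card

/-- The starting points of the lattice paths. -/
def source (w : DyckWord) : ℕ → ℤ × ℤ
  | 0 => (0, 0)
  | i + 1 => source w i + (1, 1) + (stepX w i - stepX w (i + 1), 0)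

/-- The end points of the lattice paths. -/
def sink (D : DyckTiling w) (i : ℕ) : ℤ × ℤ := source w i - (0, 1) + ((D.stepTiles i : ℤ), 0)

/-- The normalized determinant `Y` of the tiling (used for tilings with only trivial tiles). -/
def Y (D : DyckTiling w) : ℤ[T;T⁻¹] :=
  T (-∑ i : Fin w.semilength, ((i : ℕ) : ℤ) * D.stepTiles i) *
    (Matrix.of fun i j : Fin w.semilength => rdWeightSum (source w i) (D.sink j)).det

/-- The tilings with at least one non-trivial tile whose label is in the poset of labels with
minimal element `L₀`. -/
def nontrivialAbove (L₀ : DecreasingLabel w) : Set (DyckTiling w) :=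
  {D | ¬ D.IsTrivial ∧ ∃ L : DecreasingLabel w, D.HasLabel L ∧ L₀.Le L}

/-- `W = Z - Y`, for the label `L₀` and its tiling `D₀`. -/
def W (L₀ : DecreasingLabel w) (D₀ : DyckTiling w) : ℤ[T;T⁻¹] := L₀.Z - D₀.Y

end DyckTiling

end

/-!
By cover-inclusivity a Dyck tiling is determined by its upper path and, for each pair of adjacent
columns, the number of layers in which the boxes of the two columns are in the same tile. The edge
with the smallest label is a leaf of the tree, i.e. a peak of the path. Removing this peak, and
undoing the spreading of the tiling at it, gives by induction exactly one tiling for each decreasing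
label. If two boxes are in the same tile, then the induction also exhibits a `312`-pattern.

The tiling of `L` is trivial exactly if the Lehmer code `c` of `L` is the row lengths of a region
between two paths, i.e. if the right ends of these rows form a strictly increasing sequence. Above a
`312`-avoiding label `L₀`, the labels with such a code correspond to the strictly increasing
sequences which are bounded by the one of `L₀`: codes do not exceed the code of `L₀`, and every
smaller code of this kind is reached by exchanges of labels, from the last edge to the first.

The determinant `Y` is the generating function of these sequences: its matrix is, up to monomial
factors, a Hessenberg matrix of generating functions of weakly increasing chains, and the expansion
of this determinant is the inclusion-exclusion that counts strictly increasing sequences. So `Y`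
counts the trivial tilings above `L₀`, and `W = Z - Y` counts the other ones.
-/

/-! ### Words and layered tilings -/

/-- Infinite binary words; the letter `true` is an up step and `false` a down step. A Dyck path is
encoded by the word of its steps followed by down steps, so that words of different paths can be
compared at every position. -/
abbrev BinaryWord : Type := ℕ → Bool

namespace BinaryWord

/-- The number of up steps among the first `k` steps of a word. -/
def upCount (a : BinaryWord) : ℕ → ℕ
  | 0 => 0
  | k + 1 => upCount a k + if a k then 1 else 0

/-- The height of a word after `k` steps, i.e. the number of up steps minus the number of down
steps. -/
def height (a : BinaryWord) (k : ℕ) : ℤ := 2 * (upCount a k : ℤ) - k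

/-- The steps `p, ..., r - 1` of a word form a Dyck path. -/
def IsExcursion (a : BinaryWord) (p r : ℕ) : Prop :=
  height a p = height a r ∧ ∀ k, p ≤ k → k ≤ r → height a p ≤ height a k

/-- The sequence obtained by inserting `x, y` at the positions `s, s + 1`. -/
def insertPair {α : Type*} (s : ℕ) (x y : α) (c : ℕ → α) (k : ℕ) : α :=
  if k < s then c k else if k = s then x else if k = s + 1 then y else c (k - 2)

/-- The sequence obtained by deleting the entries `s` and `s + 1`. -/
def deletePair {α : Type*} (s : ℕ) (c : ℕ → α) (k : ℕ) : α := if k < s then c k else c (k + 2)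

/-- The word obtained by inserting a peak, i.e. an up step followed by a down step, at the
position `s`. -/
def insertPeak (s : ℕ) (a : BinaryWord) : BinaryWord := insertPair s true false a

/-- The word obtained by inserting an up step at the position `s`. -/
def insertUp (s : ℕ) (b : BinaryWord) : BinaryWord :=
  fun k => if k < s then b k else if k = s then true else b (k - 1)

/-- The word obtained by deleting the step at the position `s`. -/
def deleteStep (s : ℕ) (b : BinaryWord) : BinaryWord := fun k => if k < s then b k else b (k + 1)

/-- The number of boxes that lie above the position `k` and between the words `a` and `b`, for
`b` above `a`. -/
def gap (a b : BinaryWord) (k : ℕ) : ℕ := upCount b k - upCount a k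

section InsertPair

variable {α : Type*} {s k : ℕ} {x y : α} {c : ℕ → α}

theorem insertion_cases (s k : ℕ) : k < s ∨ k = s ∨ k = s + 1 ∨ ∃ i, s ≤ i ∧ k = i + 2 := by
  by_cases h : s + 2 ≤ k
  · exact Or.inr (Or.inr (Or.inr ⟨k - 2, by omega, by omega⟩))
  · omega

theorem insertPair_of_lt (h : k < s) : insertPair s x y c k = c k := by simp [insertPair, h]

@[simp] theorem insertPair_self : insertPair s x y c s = x := by simp [insertPair]

@[simp] theorem insertPair_succ : insertPair s x y c (s + 1) = y := by simp [insertPair]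

theorem insertPair_add_two (h : s ≤ k) : insertPair s x y c (k + 2) = c k := by
  simp [insertPair, show ¬ k + 2 < s by omega, show k + 2 ≠ s by omega, show k + 1 ≠ s by omega]

theorem deletePair_of_lt (h : k < s) : deletePair s c k = c k := by simp [deletePair, h]

theorem deletePair_of_le (h : s ≤ k) : deletePair s c k = c (k + 2) := by simp [deletePair, h]

theorem insertPair_deletePair (s : ℕ) (c : ℕ → α) :
    insertPair s (c s) (c (s + 1)) (deletePair s c) = c := by
  funext k
  rcases insertion_cases s k with hk | rfl | rfl | ⟨i, hi, rfl⟩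
  · rw [insertPair_of_lt hk, deletePair_of_lt hk]
  · rw [insertPair_self]
  · rw [insertPair_succ]
  · rw [insertPair_add_two hi, deletePair_of_le hi]

end InsertPair

section Counting

variable {a b : BinaryWord} {s k : ℕ}

@[simp] theorem upCount_zero : upCount a 0 = 0 := rfl

theorem upCount_succ : upCount a (k + 1) = upCount a k + if a k then 1 else 0 := rfl

theorem upCount_succ_of_up (h : a k = true) : upCount a (k + 1) = upCount a k + 1 := by
  simp [upCount_succ, h]

theorem upCount_succ_of_down (h : a k = false) : upCount a (k + 1) = upCount a k := by
  simp [upCount_succ, h]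

theorem upCount_congr (h : ∀ i < k, a i = b i) : upCount a k = upCount b k := by
  induction k with
  | zero => rfl
  | succ k ih => rw [upCount_succ, upCount_succ, ih fun i hi => h i (by omega), h k (by omega)]

theorem upCount_le_succ (a : BinaryWord) (k : ℕ) : upCount a k ≤ upCount a (k + 1) :=
  Nat.le_add_right _ _

theorem upCount_mono : Monotone (upCount a) := monotone_nat_of_le_succ (upCount_le_succ a)

theorem upCount_succ_le (a : BinaryWord) (k : ℕ) : upCount a (k + 1) ≤ upCount a k + 1 := by
  rw [upCount_succ]; split_ifs <;> omega

theorem upCount_le (k : ℕ) : upCount a k ≤ k := by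
  induction k with
  | zero => rfl
  | succ k ih => exact (upCount_succ_le a k).trans (by omega)

theorem height_succ_of_up (h : a k = true) : height a (k + 1) = height a k + 1 := by
  simp only [height, upCount_succ_of_up h]; push_cast; ring

theorem height_succ_of_down (h : a k = false) : height a (k + 1) = height a k - 1 := by
  simp only [height, upCount_succ_of_down h]; push_cast; ring

theorem insertPeak_of_lt (h : k < s) : insertPeak s a k = a k := insertPair_of_lt h

@[simp] theorem insertPeak_self : insertPeak s a s = true := insertPair_self

@[simp] theorem insertPeak_succ : insertPeak s a (s + 1) = false := insertPair_succ

theorem insertPeak_add_two (h : s ≤ k) : insertPeak s a (k + 2) = a k := insertPair_add_two h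

theorem insertPeak_deletePair (h : a s = true) (h' : a (s + 1) = false) :
    insertPeak s (deletePair s a) = a := by
  conv_rhs => rw [← insertPair_deletePair s a, h, h']
  rfl

theorem insertUp_of_lt (h : k < s) : insertUp s b k = b k := by simp [insertUp, h]

@[simp] theorem insertUp_self : insertUp s b s = true := by simp [insertUp]

theorem insertUp_succ (h : s ≤ k) : insertUp s b (k + 1) = b k := by
  simp [insertUp, show ¬ k + 1 < s by omega, show k + 1 ≠ s by omega]

theorem insertUp_deleteStep (h : b s = true) : insertUp s (deleteStep s b) = b := by
  funext k
  rcases lt_trichotomy k s with hk | rfl | hk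
  · rw [insertUp_of_lt hk]; simp [deleteStep, hk]
  · rw [insertUp_self, h]
  · obtain ⟨i, rfl⟩ : ∃ i, k = i + 1 := ⟨k - 1, by omega⟩
    rw [insertUp_succ (by omega)]; simp [deleteStep, show ¬ i < s by omega]

theorem upCount_insertPeak_of_le (h : k ≤ s) : upCount (insertPeak s a) k = upCount a k :=
  upCount_congr fun _ _ => insertPeak_of_lt (by omega)

theorem upCount_insertPeak_succ : upCount (insertPeak s a) (s + 1) = upCount a s + 1 := by
  rw [upCount_succ_of_up insertPeak_self, upCount_insertPeak_of_le le_rfl]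

theorem upCount_insertPeak_add_two (h : s ≤ k) :
    upCount (insertPeak s a) (k + 2) = upCount a k + 1 := by
  induction k, h using Nat.le_induction with
  | base => rw [upCount_succ_of_down insertPeak_succ, upCount_insertPeak_succ]
  | succ k hk ih =>
    rw [show k + 1 + 2 = (k + 2) + 1 from rfl, upCount_succ, ih, insertPeak_add_two hk,
      upCount_succ, add_right_comm]

theorem upCount_insertUp_of_le (h : k ≤ s) : upCount (insertUp s b) k = upCount b k :=
  upCount_congr fun _ _ => insertUp_of_lt (by omega)

theorem upCount_insertUp_succ (h : s ≤ k) :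
    upCount (insertUp s b) (k + 1) = upCount b k + 1 := by
  induction k, h using Nat.le_induction with
  | base => rw [upCount_succ_of_up insertUp_self, upCount_insertUp_of_le le_rfl]
  | succ k hk ih => rw [upCount_succ, ih, insertUp_succ hk, upCount_succ, add_right_comm]

theorem height_insertPeak_of_le (h : k ≤ s) : height (insertPeak s a) k = height a k := by
  rw [height, upCount_insertPeak_of_le h, height]

theorem height_insertPeak_succ : height (insertPeak s a) (s + 1) = height a s + 1 := by
  rw [height, upCount_insertPeak_succ, height]; push_cast; ring

theorem height_insertPeak_add_two (h : s ≤ k) : height (insertPeak s a) (k + 2) = height a k := by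
  rw [height, upCount_insertPeak_add_two h, height]; push_cast; ring

end Counting

section Excursion

variable {a : BinaryWord} {s p r : ℕ}

theorem isExcursion_self (a : BinaryWord) (p : ℕ) : IsExcursion a p p :=
  ⟨rfl, fun k h h' => by rw [le_antisymm h h']⟩

theorem isExcursion_insertPeak_of_le (hp : p ≤ r) (hr : r ≤ s) :
    IsExcursion (insertPeak s a) p r ↔ IsExcursion a p r := by
  rw [IsExcursion, IsExcursion, height_insertPeak_of_le hr, height_insertPeak_of_le (hp.trans hr)]
  exact and_congr_right fun _ => forall₃_congr fun k _ hk => by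
    rw [height_insertPeak_of_le (hk.trans hr)]

theorem isExcursion_insertPeak_of_le_of_le (hp : p ≤ s) (hr : s ≤ r) :
    IsExcursion (insertPeak s a) p (r + 2) ↔ IsExcursion a p r := by
  rw [IsExcursion, IsExcursion, height_insertPeak_add_two hr, height_insertPeak_of_le hp]
  refine and_congr_right fun _ => ⟨fun h k hpk hkr => ?_, fun h k hpk hkr => ?_⟩
  · rcases le_or_gt k s with hk | hk
    · simpa only [height_insertPeak_of_le hk] using h k hpk (by omega)
    · simpa only [height_insertPeak_add_two hk.le] using h (k + 2) (by omega) (by omega)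
  · rcases insertion_cases s k with hk | rfl | rfl | ⟨k, hk, rfl⟩
    · rw [height_insertPeak_of_le hk.le]; exact h k hpk (by omega)
    · rw [height_insertPeak_of_le le_rfl]; exact h k hpk hr
    · rw [height_insertPeak_succ]; have := h s hp hr; omega
    · rw [height_insertPeak_add_two hk]; exact h k (by omega) (by omega)

theorem isExcursion_insertPeak_of_ge (hp : s ≤ p) (hr : s ≤ r) :
    IsExcursion (insertPeak s a) (p + 2) (r + 2) ↔ IsExcursion a p r := by
  rw [IsExcursion, IsExcursion, height_insertPeak_add_two hr, height_insertPeak_add_two hp]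
  refine and_congr_right fun _ => ⟨fun h k hpk hkr => ?_, fun h k hpk hkr => ?_⟩
  · simpa only [height_insertPeak_add_two (hp.trans hpk)] using h (k + 2) (by omega) (by omega)
  · obtain ⟨k, rfl⟩ : ∃ i, k = i + 2 := ⟨k - 2, by omega⟩
    rw [height_insertPeak_add_two (by omega)]; exact h k (by omega) (by omega)

end Excursion

/-- The maximal runs of a sequence `J` above the level `j`: the entries strictly between `p` and
`r` are larger than `j`, those at `p` and at `r` are not. -/
def IsMaxRun (J : ℕ → ℕ) (j p r : ℕ) : Prop :=
  p < r ∧ J p ≤ j ∧ J r ≤ j ∧ ∀ k, p < k → k < r → j < J k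

section MaxRun

variable {J : ℕ → ℕ} {j s m p r : ℕ}

theorem isMaxRun_insertPair_of_lt (hr : r < s) :
    IsMaxRun (insertPair s m m J) j p r ↔ IsMaxRun J j p r := by
  refine and_congr_right fun hp => ?_
  rw [insertPair_of_lt hr, insertPair_of_lt (hp.trans hr)]
  exact and_congr_right fun _ => and_congr_right fun _ => forall₃_congr fun k _ hk => by
    rw [insertPair_of_lt (hk.trans hr)]

theorem isMaxRun_insertPair_self (hm : m ≤ j) (hs : J s ≤ j) :
    IsMaxRun (insertPair s m m J) j p s ↔ IsMaxRun J j p s := by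
  refine and_congr_right fun hp => ?_
  rw [insertPair_self, insertPair_of_lt hp]
  simp only [hm, hs, true_and]
  exact and_congr_right fun _ => forall₃_congr fun k _ hk => by rw [insertPair_of_lt hk]

theorem isMaxRun_insertPair_of_lt_of_le (hp : p < s) (hr : s ≤ r) (hm : j < m) :
    IsMaxRun (insertPair s m m J) j p (r + 2) ↔ IsMaxRun J j p r := by
  rw [IsMaxRun, IsMaxRun, insertPair_of_lt hp, insertPair_add_two hr]
  refine and_congr (by omega) (and_congr_right fun _ => and_congr_right fun _ =>
    ⟨fun h k hpk hkr => ?_, fun h k hpk hkr => ?_⟩)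
  · rcases lt_or_ge k s with hk | hk
    · simpa only [insertPair_of_lt hk] using h k hpk (by omega)
    · simpa only [insertPair_add_two hk] using h (k + 2) (by omega) (by omega)
  · rcases insertion_cases s k with hk | rfl | rfl | ⟨k, hk, rfl⟩
    · rw [insertPair_of_lt hk]; exact h k hpk (by omega)
    · rwa [insertPair_self]
    · rwa [insertPair_succ]
    · rw [insertPair_add_two hk]; exact h k (by omega) (by omega)

theorem isMaxRun_insertPair_of_ge (hp : s ≤ p) (hr : s ≤ r) :
    IsMaxRun (insertPair s m m J) j (p + 2) (r + 2) ↔ IsMaxRun J j p r := by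
  rw [IsMaxRun, IsMaxRun, insertPair_add_two hp, insertPair_add_two hr]
  refine and_congr (by omega) (and_congr_right fun _ => and_congr_right fun _ =>
    ⟨fun h k hpk hkr => ?_, fun h k hpk hkr => ?_⟩)
  · simpa only [insertPair_add_two (hp.trans hpk.le)] using h (k + 2) (by omega) (by omega)
  · obtain ⟨k, rfl⟩ : ∃ i, k = i + 2 := ⟨k - 2, by omega⟩
    rw [insertPair_add_two (by omega)]; exact h k (by omega) (by omega)

end MaxRun

/-- Every maximal run of `J` above some level lies over a Dyck path contained in `a`. -/
def RunsAreExcursions (a : BinaryWord) (J : ℕ → ℕ) : Prop :=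
  ∀ j p r, IsMaxRun J j p r → IsExcursion a (p + 1) r

theorem RunsAreExcursions.insertPeak {a : BinaryWord} {J : ℕ → ℕ} {s m : ℕ}
    (h : RunsAreExcursions a J) (hm : J s ≤ m) :
    RunsAreExcursions (insertPeak s a) (insertPair s m m J) := by
  intro j p r hrun
  obtain ⟨hpr, hp, hr, hbetween⟩ := id hrun
  rcases insertion_cases s r with hrs | rfl | rfl | ⟨r, hrs, rfl⟩
  · rw [isMaxRun_insertPair_of_lt hrs] at hrun
    exact (isExcursion_insertPeak_of_le hpr hrs.le).2 (h _ _ _ hrun)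
  · rw [insertPair_self] at hr
    rw [isMaxRun_insertPair_self hr (hm.trans hr)] at hrun
    exact (isExcursion_insertPeak_of_le hpr le_rfl).2 (h _ _ _ hrun)
  · rw [insertPair_succ] at hr
    obtain rfl : p = s := by
      by_contra hne
      have := hbetween s (by omega) (by omega)
      rw [insertPair_self] at this; omega
    exact isExcursion_self _ _
  · rw [insertPair_add_two hrs] at hr
    rcases insertion_cases s p with hps | rfl | rfl | ⟨p, hps, rfl⟩
    · have hj : j < m := by simpa using hbetween s (by omega) (by omega)
      rw [isMaxRun_insertPair_of_lt_of_le hps hrs hj] at hrun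
      exact (isExcursion_insertPeak_of_le_of_le hps hrs).2 (h _ _ _ hrun)
    · have hj := hbetween (p + 1) (by omega) (by omega)
      rw [insertPair_succ] at hj
      rw [insertPair_self] at hp; omega
    · rw [insertPair_succ] at hp
      obtain rfl : s = r := by
        by_contra hne
        have := hbetween (s + 2) (by omega) (by omega)
        rw [insertPair_add_two le_rfl] at this; omega
      exact isExcursion_self _ _
    · rw [isMaxRun_insertPair_of_ge hps hrs] at hrun
      exact (isExcursion_insertPeak_of_ge (hps.trans p.le_succ) hrs).2 (h _ _ _ hrun)

theorem RunsAreExcursions.of_insertPeak {a : BinaryWord} {J : ℕ → ℕ} {s m : ℕ}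
    (h : RunsAreExcursions (BinaryWord.insertPeak s a) (insertPair s m m J)) (hm : J s ≤ m) :
    RunsAreExcursions a J := by
  intro j p r hrun
  have hpr := hrun.1
  rcases le_or_gt s p with hps | hps
  · have hrs : s ≤ r := hps.trans hpr.le
    exact (isExcursion_insertPeak_of_ge (hps.trans p.le_succ) hrs).1
      (h _ _ _ ((isMaxRun_insertPair_of_ge hps hrs).2 hrun))
  · rcases lt_or_ge r s with hrs | hrs
    · exact (isExcursion_insertPeak_of_le hpr hrs.le).1
        (h _ _ _ ((isMaxRun_insertPair_of_lt hrs).2 hrun))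
    · rcases lt_or_ge j m with hj | hj
      · exact (isExcursion_insertPeak_of_le_of_le hps hrs).1
          (h _ _ _ ((isMaxRun_insertPair_of_lt_of_le hps hrs hj).2 hrun))
      · obtain rfl : r = s := by
          by_contra hne
          have := hrun.2.2.2 s hps (by omega)
          omega
        exact (isExcursion_insertPeak_of_le hpr le_rfl).1
          (h _ _ _ ((isMaxRun_insertPair_self hj (hm.trans hj)).2 hrun))

/-- The weight of the part to the left of the position `k` of the line of the Hermite history which
passes through the layer `j` there, for the tiling between `a` and `b` described by `J` (see
`TilingData`). A line loses no weight inside of a tile at an up step, since the weight of a tile is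
the number of its down steps plus one. -/
def lineWeight (a b : BinaryWord) (J : ℕ → ℕ) : ℕ → ℕ → ℕ
  | 0, _ => 0
  | k + 1, j =>
    if gap a b (k + 1) ≤ j then 0
    else if a k then (if j < J k then lineWeight a b J k j else 1 + lineWeight a b J k (j + 1))
    else 1 + lineWeight a b J k j

section LineWeight

variable {a b : BinaryWord} {J : ℕ → ℕ} {k j : ℕ}

theorem lineWeight_eq_zero (h : gap a b k ≤ j) : lineWeight a b J k j = 0 := by
  cases k with
  | zero => rfl
  | succ k => rw [lineWeight, if_pos h]

theorem lineWeight_of_down (h : j < gap a b (k + 1)) (hk : a k = false) :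
    lineWeight a b J (k + 1) j = 1 + lineWeight a b J k j := by
  rw [lineWeight, if_neg (by omega), if_neg (by simp [hk])]

theorem lineWeight_of_joint (h : j < gap a b (k + 1)) (hk : a k = true) (hj : j < J k) :
    lineWeight a b J (k + 1) j = lineWeight a b J k j := by
  rw [lineWeight, if_neg (by omega), if_pos hk, if_pos hj]

theorem lineWeight_of_not_joint (h : j < gap a b (k + 1)) (hk : a k = true) (hj : J k ≤ j) :
    lineWeight a b J (k + 1) j = 1 + lineWeight a b J k (j + 1) := by
  rw [lineWeight, if_neg (by omega), if_pos hk, if_neg (by omega)]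

end LineWeight

end BinaryWord

open BinaryWord

/-- A layered description of the Dyck tilings of the region between the words `a` and `b`: `J k` is
the number of layers in which the boxes above the positions `k` and `k + 1` belong to the same tile.
By cover-inclusivity, these are the lowest layers. The tiles in the layer `j` are the maximal runs
of `J` above the level `j`. -/
structure TilingData (a b : BinaryWord) (J : ℕ → ℕ) : Prop where
  eventually_eq : ∃ N, ∀ k, N ≤ k → a k = false ∧ b k = false ∧ upCount a k = upCount b k
  joint_left : ∀ k, J k + upCount a k ≤ upCount b k
  joint_right : ∀ k, J k + upCount a (k + 1) ≤ upCount b (k + 1)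
  runs : RunsAreExcursions a J

namespace TilingData

variable {a b : BinaryWord} {J : ℕ → ℕ} {s k j : ℕ}

theorem above (h : TilingData a b J) (k : ℕ) : upCount a k ≤ upCount b k :=
  (Nat.le_add_left _ _).trans (h.joint_left k)

theorem joint_zero (h : TilingData a b J) : J 0 = 0 := by simpa using h.joint_left 0

theorem joint_le_gap (h : TilingData a b J) (k : ℕ) : J k ≤ gap a b k :=
  Nat.le_sub_of_add_le (h.joint_left k)

theorem joint_le_gap_succ (h : TilingData a b J) (k : ℕ) : J k ≤ gap a b (k + 1) :=
  Nat.le_sub_of_add_le (h.joint_right k)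

theorem exists_run_end (h : TilingData a b J) (k j : ℕ) :
    ∃ r, k ≤ r ∧ J r ≤ j ∧ ∀ i, k ≤ i → i < r → j < J i := by
  classical
  have hex : ∃ r, k ≤ r ∧ J r ≤ j := by
    obtain ⟨N, hN⟩ := h.eventually_eq
    have hleft := h.joint_left (max k N)
    have heq := (hN (max k N) (le_max_right _ _)).2.2
    exact ⟨max k N, le_max_left _ _, by omega⟩
  refine ⟨Nat.find hex, (Nat.find_spec hex).1, (Nat.find_spec hex).2, fun i hi hlt => ?_⟩
  have := Nat.find_min hex hlt
  omega

theorem exists_run_start (h : TilingData a b J) (j : ℕ) (hk : 0 < k) :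
    ∃ p, p < k ∧ J p ≤ j ∧ ∀ i, p < i → i < k → j < J i := by
  induction k with
  | zero => omega
  | succ k ih =>
    by_cases hj : J k ≤ j
    · exact ⟨k, by omega, hj, fun i hi hlt => by omega⟩
    · have hk0 : 0 < k := by
        by_contra hk0
        rw [Nat.eq_zero_of_not_pos hk0, h.joint_zero] at hj; omega
      obtain ⟨p, hp, hJ, hi⟩ := ih hk0
      refine ⟨p, by omega, hJ, fun i hpi hik => ?_⟩
      rcases Nat.lt_succ_iff_lt_or_eq.1 hik with hik | rfl
      · exact hi i hpi hik
      · omega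

theorem joint_le_of_up (h : TilingData a b J) (hk : a k = true) : J k ≤ J (k + 1) := by
  by_contra hlt
  have hk0 : 0 < k := by
    by_contra hk0
    rw [Nat.eq_zero_of_not_pos hk0, h.joint_zero] at hlt; omega
  obtain ⟨p, hp, hJ, hi⟩ := h.exists_run_start (J (k + 1)) hk0
  have hexc : IsExcursion a (p + 1) (k + 1) :=
    h.runs (J (k + 1)) p (k + 1) ⟨by omega, hJ, le_rfl, fun i hpi hik => by
      rcases Nat.lt_succ_iff_lt_or_eq.1 hik with hik | rfl
      · exact hi i hpi hik
      · omega⟩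
  have hbelow := hexc.2 k hp (by omega)
  have hend := hexc.1
  have := height_succ_of_up hk
  omega

theorem joint_le_of_down (h : TilingData a b J) (hk : a (k + 1) = false) :
    J (k + 1) ≤ J k := by
  by_contra hlt
  obtain ⟨r, hr, hJ, hi⟩ := h.exists_run_end (k + 1) (J k)
  have hr' : k + 1 ≠ r := by rintro rfl; omega
  have hexc : IsExcursion a (k + 1) r := h.runs (J k) k r ⟨by omega, le_rfl, hJ, hi⟩
  have hbelow := hexc.2 (k + 1 + 1) (by omega) (by omega)
  have := height_succ_of_down hk
  omega

theorem lineWeight_pos (h : TilingData a b J) (hj : j < gap a b k) :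
    0 < lineWeight a b J k j := by
  induction k with
  | zero => simp [gap] at hj
  | succ k ih =>
    rw [lineWeight, if_neg (by omega)]
    split_ifs with hk hjoint
    · exact ih (hjoint.trans_le (h.joint_le_gap k))
    · omega
    · omega

/-- Spreading: the region is cut along the antidiagonal through the position `s`, the right part is
moved away, and the cut is filled with boxes that are joined to both of their neighbours. -/
theorem spread (h : TilingData a b J) (s : ℕ) :
    TilingData (insertPeak s a) (insertUp s b) (insertPair s (gap a b s) (gap a b s) J) := by
  have habove : gap a b s + upCount a s = upCount b s := Nat.sub_add_cancel (h.above s)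
  have hup : ∀ i, s ≤ i → upCount (insertUp s b) (i + 2) = upCount b (i + 1) + 1 := fun i hi =>
    upCount_insertUp_succ (by omega)
  refine ⟨?_, fun k => ?_, fun k => ?_, h.runs.insertPeak (h.joint_le_gap s)⟩
  · obtain ⟨N, hN⟩ := h.eventually_eq
    refine ⟨max N s + 2, fun k hk => ?_⟩
    obtain ⟨i, rfl⟩ : ∃ i, k = i + 2 := ⟨k - 2, by omega⟩
    have hi : s ≤ i := by omega
    obtain ⟨ha, -, -⟩ := hN i (by omega)
    obtain ⟨-, hb, hab⟩ := hN (i + 1) (by omega)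
    refine ⟨by rw [insertPeak_add_two hi, ha], by rw [insertUp_succ (by omega), hb], ?_⟩
    rw [upCount_insertPeak_add_two hi, hup i hi, ← hab, upCount_succ_of_down ha]
  · rcases insertion_cases s k with hk | rfl | rfl | ⟨i, hi, rfl⟩
    · rw [upCount_insertPeak_of_le hk.le, upCount_insertUp_of_le hk.le, insertPair_of_lt hk]
      exact h.joint_left k
    · rw [upCount_insertPeak_of_le le_rfl, upCount_insertUp_of_le le_rfl, insertPair_self, habove]
    · rw [upCount_insertPeak_succ, upCount_insertUp_succ le_rfl, insertPair_succ]; omega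
    · rw [upCount_insertPeak_add_two hi, hup i hi, insertPair_add_two hi]
      have := h.joint_left i; have := upCount_le_succ b i; omega
  · rcases insertion_cases s k with hk | rfl | rfl | ⟨i, hi, rfl⟩
    · rw [upCount_insertPeak_of_le hk, upCount_insertUp_of_le hk, insertPair_of_lt hk]
      exact h.joint_right k
    · rw [upCount_insertPeak_succ, upCount_insertUp_succ le_rfl, insertPair_self]; omega
    · rw [upCount_insertPeak_add_two le_rfl, hup s le_rfl, insertPair_succ]
      have := upCount_le_succ b s; omega
    · rw [show i + 2 + 1 = (i + 1) + 2 from rfl, upCount_insertPeak_add_two (by omega),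
        hup (i + 1) (by omega), insertPair_add_two hi]
      have := h.joint_right i; have := upCount_le_succ b (i + 1); omega

theorem gap_spread_of_le (hk : k ≤ s) : gap (insertPeak s a) (insertUp s b) k = gap a b k := by
  rw [gap, upCount_insertPeak_of_le hk, upCount_insertUp_of_le hk, gap]

theorem gap_spread_succ : gap (insertPeak s a) (insertUp s b) (s + 1) = gap a b s := by
  rw [gap, upCount_insertPeak_succ, upCount_insertUp_succ le_rfl, gap, Nat.add_sub_add_right]

theorem gap_spread_add_two (hk : s ≤ k) :
    gap (insertPeak s a) (insertUp s b) (k + 2) = upCount b (k + 1) - upCount a k := by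
  rw [gap, upCount_insertPeak_add_two hk, upCount_insertUp_succ (by omega), Nat.add_sub_add_right]

theorem lineWeight_spread_of_le {m : ℕ} (hk : k ≤ s) :
    lineWeight (insertPeak s a) (insertUp s b) (insertPair s m m J) k j = lineWeight a b J k j := by
  induction k generalizing j with
  | zero => rfl
  | succ k ih =>
    rw [lineWeight, lineWeight, gap_spread_of_le hk, insertPeak_of_lt (by omega),
      insertPair_of_lt (by omega), ih (by omega), ih (by omega)]

theorem lineWeight_spread_add_two (h : TilingData a b J) (hk : s ≤ k)
    (hj : j + upCount a k < upCount b (k + 1)) :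
    lineWeight (insertPeak s a) (insertUp s b) (insertPair s (gap a b s) (gap a b s) J) (k + 2) j =
      lineWeight a b J k j + 1 := by
  induction k, hk using Nat.le_induction generalizing j with
  | base =>
    rw [lineWeight_of_down (by rw [gap_spread_add_two le_rfl]; omega) insertPeak_succ]
    rcases lt_or_ge j (gap a b s) with hgap | hgap
    · rw [lineWeight_of_joint (by rwa [gap_spread_succ]) insertPeak_self (by rwa [insertPair_self]),
        lineWeight_spread_of_le le_rfl, add_comm]
    · rw [lineWeight_eq_zero hgap, lineWeight_eq_zero (by rwa [gap_spread_succ])]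
  | succ k hk ih =>
    have hright := h.joint_right k
    have hlt : j < gap (insertPeak s a) (insertUp s b) (k + 2 + 1) := by
      rw [show k + 2 + 1 = (k + 1) + 2 from rfl, gap_spread_add_two (by omega)]; omega
    have hpeak : insertPeak s a (k + 2) = a k := insertPeak_add_two hk
    have hpair := insertPair_add_two (x := gap a b s) (y := gap a b s) (c := J) hk
    rw [show k + 1 + 2 = (k + 2) + 1 from rfl]
    cases hak : a k
    · have ha := upCount_succ_of_down hak
      rw [lineWeight_of_down hlt (hpeak.trans hak)]
      rcases lt_or_ge j (gap a b (k + 1)) with hg | hg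
      · rw [lineWeight_of_down hg hak, ih (by unfold gap at hg; omega)]; omega
      · rw [lineWeight_eq_zero hg, lineWeight_eq_zero]
        rw [gap_spread_add_two hk]; unfold gap at hg; omega
    · have ha := upCount_succ_of_up hak
      rcases lt_or_ge j (J k) with hjoint | hjoint
      · rw [lineWeight_of_joint hlt (hpeak.trans hak) (by rwa [hpair]),
          lineWeight_of_joint (by unfold gap; omega) hak hjoint, ih (by omega)]
      · rw [lineWeight_of_not_joint hlt (hpeak.trans hak) (by rwa [hpair])]
        rcases lt_or_ge j (gap a b (k + 1)) with hg | hg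
        · rw [lineWeight_of_not_joint hg hak hjoint, ih (by unfold gap at hg; omega)]; omega
        · rw [lineWeight_eq_zero hg, lineWeight_eq_zero]
          rw [gap_spread_add_two hk]; unfold gap at hg; omega

theorem of_spread
    (h : TilingData (insertPeak s a) (insertUp s b) (insertPair s (gap a b s) (gap a b s) J))
    (hup : ∀ k, s ≤ k → a k = true → J k + upCount a (k + 1) ≤ upCount b (k + 1)) :
    TilingData a b J := by
  have hright : ∀ k, J k + upCount a (k + 1) ≤ upCount b (k + 1) := fun k => by
    rcases lt_or_ge k s with hk | hk
    · simpa only [upCount_insertPeak_of_le hk, upCount_insertUp_of_le hk, insertPair_of_lt hk]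
        using h.joint_right k
    · cases hak : a k
      · have := h.joint_left (k + 2)
        rw [upCount_insertPeak_add_two hk, upCount_insertUp_succ (by omega),
          insertPair_add_two hk] at this
        rw [upCount_succ_of_down hak]; omega
      · exact hup k hk hak
  have hJs : J s ≤ gap a b s := by
    cases has : a s
    · simpa [insertPair_add_two le_rfl] using
        h.joint_le_of_down (k := s + 1) ((insertPeak_add_two le_rfl).trans has)
    · have := hright s
      rw [upCount_succ_of_up has] at this
      have := upCount_succ_le b s
      unfold gap; omega
  refine ⟨?_, fun k => ?_, hright, h.runs.of_insertPeak hJs⟩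
  · obtain ⟨N, hN⟩ := h.eventually_eq
    refine ⟨max N s, fun k hk => ?_⟩
    have hks : s ≤ k := by omega
    obtain ⟨ha, -, hab⟩ := hN (k + 2) (by omega)
    obtain ⟨-, hb, -⟩ := hN (k + 1) (by omega)
    rw [insertPeak_add_two hks] at ha
    rw [insertUp_succ hks] at hb
    rw [upCount_insertPeak_add_two hks, upCount_insertUp_succ (by omega),
      upCount_succ_of_down hb] at hab
    exact ⟨ha, hb, by omega⟩
  · rcases lt_trichotomy k s with hk | rfl | hk
    · simpa only [upCount_insertPeak_of_le hk.le, upCount_insertUp_of_le hk.le,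
        insertPair_of_lt hk] using h.joint_left k
    · have := h.above k
      rw [upCount_insertPeak_of_le le_rfl, upCount_insertUp_of_le le_rfl] at this
      unfold gap at hJs; omega
    · obtain ⟨i, rfl⟩ : ∃ i, k = i + 1 := ⟨k - 1, by omega⟩
      cases hai : a (i + 1)
      · have hJ := h.joint_le_of_down (k := i + 2) ((insertPeak_add_two hk.le).trans hai)
        rw [show i + 2 + 1 = (i + 1) + 2 from rfl, insertPair_add_two (by omega),
          insertPair_add_two (by omega)] at hJ
        have := hright i; omega
      · have := hright (i + 1)
        rw [upCount_succ_of_up hai] at this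
        have := upCount_succ_le b (i + 1); omega

theorem joint_eq_gap_of_lineWeight_eq_zero (h : TilingData a b J)
    (h0 : lineWeight a b J k (J k) = 0) : J k + upCount a k = upCount b k := by
  have hgap : ¬ J k < gap a b k := fun hlt => (h.lineWeight_pos hlt).ne' h0
  have := h.joint_left k
  unfold gap at hgap; omega

/-- If the line of the up step at the peak `s` is empty and those of the later up steps are not,
then the tiling is obtained by spreading. -/
theorem exists_eq_spread (h : TilingData (insertPeak s a) b J)
    (h0 : lineWeight (insertPeak s a) b J s (J s) = 0)
    (hpos : ∀ k, s < k → insertPeak s a k = true → lineWeight (insertPeak s a) b J k (J k) ≠ 0) :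
    ∃ b' J', TilingData a b' J' ∧ b = insertUp s b' ∧
      J = insertPair s (gap a b' s) (gap a b' s) J' := by
  have hJs : J s + upCount a s = upCount b s := by
    simpa only [upCount_insertPeak_of_le le_rfl] using h.joint_eq_gap_of_lineWeight_eq_zero h0
  have hbs : b s = true := by
    have hright := h.joint_right s
    rw [upCount_insertPeak_succ] at hright
    cases hb : b s
    · rw [upCount_succ_of_down hb] at hright; omega
    · rfl
  have hJs' : J (s + 1) = J s := by
    refine le_antisymm ?_ (h.joint_le_of_up insertPeak_self)
    have := h.joint_left (s + 1)
    rw [upCount_insertPeak_succ, upCount_succ_of_up hbs] at this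
    omega
  have hb := insertUp_deleteStep hbs
  have hgap : gap a (deleteStep s b) s = J s := by
    rw [gap, ← upCount_insertUp_of_le (b := deleteStep s b) le_rfl, hb, ← hJs,
      Nat.add_sub_cancel_right]
  have hJ : insertPair s (gap a (deleteStep s b) s) (gap a (deleteStep s b) s) (deletePair s J) =
      J := by
    conv_rhs => rw [← insertPair_deletePair s J, hJs', ← hgap]
  refine ⟨deleteStep s b, deletePair s J, of_spread (by rwa [hb, hJ]) fun k hk hak => ?_, hb.symm,
    hJ.symm⟩
  have hlt : ¬ gap (insertPeak s a) b (k + 2) ≤ J (k + 2) := fun hle =>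
    hpos (k + 2) (by omega) (by rwa [insertPeak_add_two hk]) (lineWeight_eq_zero hle)
  rw [← hb, gap_spread_add_two hk] at hlt
  rw [deletePair_of_le hk, upCount_succ_of_up hak]
  omega

end TilingData

/-! ### Labels of words and peak insertion -/

namespace BinaryWord

/-- The chord of the up step `f` of a word is closed before the position `k`: the word returns to
the height of `f` after `f` and not after `k`. -/
def ClosedBefore (a : BinaryWord) (f k : ℕ) : Prop := ∃ t, f < t ∧ t ≤ k ∧ height a t ≤ height a f

/-- `ℓ` is a decreasing label of the chords of `a`: it is injective on up steps, and a chord that is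
nested in another one has the smaller label. Its values are not required to be an interval, so
that labels can be restricted to subwords. -/
structure IsDecreasingLabel (a : BinaryWord) (ℓ : ℕ → ℕ) : Prop where
  inj : ∀ i k, a i = true → a k = true → ℓ i = ℓ k → i = k
  lt_of_nested : ∀ i k, i < k → a i = true → a k = true → ¬ ClosedBefore a i k → ℓ k < ℓ i

/-- The entry at `k` of the Lehmer code of a label: the number of up steps before `k` with a smaller
label. -/
def wordCode (a : BinaryWord) (ℓ : ℕ → ℕ) (k : ℕ) : ℕ :=
  upCount (fun i => a i && decide (ℓ i < ℓ k)) k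

/-- The label of a chord diagram contains a `312`-pattern, i.e. three chords side by side (from left
to right `f`, `e`, `g`) such that the middle label is the smallest and the right one the largest. -/
def Contains312 (a : BinaryWord) (ℓ : ℕ → ℕ) : Prop :=
  ∃ f e g, a f = true ∧ a e = true ∧ a g = true ∧ ClosedBefore a f e ∧ ClosedBefore a e g ∧
    ℓ e < ℓ f ∧ ℓ f < ℓ g

/-- Some chord that is closed before the position `p` has a smaller label than some chord that opens
after `p`. A peak inserted at `p` with a minimal label completes a `312`-pattern. -/
def HasAscentAround (a : BinaryWord) (ℓ : ℕ → ℕ) (p : ℕ) : Prop :=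
  ∃ f g, a f = true ∧ a g = true ∧ ClosedBefore a f p ∧ p ≤ g ∧ ℓ f < ℓ g

/-- The up step at `s` has the smallest label. -/
def IsMinimalAt (a : BinaryWord) (ℓ : ℕ → ℕ) (s : ℕ) : Prop :=
  ∀ k, a k = true → k ≠ s → ℓ s < ℓ k

/-- The labelled word arises from the empty word by inserting peaks, each with a label that is
smaller than the labels that are already there. -/
inductive IsPeakGrowth : BinaryWord → (ℕ → ℕ) → Prop
  | empty (ℓ : ℕ → ℕ) : IsPeakGrowth (fun _ => false) ℓ
  | insert (s : ℕ) (a : BinaryWord) (ℓ : ℕ → ℕ) (hmin : IsMinimalAt (insertPeak s a) ℓ s)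
      (h : IsPeakGrowth a (deletePair s ℓ)) : IsPeakGrowth (insertPeak s a) ℓ

/-- The position in `insertPair s x y c` of the entry `k` of `c`. -/
def skipPair (s k : ℕ) : ℕ := if k < s then k else k + 2

section SkipPair

variable {a : BinaryWord} {ℓ : ℕ → ℕ} {s f p k : ℕ}

theorem skipPair_of_lt (h : k < s) : skipPair s k = k := if_pos h

theorem skipPair_of_le (h : s ≤ k) : skipPair s k = k + 2 := if_neg (by omega)

theorem skipPair_strictMono : StrictMono (skipPair s) := fun i k hik => by
  simp only [skipPair]; split_ifs <;> omega

theorem le_skipPair : k ≤ skipPair s k := by simp only [skipPair]; split_ifs <;> omega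

theorem deletePair_eq {α : Type*} (c : ℕ → α) : deletePair s c k = c (skipPair s k) := by
  simp only [skipPair, deletePair]; split_ifs <;> rfl

theorem insertPeak_skipPair : insertPeak s a (skipPair s k) = a k := by
  rcases lt_or_ge k s with h | h
  · rw [skipPair_of_lt h, insertPeak_of_lt h]
  · rw [skipPair_of_le h, insertPeak_add_two h]

theorem height_insertPeak_skipPair : height (insertPeak s a) (skipPair s k) = height a k := by
  rcases lt_or_ge k s with h | h
  · rw [skipPair_of_lt h, height_insertPeak_of_le h.le]
  · rw [skipPair_of_le h, height_insertPeak_add_two h]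

theorem ClosedBefore.lt (h : ClosedBefore a f k) : f < k := by
  obtain ⟨t, hft, htk, -⟩ := h
  omega

theorem ClosedBefore.mono (h : ClosedBefore a f k) (hkp : k ≤ p) : ClosedBefore a f p := by
  obtain ⟨t, hft, htk, ht⟩ := h
  exact ⟨t, hft, htk.trans hkp, ht⟩

theorem ClosedBefore.insertPeak (h : ClosedBefore a f k) :
    ClosedBefore (insertPeak s a) (skipPair s f) (skipPair s k) := by
  obtain ⟨t, hft, htk, ht⟩ := h
  exact ⟨skipPair s t, skipPair_strictMono hft, skipPair_strictMono.monotone htk, by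
    rwa [height_insertPeak_skipPair, height_insertPeak_skipPair]⟩

theorem ClosedBefore.of_insertPeak
    (h : ClosedBefore (BinaryWord.insertPeak s a) (skipPair s f) (skipPair s k)) :
    ClosedBefore a f k := by
  obtain ⟨t, hft, htk, ht⟩ := h
  rw [height_insertPeak_skipPair] at ht
  simp only [skipPair] at hft htk
  rcases insertion_cases s t with hts | rfl | rfl | ⟨i, hi, rfl⟩
  · rw [height_insertPeak_of_le hts.le] at ht
    exact ⟨t, by split_ifs at hft <;> omega, by split_ifs at htk <;> omega, ht⟩
  · rw [height_insertPeak_of_le le_rfl] at ht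
    exact ⟨t, by split_ifs at hft <;> omega, by split_ifs at htk <;> omega, ht⟩
  · rw [height_insertPeak_succ] at ht
    exact ⟨s, by split_ifs at hft <;> omega, by split_ifs at htk <;> omega, by omega⟩
  · rw [height_insertPeak_add_two hi] at ht
    exact ⟨i, by split_ifs at hft <;> omega, by split_ifs at htk <;> omega, ht⟩

theorem ClosedBefore.insertPeak_of_le (h : ClosedBefore a f p) (hp : p ≤ s) :
    ClosedBefore (BinaryWord.insertPeak s a) f p := by
  obtain ⟨t, hft, htp, ht⟩ := h
  exact ⟨t, hft, htp, by
    rwa [height_insertPeak_of_le (by omega), height_insertPeak_of_le (by omega)]⟩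

theorem closedBefore_insertPeak_self (hp : s + 2 ≤ p) : ClosedBefore (insertPeak s a) s p :=
  ⟨s + 2, by omega, hp, by rw [height_insertPeak_add_two le_rfl, height_insertPeak_of_le le_rfl]⟩

theorem IsDecreasingLabel.of_insertPeak (h : IsDecreasingLabel (insertPeak s a) ℓ) :
    IsDecreasingLabel a (deletePair s ℓ) where
  inj i k hi hk hik := by
    rw [deletePair_eq, deletePair_eq] at hik
    exact skipPair_strictMono.injective
      (h.inj _ _ (by rwa [insertPeak_skipPair]) (by rwa [insertPeak_skipPair]) hik)
  lt_of_nested i k hik hi hk hn := by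
    rw [deletePair_eq, deletePair_eq]
    exact h.lt_of_nested _ _ (skipPair_strictMono hik) (by rwa [insertPeak_skipPair])
      (by rwa [insertPeak_skipPair]) fun hc => hn hc.of_insertPeak

theorem exists_isMinimalAt (h : IsDecreasingLabel a ℓ) (hne : ∃ k, a k = true) :
    ∃ s, a s = true ∧ IsMinimalAt a ℓ s := by
  obtain ⟨s, hs, hmin⟩ := (wellFounded_lt.onFun (f := ℓ)).has_min {k | a k = true} hne
  exact ⟨s, hs, fun k hk hks => lt_of_le_of_ne (not_lt.1 (hmin k hk))
    fun he => hks (h.inj _ _ hk hs he.symm)⟩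

theorem IsMinimalAt.down_succ (hmin : IsMinimalAt a ℓ s) (h : IsDecreasingLabel a ℓ)
    (hs : a s = true) : a (s + 1) = false := by
  by_contra hc
  rw [Bool.not_eq_false] at hc
  refine (hmin (s + 1) hc (by omega)).not_gt (h.lt_of_nested s (s + 1) (by omega) hs hc ?_)
  rintro ⟨t, hst, hts, ht⟩
  rw [show t = s + 1 by omega, height_succ_of_up hs] at ht
  omega

theorem exists_eq_insertPeak (h : IsDecreasingLabel a ℓ) (hne : ∃ k, a k = true) :
    ∃ s a', a = insertPeak s a' ∧ IsMinimalAt a ℓ s := by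
  obtain ⟨s, hs, hmin⟩ := exists_isMinimalAt h hne
  exact ⟨s, deletePair s a, (insertPeak_deletePair hs (hmin.down_succ h hs)).symm, hmin⟩

theorem upCount_false (k : ℕ) : upCount (fun _ => false) k = 0 := by
  induction k with
  | zero => rfl
  | succ k ih => rw [upCount_succ, ih]; rfl

theorem upCount_eq_of_down (hk : s ≤ k) (h : ∀ i, s ≤ i → i < k → a i = false) :
    upCount a k = upCount a s := by
  induction k, hk using Nat.le_induction with
  | base => rfl
  | succ k hk ih =>
    rw [upCount_succ_of_down (h k hk (by omega)), ih fun i hi hik => h i hi (by omega)]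

/-- A decreasing label is built up from peaks, because the chord with the smallest label is a
peak. -/
theorem IsDecreasingLabel.isPeakGrowth (h : IsDecreasingLabel a ℓ)
    (hfin : ∃ N, ∀ k, N ≤ k → a k = false) : IsPeakGrowth a ℓ := by
  obtain ⟨N, hN⟩ := hfin
  generalize hn : upCount a N = n
  induction n generalizing a ℓ N with
  | zero =>
    obtain rfl : a = fun _ => false := funext fun k => by
      by_contra hk
      rw [Bool.not_eq_false] at hk
      have hkN : k < N := by by_contra hle; simp [hN k (by omega)] at hk
      have := upCount_mono (a := a) (show k + 1 ≤ N from hkN)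
      rw [upCount_succ_of_up hk] at this
      omega
    exact .empty ℓ
  | succ n ih =>
    have hne : ∃ k, a k = true := by
      by_contra! hall
      have := upCount_eq_of_down (a := a) N.zero_le fun i _ _ => by simpa using hall i
      rw [upCount_zero] at this
      omega
    obtain ⟨s, a', rfl, hmin⟩ := exists_eq_insertPeak h hne
    have hsN : s < N := by
      by_contra hle
      have := hN s (by omega)
      rw [insertPeak_self] at this
      cases this
    refine .insert s a' ℓ hmin (ih h.of_insertPeak N (fun k hk => ?_) ?_)
    · rw [← insertPeak_add_two (s := s) (a := a') (k := k) (by omega)]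
      exact hN _ (by omega)
    · have := upCount_eq_of_down (show N ≤ N + 2 by omega) fun i hi _ => hN i hi
      rw [upCount_insertPeak_add_two hsN.le, hn] at this
      omega

end SkipPair

section Code

variable {a : BinaryWord} {ℓ : ℕ → ℕ} {s k : ℕ}

theorem wordCode_insertPeak_of_lt (hk : k < s) :
    wordCode (insertPeak s a) ℓ k = wordCode a (deletePair s ℓ) k :=
  upCount_congr fun i hi => by
    rw [insertPeak_of_lt (by omega), deletePair_of_lt (by omega), deletePair_of_lt (by omega)]

theorem IsMinimalAt.wordCode_eq_zero (hmin : IsMinimalAt a ℓ s) : wordCode a ℓ s = 0 := by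
  rw [← upCount_false s]
  refine upCount_congr fun i hi => ?_
  cases hai : a i
  · rfl
  · simp [(hmin i hai (by omega)).le]

theorem IsMinimalAt.wordCode_insertPeak_add_two (hmin : IsMinimalAt (insertPeak s a) ℓ s)
    (hk : s ≤ k) (hak : a k = true) :
    wordCode (insertPeak s a) ℓ (k + 2) = wordCode a (deletePair s ℓ) k + 1 := by
  rw [wordCode, wordCode, ← upCount_insertPeak_add_two hk]
  congr 1
  funext i
  have hlt : ℓ s < ℓ (k + 2) := hmin _ (by rwa [insertPeak_add_two hk]) (by omega)
  rcases insertion_cases s i with hi | rfl | rfl | ⟨t, ht, rfl⟩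
  · rw [insertPeak_of_lt hi, insertPeak_of_lt hi, deletePair_of_lt hi, deletePair_of_le hk]
  · simp [hlt]
  · simp
  · rw [insertPeak_add_two ht, insertPeak_add_two ht, deletePair_of_le hk, deletePair_of_le ht]

end Code

/-- The tiling with joint counts `J` between the words `a` and `b` has the label `ℓ`: its Hermite
history is the Lehmer code of `ℓ`. -/
def HasWordLabel (a b : BinaryWord) (J ℓ : ℕ → ℕ) : Prop :=
  ∀ k, a k = true → lineWeight a b J k (J k) = wordCode a ℓ k

end BinaryWord

namespace TilingData

variable {a b b₁ b₂ : BinaryWord} {J J₁ J₂ ℓ : ℕ → ℕ} {s k : ℕ}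

theorem joint_lt_of_up (h : TilingData a b J) (hk : a k = true) :
    J k + upCount a k < upCount b (k + 1) := by
  have := h.joint_right k
  rw [upCount_succ_of_up hk] at this
  omega

theorem hasWordLabel_spread_iff (h : TilingData a b J) (hmin : IsMinimalAt (insertPeak s a) ℓ s) :
    HasWordLabel (insertPeak s a) (insertUp s b)
        (insertPair s (gap a b s) (gap a b s) J) ℓ ↔
      HasWordLabel a b J (deletePair s ℓ) := by
  constructor
  · intro hL k hk
    rcases lt_or_ge k s with hks | hks
    · have := hL k (by rwa [insertPeak_of_lt hks])
      rwa [insertPair_of_lt hks, lineWeight_spread_of_le hks.le,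
        wordCode_insertPeak_of_lt hks] at this
    · have := hL (k + 2) (by rwa [insertPeak_add_two hks])
      rw [insertPair_add_two hks, h.lineWeight_spread_add_two hks (h.joint_lt_of_up hk),
        hmin.wordCode_insertPeak_add_two hks hk] at this
      omega
  · intro hL k hk
    rcases insertion_cases s k with hks | rfl | rfl | ⟨i, hi, rfl⟩
    · rw [insertPeak_of_lt hks] at hk
      rw [insertPair_of_lt hks, lineWeight_spread_of_le hks.le, wordCode_insertPeak_of_lt hks]
      exact hL k hk
    · rw [insertPair_self, lineWeight_spread_of_le le_rfl, hmin.wordCode_eq_zero,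
        lineWeight_eq_zero le_rfl]
    · rw [insertPeak_succ] at hk
      cases hk
    · rw [insertPeak_add_two hi] at hk
      rw [insertPair_add_two hi, h.lineWeight_spread_add_two hi (h.joint_lt_of_up hk),
        hmin.wordCode_insertPeak_add_two hi hk, hL _ hk]

theorem exists_eq_spread_of_hasWordLabel (h : TilingData (insertPeak s a) b J)
    (hL : HasWordLabel (insertPeak s a) b J ℓ) (hmin : IsMinimalAt (insertPeak s a) ℓ s) :
    ∃ b' J', TilingData a b' J' ∧ b = insertUp s b' ∧
      J = insertPair s (gap a b' s) (gap a b' s) J' ∧ HasWordLabel a b' J' (deletePair s ℓ) := by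
  have hself : lineWeight (insertPeak s a) b J s (J s) = 0 := by
    rw [hL s insertPeak_self, hmin.wordCode_eq_zero]
  have hne : ∀ k, s < k → insertPeak s a k = true →
      lineWeight (insertPeak s a) b J k (J k) ≠ 0 := fun k hsk hk => by
    rcases insertion_cases s k with hks | rfl | rfl | ⟨i, hi, rfl⟩
    · omega
    · omega
    · rw [insertPeak_succ] at hk
      cases hk
    · rw [hL _ hk, hmin.wordCode_insertPeak_add_two hi (by rwa [insertPeak_add_two hi] at hk)]
      omega
  obtain ⟨b', J', h', rfl, rfl⟩ := h.exists_eq_spread hself hne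
  exact ⟨b', J', h', rfl, rfl, (h'.hasWordLabel_spread_iff hmin).1 hL⟩

theorem of_joint_eq_zero (hab : ∀ k, upCount a k ≤ upCount b k)
    (hN : ∃ N, ∀ k, N ≤ k → a k = false ∧ b k = false ∧ upCount a k = upCount b k) :
    TilingData a b fun _ => 0 where
  eventually_eq := hN
  joint_left k := by simpa using hab k
  joint_right k := by simpa using hab (k + 1)
  runs := by
    rintro j p r ⟨hpr, -, -, hbetween⟩
    obtain rfl : r = p + 1 := by
      by_contra hne
      exact absurd (hbetween (p + 1) (by omega) (by omega)) (by simp)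
    exact isExcursion_self a _

theorem eq_of_false (h : TilingData (fun _ => false) b J) :
    b = (fun _ => false) ∧ J = fun _ => 0 := by
  obtain ⟨N, hN⟩ := h.eventually_eq
  have hb : ∀ k, upCount b k = 0 := fun k => by
    have hmono := upCount_mono (a := b) (le_max_left k N)
    rw [← (hN _ (le_max_right k N)).2.2, upCount_false] at hmono
    omega
  refine ⟨funext fun k => ?_, funext fun k => ?_⟩
  · by_contra hk
    have := hb (k + 1)
    rw [upCount_succ_of_up (by simpa using hk)] at this
    omega
  · have := h.joint_left k
    rw [hb k] at this
    omega

end TilingData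

namespace BinaryWord

variable {a b b₁ b₂ : BinaryWord} {J J₁ J₂ ℓ : ℕ → ℕ} {s p k : ℕ}

theorem IsPeakGrowth.exists_tilingData (hℓ : IsPeakGrowth a ℓ) :
    ∃ b J, TilingData a b J ∧ HasWordLabel a b J ℓ := by
  induction hℓ with
  | empty ℓ =>
    exact ⟨_, _, .of_joint_eq_zero (fun _ => le_rfl) ⟨0, fun _ _ => ⟨rfl, rfl, rfl⟩⟩,
      fun k hk => by cases hk⟩
  | insert s a ℓ hmin _ ih =>
    obtain ⟨b, J, h, hL⟩ := ih
    exact ⟨_, _, h.spread s, (h.hasWordLabel_spread_iff hmin).2 hL⟩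

theorem IsPeakGrowth.tilingData_unique (hℓ : IsPeakGrowth a ℓ)
    (h₁ : TilingData a b₁ J₁) (h₂ : TilingData a b₂ J₂)
    (hL₁ : HasWordLabel a b₁ J₁ ℓ) (hL₂ : HasWordLabel a b₂ J₂ ℓ) : b₁ = b₂ ∧ J₁ = J₂ := by
  induction hℓ generalizing b₁ b₂ J₁ J₂ with
  | empty ℓ =>
    rw [h₁.eq_of_false.1, h₁.eq_of_false.2, h₂.eq_of_false.1, h₂.eq_of_false.2]
    exact ⟨rfl, rfl⟩
  | insert s a ℓ hmin _ ih =>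
    obtain ⟨b₁', J₁', h₁', rfl, rfl, hL₁'⟩ := h₁.exists_eq_spread_of_hasWordLabel hL₁ hmin
    obtain ⟨b₂', J₂', h₂', rfl, rfl, hL₂'⟩ := h₂.exists_eq_spread_of_hasWordLabel hL₂ hmin
    obtain ⟨rfl, rfl⟩ := ih h₁' h₂' hL₁' hL₂'
    exact ⟨rfl, rfl⟩

theorem HasAscentAround.of_deletePair (h : HasAscentAround a (deletePair s ℓ) k)
    (hks : k ≤ s) (hkp : k ≤ p) (hpk : p ≤ skipPair s k) :
    HasAscentAround (insertPeak s a) ℓ p := by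
  obtain ⟨f, g, hf, hg, hclosed, hkg, hfg⟩ := h
  rw [deletePair_eq, deletePair_eq] at hfg
  refine ⟨skipPair s f, skipPair s g, by rwa [insertPeak_skipPair], by rwa [insertPeak_skipPair],
    ?_, hpk.trans (skipPair_strictMono.monotone hkg), hfg⟩
  rw [skipPair_of_lt (hclosed.lt.trans_le hks)]
  exact (hclosed.insertPeak_of_le hks).mono hkp

theorem HasAscentAround.of_deletePair_of_le (h : HasAscentAround a (deletePair s ℓ) k)
    (hks : s ≤ k) : HasAscentAround (insertPeak s a) ℓ (k + 2) := by
  obtain ⟨f, g, hf, hg, hclosed, hkg, hfg⟩ := h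
  rw [deletePair_eq, deletePair_eq] at hfg
  rw [← skipPair_of_le hks]
  exact ⟨skipPair s f, skipPair s g, by rwa [insertPeak_skipPair], by rwa [insertPeak_skipPair],
    hclosed.insertPeak, skipPair_strictMono.monotone hkg, hfg⟩

theorem IsMinimalAt.hasAscentAround_add_two (hmin : IsMinimalAt (insertPeak s a) ℓ s) (hks : s ≤ k)
    (hup : ∃ g, k ≤ g ∧ a g = true) : HasAscentAround (insertPeak s a) ℓ (k + 2) := by
  obtain ⟨g, hkg, hg⟩ := hup
  have hg' : insertPeak s a (g + 2) = true := by rwa [insertPeak_add_two (by omega)]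
  exact ⟨s, g + 2, insertPeak_self, hg', closedBefore_insertPeak_self (by omega), by omega,
    hmin _ hg' (by omega)⟩

end BinaryWord

namespace TilingData

variable {a b : BinaryWord} {J ℓ : ℕ → ℕ} {s k p j : ℕ}

theorem exists_up_of_upCount_lt (h : TilingData a b J) (hk : upCount a k < upCount b (k + 1)) :
    ∃ g, k ≤ g ∧ a g = true := by
  by_contra! hall
  obtain ⟨N, hN⟩ := h.eventually_eq
  have ha := upCount_eq_of_down (a := a) (show k ≤ max N (k + 1) by omega)
    fun i hi _ => by simpa using hall i hi
  have hab := (hN (max N (k + 1)) (le_max_left _ _)).2.2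
  have hb := upCount_mono (a := b) (le_max_right N (k + 1))
  omega

theorem hasAscentAround (hℓ : IsPeakGrowth a ℓ) (h : TilingData a b J)
    (hL : HasWordLabel a b J ℓ) (hp : 0 < gap a b p) : HasAscentAround a ℓ p := by
  induction hℓ generalizing b J p with
  | empty ℓ =>
    rw [h.eq_of_false.1, gap] at hp
    omega
  | insert s a ℓ hmin hℓ ih =>
    obtain ⟨b', J', h', rfl, rfl, hL'⟩ := h.exists_eq_spread_of_hasWordLabel hL hmin
    rcases insertion_cases s p with hps | rfl | rfl | ⟨k, hk, rfl⟩
    · rw [gap_spread_of_le hps.le] at hp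
      exact (ih h' hL' hp).of_deletePair hps.le le_rfl le_skipPair
    · rw [gap_spread_of_le le_rfl] at hp
      exact (ih h' hL' hp).of_deletePair le_rfl le_rfl le_skipPair
    · rw [gap_spread_succ] at hp
      exact (ih h' hL' hp).of_deletePair le_rfl (by omega) (by rw [skipPair_of_le le_rfl]; omega)
    · rcases Nat.eq_zero_or_pos (gap a b' k) with hgap | hgap
      · rw [gap_spread_add_two hk] at hp
        exact hmin.hasAscentAround_add_two hk (h'.exists_up_of_upCount_lt (by omega))
      · exact (ih h' hL' hgap).of_deletePair_of_le hk

end TilingData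

namespace BinaryWord

variable {a : BinaryWord} {ℓ : ℕ → ℕ} {s : ℕ}

theorem Contains312.of_deletePair (h : Contains312 a (deletePair s ℓ)) :
    Contains312 (insertPeak s a) ℓ := by
  obtain ⟨f, e, g, hf, he, hg, hfe, heg, hef, hfg⟩ := h
  simp only [deletePair_eq] at hef hfg
  exact ⟨skipPair s f, skipPair s e, skipPair s g, by rwa [insertPeak_skipPair],
    by rwa [insertPeak_skipPair], by rwa [insertPeak_skipPair], hfe.insertPeak, heg.insertPeak,
    hef, hfg⟩

theorem HasAscentAround.contains312_insertPeak (h : HasAscentAround a (deletePair s ℓ) s)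
    (hmin : IsMinimalAt (insertPeak s a) ℓ s) : Contains312 (insertPeak s a) ℓ := by
  obtain ⟨f, g, hf, hg, hclosed, hsg, hfg⟩ := h
  have hfs := hclosed.lt
  rw [deletePair_of_lt hfs, deletePair_of_le hsg] at hfg
  have hf' : insertPeak s a f = true := by rwa [insertPeak_of_lt hfs]
  exact ⟨f, s, g + 2, hf', insertPeak_self, by rwa [insertPeak_add_two hsg],
    hclosed.insertPeak_of_le le_rfl, closedBefore_insertPeak_self (by omega),
    hmin f hf' (by omega), hfg⟩

end BinaryWord

namespace TilingData

variable {a b : BinaryWord} {J ℓ : ℕ → ℕ} {k P j : ℕ}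

theorem contains312 (hℓ : IsPeakGrowth a ℓ) (h : TilingData a b J)
    (hL : HasWordLabel a b J ℓ) (hk : 0 < J k) : Contains312 a ℓ := by
  induction hℓ generalizing b J k with
  | empty ℓ =>
    simp [h.eq_of_false.2] at hk
  | insert s a ℓ hmin hℓ ih =>
    obtain ⟨b', J', h', rfl, rfl, hL'⟩ := h.exists_eq_spread_of_hasWordLabel hL hmin
    rw [insertPair] at hk
    split_ifs at hk
    · exact (ih h' hL' hk).of_deletePair
    · exact (hasAscentAround hℓ h' hL' hk).contains312_insertPeak hmin
    · exact (hasAscentAround hℓ h' hL' hk).contains312_insertPeak hmin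
    · exact (ih h' hL' hk).of_deletePair

theorem sum_lineWeight_range (m : ℕ) (hm : gap a b k ≤ m) :
    ∑ j ∈ Finset.range m, lineWeight a b J k j =
      ∑ j ∈ Finset.range (gap a b k), lineWeight a b J k j :=
  (Finset.sum_subset (Finset.range_mono hm) fun j _ hj =>
    lineWeight_eq_zero (by simpa using hj)).symm

theorem sum_lineWeight_succ_of_down (hk : a k = false) :
    ∑ j ∈ Finset.range (gap a b (k + 1)), lineWeight a b J (k + 1) j =
      gap a b (k + 1) + ∑ j ∈ Finset.range (gap a b k), lineWeight a b J k j := by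
  have hgap : gap a b k ≤ gap a b (k + 1) := by
    have := upCount_le_succ b k
    rw [gap, gap, upCount_succ_of_down hk]
    omega
  rw [Finset.sum_congr rfl fun j hj =>
    lineWeight_of_down (b := b) (J := J) (Finset.mem_range.1 hj) hk, Finset.sum_add_distrib,
    sum_lineWeight_range _ hgap]
  simp

theorem sum_lineWeight_succ_of_up (h : TilingData a b J) (hk : a k = true) :
    ∑ j ∈ Finset.range (gap a b (k + 1)), lineWeight a b J (k + 1) j +
        lineWeight a b J k (J k) =
      gap a b (k + 1) - J k + ∑ j ∈ Finset.range (gap a b k), lineWeight a b J k j := by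
  have hJ := h.joint_le_gap_succ k
  have hgap : gap a b k ≤ gap a b (k + 1) + 1 := by
    have := upCount_le_succ b k
    rw [gap, gap, upCount_succ_of_up hk]
    omega
  rw [← Finset.sum_range_add_sum_Ico _ hJ,
    Finset.sum_congr rfl fun j hj =>
      lineWeight_of_joint ((Finset.mem_range.1 hj).trans_le hJ) hk (Finset.mem_range.1 hj),
    Finset.sum_congr rfl fun j hj => lineWeight_of_not_joint (b := b) (J := J)
      (Finset.mem_Ico.1 hj).2 hk (Finset.mem_Ico.1 hj).1, Finset.sum_add_distrib,
    ← sum_lineWeight_range _ hgap,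
    ← Finset.sum_range_add_sum_Ico _ (show J k ≤ gap a b (k + 1) + 1 by omega),
    Finset.sum_eq_sum_Ico_succ_bot (show J k < gap a b (k + 1) + 1 by omega),
    ← Finset.sum_Ico_add' (fun j => lineWeight a b J k j)]
  simp only [Finset.sum_const, Nat.card_Ico, smul_eq_mul, mul_one]
  ring

theorem sum_lineWeight (h : TilingData a b J) (N : ℕ) :
    ∑ k ∈ Finset.range N, (if a k then gap a b (k + 1) - J k else gap a b (k + 1)) =
      ∑ k ∈ Finset.range N, (if a k then lineWeight a b J k (J k) else 0) +
        ∑ j ∈ Finset.range (gap a b N), lineWeight a b J N j := by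
  induction N with
  | zero => simp [gap]
  | succ k ih =>
    rw [Finset.sum_range_succ, Finset.sum_range_succ, ih]
    cases hk : a k
    · rw [sum_lineWeight_succ_of_down hk, if_neg Bool.false_ne_true, if_neg Bool.false_ne_true]
      ring
    · have := h.sum_lineWeight_succ_of_up hk
      rw [if_pos rfl, if_pos rfl]
      omega

/-- Without joints, every line goes straight to the left up to the top path. -/
theorem lineWeight_eq_sub {P k j : ℕ} (hP : b P = true) (hc : upCount b P = upCount a k + j) :
    lineWeight a b (fun _ => 0) k j = k - P := by
  induction k generalizing j with
  | zero => simp [lineWeight]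
  | succ k ih =>
    rcases le_or_gt (k + 1) P with hk | hk
    · have := upCount_mono (a := b) hk
      rw [lineWeight_eq_zero (by unfold gap; omega)]
      omega
    · have hb := upCount_mono (a := b) (show P + 1 ≤ k + 1 by omega)
      rw [upCount_succ_of_up hP] at hb
      have hj : j < gap a b (k + 1) := by unfold gap; omega
      cases hak : a k
      · rw [upCount_succ_of_down hak] at hc
        rw [lineWeight_of_down hj hak, ih hc]
        omega
      · rw [upCount_succ_of_up hak] at hc
        rw [lineWeight_of_not_joint hj hak (Nat.zero_le _), ih (by omega)]
        omega

end TilingData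

/-! ### Edges of the tree -/

namespace BinaryWord

/-- The binary word of a Dyck path: its steps, followed by down steps. -/
def ofDyck (w : DyckWord) : BinaryWord := fun k => decide (w.toList[k]? = some U)

/-- The up step `i` is matched with the down step `j`, i.e. `j` is the first step after `i` that
returns to the height of `i`. -/
structure IsMatchedPair (a : BinaryWord) (i j : ℕ) : Prop where
  up : a i = true
  lt : i < j
  down : a j = false
  height_eq : height a (j + 1) = height a i
  height_lt : ∀ t, i < t → t ≤ j → height a i < height a t

section Matching

variable {a : BinaryWord} {i j i' j' k t N : ℕ}

theorem upCount_eq_card_filter (a : BinaryWord) (k : ℕ) :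
    upCount a k = ((Finset.range k).filter fun i => a i = true).card := by
  induction k with
  | zero => rfl
  | succ k ih =>
    rw [upCount_succ, ih, Finset.range_add_one, Finset.filter_insert]
    split_ifs
    · rw [Finset.card_insert_of_notMem (by simp)]
    · rfl

theorem sub_upCount_eq_card_filter (a : BinaryWord) (k : ℕ) :
    k - upCount a k = ((Finset.range k).filter fun i => a i = false).card := by
  have hsum := Finset.card_filter_add_card_filter_not (s := Finset.range k) (fun i => a i = true)
  simp only [Finset.card_range, Bool.not_eq_true] at hsum
  have := upCount_eq_card_filter a k
  omega

theorem exists_up_of_height_le_of_lt {c : ℤ} (htj : t ≤ j) (ht : height a t ≤ c)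
    (hj : c < height a j) : ∃ k, t ≤ k ∧ k < j ∧ a k = true ∧ height a k = c := by
  induction j, htj using Nat.le_induction with
  | base => omega
  | succ j htj ih =>
    rcases lt_or_ge c (height a j) with h | h
    · obtain ⟨k, htk, hkj, hup, hk⟩ := ih h
      exact ⟨k, htk, by omega, hup, hk⟩
    · refine ⟨j, htj, by omega, ?_, ?_⟩
      · by_contra hc
        have := height_succ_of_down (Bool.eq_false_of_not_eq_true hc)
        omega
      · cases hup : a j
        · have := height_succ_of_down hup
          omega
        · have := height_succ_of_up hup
          omega

theorem exists_isMatchedPair (hk : a k = true) (hkN : k < N) (hN : height a N ≤ height a k) :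
    ∃ j < N, IsMatchedPair a k j := by
  classical
  have hex : ∃ t, k < t ∧ height a t ≤ height a k := ⟨N, hkN, hN⟩
  obtain ⟨hlt, hle⟩ := Nat.find_spec hex
  have hmin : ∀ t, k < t → t < Nat.find hex → height a k < height a t := fun t hkt htf =>
    not_le.1 fun h => Nat.find_min hex htf ⟨hkt, h⟩
  have hfN : Nat.find hex ≤ N := Nat.find_min' hex ⟨hkN, hN⟩
  obtain ⟨j, hj⟩ : ∃ j, Nat.find hex = j + 1 := ⟨Nat.find hex - 1, by omega⟩
  rw [hj] at hlt hle hmin hfN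
  have hkj : k < j := by
    rcases Nat.lt_succ_iff_lt_or_eq.1 hlt with h | rfl
    · exact h
    · rw [height_succ_of_up hk] at hle
      omega
  have hgt := hmin j hkj (by omega)
  have hdown : a j = false := by
    by_contra hc
    rw [height_succ_of_up (Bool.eq_true_of_not_eq_false hc)] at hle
    omega
  have := height_succ_of_down hdown
  exact ⟨j, by omega, hk, hkj, hdown, by omega, fun t hkt htj => hmin t hkt (by omega)⟩

theorem IsMatchedPair.closing_le_of_opening_le (h : IsMatchedPair a i j)
    (h' : IsMatchedPair a i' j') (hii' : i ≤ i') (hi'j : i' ≤ j) : j' ≤ j := by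
  by_contra hlt
  have hsucc := h'.height_lt (j + 1) (by omega) (by omega)
  rcases hii'.eq_or_lt with rfl | hlt'
  · exact absurd h.height_eq hsucc.ne'
  · have := h.height_lt i' hlt' hi'j
    have := h.height_eq
    omega

theorem IsMatchedPair.closing_unique (h : IsMatchedPair a i j) (h' : IsMatchedPair a i j') :
    j = j' :=
  (h'.closing_le_of_opening_le h le_rfl h'.lt.le).antisymm
    (h.closing_le_of_opening_le h' le_rfl h.lt.le)

theorem IsMatchedPair.closedBefore_iff (h : IsMatchedPair a i j) : ClosedBefore a i k ↔ j < k := by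
  refine ⟨fun ⟨t, hit, htk, hle⟩ => ?_, fun hjk => ⟨j + 1, by have := h.lt; omega, hjk,
    h.height_eq.le⟩⟩
  by_contra hkj
  exact absurd hle (h.height_lt t hit (by omega)).not_ge

end Matching

section OfDyck

variable {w : DyckWord} {i j k : ℕ}

theorem count_U_add_count_D (l : List DyckStep) : l.count U + l.count D = l.length := by
  induction l with
  | nil => rfl
  | cons x l ih => cases x <;> simp <;> omega

theorem count_U_take (w : DyckWord) (k : ℕ) : (w.toList.take k).count U = upCount (ofDyck w) k := by
  induction k with
  | zero => simp
  | succ k ih =>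
    rw [List.take_add_one, List.count_append, ih, upCount_succ, ofDyck]
    cases h : w.toList[k]? with
    | none => simp
    | some x => cases x <;> simp

theorem count_D_take (hk : k ≤ w.toList.length) :
    (w.toList.take k).count D = k - upCount (ofDyck w) k := by
  have h := count_U_add_count_D (w.toList.take k)
  rw [List.length_take, min_eq_left hk, count_U_take] at h
  omega

theorem ofDyck_of_length_le (hk : w.toList.length ≤ k) : ofDyck w k = false := by
  simp [ofDyck, hk]

theorem lt_length_of_ofDyck (hk : ofDyck w k = true) : k < w.toList.length := by
  by_contra h
  rw [ofDyck_of_length_le (by omega)] at hk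
  exact absurd hk (by decide)

theorem upCount_ofDyck_length (w : DyckWord) :
    upCount (ofDyck w) w.toList.length = w.semilength := by
  rw [← count_U_take, List.take_length]; rfl

theorem upCount_ofDyck_le_semilength (w : DyckWord) (k : ℕ) :
    upCount (ofDyck w) k ≤ w.semilength := by
  rw [← count_U_take]
  exact (List.take_sublist _ _).count_le _

theorem height_ofDyck_nonneg (hk : k ≤ w.toList.length) : 0 ≤ height (ofDyck w) k := by
  have h := w.count_D_le_count_U k
  rw [count_D_take hk, count_U_take] at h
  unfold height; omega

theorem height_ofDyck_length (w : DyckWord) : height (ofDyck w) w.toList.length = 0 := by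
  rw [height, upCount_ofDyck_length, ← w.two_mul_semilength_eq_length]
  push_cast
  ring

theorem getElem?_eq_U_iff : w.toList[k]? = some U ↔ ofDyck w k = true := by simp [ofDyck]

theorem getElem?_eq_D_iff :
    w.toList[k]? = some D ↔ k < w.toList.length ∧ ofDyck w k = false := by
  rcases lt_or_ge k w.toList.length with hk | hk
  · simp only [ofDyck, List.getElem?_eq_getElem hk, hk, true_and]
    cases w.toList[k] <;> simp
  · simp [hk]

theorem isBalancedPair_iff (hij : i ≤ j) (hj : j < w.toList.length) :
    w.IsBalancedPair i j ↔
      ofDyck w i = true ∧ height (ofDyck w) (j + 1) = height (ofDyck w) i := by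
  rw [DyckWord.IsBalancedPair, getElem?_eq_U_iff]
  refine and_congr_right fun _ => ?_
  have happ : w.toList.take (j + 1) = w.toList.take i ++ w.segment i j := by
    rw [DyckWord.segment, ← List.take_add]; congr 1; omega
  have hU := congrArg (List.count U) happ
  have hD := congrArg (List.count D) happ
  rw [List.count_append, count_U_take, count_U_take] at hU
  rw [List.count_append, count_D_take (by omega), count_D_take (by omega)] at hD
  have := upCount_le (a := ofDyck w) (j + 1)
  have := upCount_le (a := ofDyck w) i
  unfold height
  push_cast
  omega

theorem isChordPair_iff : w.IsChordPair i j ↔ IsMatchedPair (ofDyck w) i j := by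
  rw [DyckWord.IsChordPair, getElem?_eq_D_iff]
  constructor
  · rintro ⟨⟨hj, hdown⟩, hij, hbal, hmax⟩
    obtain ⟨hup, hret⟩ := (isBalancedPair_iff hij.le hj).1 hbal
    refine ⟨hup, hij, hdown, hret, fun t hit htj => ?_⟩
    by_contra hle
    have hsucc := height_succ_of_down hdown
    obtain ⟨k, htk, hkj, hkup, hk⟩ :=
      exists_up_of_height_le_of_lt htj (not_lt.1 hle) (show _ < height (ofDyck w) j by omega)
    exact hmax k (by omega) hkj ((isBalancedPair_iff hkj.le hj).2 ⟨hkup, hret.trans hk.symm⟩)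
  · intro h
    have hj : j < w.toList.length := by
      by_contra hle
      have hi := lt_length_of_ofDyck h.up
      have := h.height_lt w.toList.length hi (by omega)
      rw [height_ofDyck_length] at this
      exact this.not_ge (height_ofDyck_nonneg hi.le)
    refine ⟨⟨hj, h.down⟩, h.lt, (isBalancedPair_iff h.lt.le hj).2 ⟨h.up, h.height_eq⟩, ?_⟩
    intro k hik hkj hbal
    have hk := ((isBalancedPair_iff hkj.le hj).1 hbal).2
    have := h.height_lt k hik hkj.le
    rw [← hk, h.height_eq] at this
    exact this.false

end OfDyck

end BinaryWord

namespace TreeEdge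

variable {w : DyckWord} {e f : TreeEdge w}

theorem isMatchedPair (e : TreeEdge w) : IsMatchedPair (ofDyck w) e.opening e.closing :=
  isChordPair_iff.1 e.2

theorem opening_lt_closing (e : TreeEdge w) : e.opening < e.closing := e.isMatchedPair.lt

theorem ofDyck_opening (e : TreeEdge w) : ofDyck w e.opening = true := e.isMatchedPair.up

theorem ofDyck_closing (e : TreeEdge w) : ofDyck w e.closing = false := e.isMatchedPair.down

theorem row_eq_upCount (e : TreeEdge w) : e.row = upCount (ofDyck w) e.opening := count_U_take w _

theorem exists_opening_eq {k : ℕ} (hk : ofDyck w k = true) : ∃ e : TreeEdge w, e.opening = k := by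
  have hlen := lt_length_of_ofDyck hk
  obtain ⟨j, hj, hmatch⟩ := exists_isMatchedPair hk hlen
    (by rw [height_ofDyck_length]; exact height_ofDyck_nonneg hlen.le)
  exact ⟨⟨(⟨k, hlen⟩, ⟨j, hj⟩), isChordPair_iff.2 hmatch⟩, rfl⟩

theorem opening_injective : Function.Injective (opening : TreeEdge w → ℕ) := fun e f h =>
  Subtype.ext (Prod.ext (Fin.ext h)
    (Fin.ext (e.isMatchedPair.closing_unique (h ▸ f.isMatchedPair))))

theorem isBelow_or_strictlyLeft (h : f.opening < e.opening) : e.IsBelow f ∨ f.StrictlyLeft e := by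
  by_cases hleft : f.closing < e.opening
  · exact Or.inr hleft
  · refine Or.inl ⟨h, lt_of_le_of_ne (f.isMatchedPair.closing_le_of_opening_le e.isMatchedPair h.le
      (not_lt.1 hleft)) fun hc => ?_⟩
    have hf := f.isMatchedPair.height_eq
    have he := e.isMatchedPair.height_eq
    have := f.isMatchedPair.height_lt e.opening h (not_lt.1 hleft)
    rw [← hc, he] at hf
    omega

theorem closing_injective : Function.Injective (closing : TreeEdge w → ℕ) := by
  have hle : ∀ e f : TreeEdge w, e.closing = f.closing → ¬ e.opening < f.opening := by
    intro e f h hlt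
    rcases isBelow_or_strictlyLeft hlt with hbelow | hleft
    · exact hbelow.2.ne h.symm
    · exact (h ▸ hleft : f.closing < f.opening).not_gt f.opening_lt_closing
  exact fun e f h => opening_injective
    (le_antisymm (not_lt.1 (hle f e h.symm)) (not_lt.1 (hle e f h)))

theorem StrictlyLeft.opening_lt (h : e.StrictlyLeft f) : e.opening < f.opening :=
  e.opening_lt_closing.trans h

theorem IsBelow.not_strictlyLeft (h : e.IsBelow f) : ¬ f.StrictlyLeft e := fun hleft =>
  (e.opening_lt_closing.trans h.2).not_gt hleft

theorem strictlyLeft_iff_closedBefore :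
    e.StrictlyLeft f ↔ ClosedBefore (ofDyck w) e.opening f.opening :=
  e.isMatchedPair.closedBefore_iff.symm

theorem row_lt_row (h : e.opening < f.opening) : e.row < f.row := by
  rw [row_eq_upCount, row_eq_upCount, Nat.lt_iff_add_one_le,
    ← upCount_succ_of_up e.ofDyck_opening]
  exact upCount_mono h

theorem row_lt_row_iff : e.row < f.row ↔ e.opening < f.opening := by
  refine ⟨fun h => ?_, row_lt_row⟩
  by_contra hle
  rcases (not_lt.1 hle).eq_or_lt with heq | hlt
  · rw [opening_injective heq] at h
    exact h.false
  · exact h.not_gt (row_lt_row hlt)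

theorem row_injective : Function.Injective (row : TreeEdge w → ℕ) := fun _ _ h =>
  opening_injective <| le_antisymm
    (not_lt.1 fun hlt => (row_lt_row hlt).ne' h) (not_lt.1 fun hlt => (row_lt_row hlt).ne h)

theorem row_lt_semilength (e : TreeEdge w) : e.row < w.semilength := by
  rw [row_eq_upCount, Nat.lt_iff_add_one_le, ← upCount_succ_of_up e.ofDyck_opening]
  exact upCount_ofDyck_le_semilength w _

theorem exists_row_eq {r : ℕ} (hr : r < w.semilength) : ∃ e : TreeEdge w, e.row = r := by
  have hex : ∃ k, r < upCount (ofDyck w) k :=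
    ⟨w.toList.length, by rwa [upCount_ofDyck_length]⟩
  obtain ⟨k, hk⟩ : ∃ k, Nat.find hex = k + 1 :=
    Nat.exists_eq_succ_of_ne_zero fun h => by simpa [h] using Nat.find_spec hex
  have hgt : r < upCount (ofDyck w) (k + 1) := hk ▸ Nat.find_spec hex
  have hle : upCount (ofDyck w) k ≤ r := not_lt.1 (Nat.find_min hex (by omega))
  cases hup : ofDyck w k
  · rw [upCount_succ_of_down hup] at hgt
    omega
  · rw [upCount_succ_of_up hup] at hgt
    obtain ⟨e, rfl⟩ := exists_opening_eq hup
    exact ⟨e, by rw [row_eq_upCount]; omega⟩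

/-- The bijection of the edges with the rows of the path. -/
noncomputable def rowEquiv (w : DyckWord) : TreeEdge w ≃ Fin w.semilength :=
  Equiv.ofBijective (fun e => ⟨e.row, e.row_lt_semilength⟩)
    ⟨fun _ _ h => row_injective (Fin.mk.inj_iff.1 h),
      fun r => (exists_row_eq r.2).imp fun _ he => Fin.ext he⟩

open Classical in
/-- The function on the positions of a word that takes the value `g e` at the up step of an edge `e`
and the value `0` elsewhere. -/
noncomputable def onSteps (g : TreeEdge w → ℕ) (k : ℕ) : ℕ :=
  if h : ∃ e : TreeEdge w, e.opening = k then g h.choose else 0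

theorem onSteps_opening (g : TreeEdge w → ℕ) (e : TreeEdge w) : onSteps g e.opening = g e := by
  have h : ∃ f : TreeEdge w, f.opening = e.opening := ⟨e, rfl⟩
  rw [onSteps, dif_pos h, opening_injective h.choose_spec]

theorem sum_opening (w : DyckWord) (g : ℕ → ℕ) :
    ∑ k ∈ Finset.range w.toList.length, (if ofDyck w k then g k else 0) =
      ∑ e : TreeEdge w, g e.opening := by
  rw [← Finset.sum_filter]
  refine (Finset.sum_bij (fun e _ => opening e) (fun e _ => ?_)
    (fun e _ f _ h => opening_injective h) (fun k hk => ?_) fun _ _ => rfl).symm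
  · simp [e.ofDyck_opening, lt_length_of_ofDyck e.ofDyck_opening]
  · obtain ⟨e, he⟩ := exists_opening_eq (Finset.mem_filter.1 hk).2
    exact ⟨e, Finset.mem_univ _, he⟩

theorem upCount_and_eq_card (k : ℕ) (p : TreeEdge w → Prop) [DecidablePred p] (c : BinaryWord)
    (hc : ∀ e : TreeEdge w, c e.opening = true ↔ p e) :
    upCount (fun i => ofDyck w i && c i) k =
      (Finset.univ.filter fun e : TreeEdge w => e.opening < k ∧ p e).card := by
  rw [upCount_eq_card_filter]
  refine (Finset.card_bij (fun e _ => opening e) (fun e he => ?_)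
    (fun e _ f _ h => opening_injective h) fun i hi => ?_).symm
  · simp only [Finset.mem_filter, Finset.mem_univ, true_and, Finset.mem_range,
      Bool.and_eq_true] at he ⊢
    exact ⟨he.1, e.ofDyck_opening, (hc e).2 he.2⟩
  · simp only [Finset.mem_filter, Finset.mem_range, Bool.and_eq_true] at hi
    obtain ⟨e, rfl⟩ := exists_opening_eq hi.2.1
    exact ⟨e, by simpa using ⟨hi.1, (hc e).1 hi.2.2⟩, rfl⟩

/-- There are as many edges as down steps, so every down step closes an edge. -/
theorem exists_closing_eq {k : ℕ} (hk : k < w.toList.length) (hdown : ofDyck w k = false) :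
    ∃ e : TreeEdge w, e.closing = k := by
  classical
  have himage : Finset.univ.image (closing : TreeEdge w → ℕ) =
      (Finset.range w.toList.length).filter fun i => ofDyck w i = false := by
    apply Finset.eq_of_subset_of_card_le
    · intro i hi
      obtain ⟨e, -, rfl⟩ := Finset.mem_image.1 hi
      exact Finset.mem_filter.2 ⟨Finset.mem_range.2 e.1.2.2, e.ofDyck_closing⟩
    · rw [← sub_upCount_eq_card_filter, upCount_ofDyck_length,
        Finset.card_image_of_injective _ closing_injective, Finset.card_univ,
        Fintype.card_congr (rowEquiv w), Fintype.card_fin, ← w.two_mul_semilength_eq_length]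
      omega
  have hmem : k ∈ Finset.univ.image (closing : TreeEdge w → ℕ) := by
    rw [himage]
    exact Finset.mem_filter.2 ⟨Finset.mem_range.2 hk, hdown⟩
  obtain ⟨e, -, he⟩ := Finset.mem_image.1 hmem
  exact ⟨e, he⟩

instance : DecidableRel (StrictlyLeft (w := w)) := fun e f =>
  inferInstanceAs (Decidable (e.closing < f.opening))

instance : DecidableRel (IsBelow (w := w)) := fun e f =>
  inferInstanceAs (Decidable (f.opening < e.opening ∧ e.closing < f.closing))

/-- The number of edges strictly left to `e`. -/
noncomputable def leftCount (e : TreeEdge w) : ℕ :=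
  (Finset.univ.filter fun f : TreeEdge w => f.StrictlyLeft e).card

theorem leftCount_eq (e : TreeEdge w) : e.leftCount = e.opening - e.row := by
  rw [row_eq_upCount, sub_upCount_eq_card_filter]
  refine Finset.card_bij (fun f _ => closing f) (fun f hf => ?_)
    (fun f _ g _ h => closing_injective h) fun i hi => ?_
  · simp only [Finset.mem_filter, Finset.mem_univ, true_and, Finset.mem_range] at hf ⊢
    exact ⟨hf, f.ofDyck_closing⟩
  · simp only [Finset.mem_filter, Finset.mem_range] at hi
    obtain ⟨f, rfl⟩ :=
      exists_closing_eq (hi.1.trans (lt_length_of_ofDyck e.ofDyck_opening)) hi.2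
    exact ⟨f, by simpa using (show f.StrictlyLeft e from hi.1), rfl⟩

end TreeEdge

namespace DecreasingLabel

variable {w : DyckWord}

/-- The label as a function on the positions of the up steps. -/
noncomputable def wordLabel (L : DecreasingLabel w) : ℕ → ℕ := TreeEdge.onSteps fun e => (L e : ℕ)

theorem wordLabel_opening (L : DecreasingLabel w) (e : TreeEdge w) :
    L.wordLabel e.opening = L e :=
  TreeEdge.onSteps_opening _ e

theorem isDecreasingLabel (L : DecreasingLabel w) : IsDecreasingLabel (ofDyck w) L.wordLabel := by
  constructor
  · intro i k hi hk h
    obtain ⟨e, rfl⟩ := TreeEdge.exists_opening_eq hi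
    obtain ⟨f, rfl⟩ := TreeEdge.exists_opening_eq hk
    rw [wordLabel_opening, wordLabel_opening] at h
    rw [L.1.injective (Fin.ext h)]
  · intro i k hik hi hk hopen
    obtain ⟨e, rfl⟩ := TreeEdge.exists_opening_eq hi
    obtain ⟨f, rfl⟩ := TreeEdge.exists_opening_eq hk
    rw [wordLabel_opening, wordLabel_opening]
    rw [← TreeEdge.strictlyLeft_iff_closedBefore] at hopen
    exact L.2 f e ((TreeEdge.isBelow_or_strictlyLeft hik).resolve_right hopen)

theorem isPeakGrowth (L : DecreasingLabel w) : IsPeakGrowth (ofDyck w) L.wordLabel :=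
  L.isDecreasingLabel.isPeakGrowth ⟨_, fun _ => ofDyck_of_length_le⟩

theorem wordCode_eq_code (L : DecreasingLabel w) (e : TreeEdge w) :
    wordCode (ofDyck w) L.wordLabel e.opening = L.code e := by
  classical
  rw [wordCode, TreeEdge.upCount_and_eq_card _ fun f => L f < L e]
  · unfold code
    congr
  · intro f
    simp only [wordLabel_opening, decide_eq_true_eq, Fin.lt_def]

end DecreasingLabel

/-! ### Lehmer codes and the order of labels -/

namespace TreeEdge

variable {w : DyckWord} {e f g : TreeEdge w}

theorem StrictlyLeft.trans (hef : e.StrictlyLeft f) (hfg : f.StrictlyLeft g) : e.StrictlyLeft g :=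
  lt_trans hef hfg.opening_lt

theorem StrictlyLeft.ne (h : e.StrictlyLeft f) : e ≠ f := by
  rintro rfl
  exact h.opening_lt.false

theorem ne_of_opening_lt (h : e.opening < f.opening) : e ≠ f := by
  rintro rfl
  exact h.false

theorem strictlyLeft_of_isBelow (hef : e.StrictlyLeft f) (hgf : g.IsBelow f) : e.StrictlyLeft g :=
  lt_trans hef hgf.1

/-- The numbers `c` of boxes in the rows above `w` leave a path: the horizontal coordinates
`leftCount - c` of its up steps are weakly increasing. -/
def RowMonotone (c : TreeEdge w → ℕ) : Prop :=
  ∀ e f : TreeEdge w, e.opening < f.opening → e.leftCount + c f ≤ f.leftCount + c e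

end TreeEdge

open TreeEdge

namespace DecreasingLabel

variable {w : DyckWord} {L L' L₀ M : DecreasingLabel w} {e f g l r : TreeEdge w}

section Code

theorem opening_lt_and_lt_iff :
    f.opening < e.opening ∧ L f < L e ↔ f.StrictlyLeft e ∧ L f < L e := by
  refine and_congr_left fun hlt => ⟨fun h => ?_, StrictlyLeft.opening_lt⟩
  exact (isBelow_or_strictlyLeft h).resolve_left fun hbelow => (L.2 e f hbelow).not_gt hlt

theorem code_eq_card_strictlyLeft (L : DecreasingLabel w) (e : TreeEdge w) :
    L.code e = (Finset.univ.filter fun f : TreeEdge w => f.StrictlyLeft e ∧ L f < L e).card := by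
  simp only [code, opening_lt_and_lt_iff]

/-- The number of edges strictly left to `e` with a larger label. -/
noncomputable def leftLarger (L : DecreasingLabel w) (e : TreeEdge w) : ℕ :=
  (Finset.univ.filter fun f : TreeEdge w => f.StrictlyLeft e ∧ L e < L f).card

theorem code_add_leftLarger (L : DecreasingLabel w) (e : TreeEdge w) :
    L.code e + L.leftLarger e = e.leftCount := by
  rw [code_eq_card_strictlyLeft, leftLarger, leftCount, ← Finset.card_filter_add_card_filter_not
    (s := Finset.univ.filter fun f : TreeEdge w => f.StrictlyLeft e) (fun f => L f < L e),
    Finset.filter_filter, Finset.filter_filter]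
  congr 2
  refine Finset.filter_congr fun f _ => and_congr_right fun hf => ?_
  exact ⟨fun h => h.not_gt, fun h => lt_of_le_of_ne (not_lt.1 h) (L.1.injective.ne hf.ne.symm)⟩

theorem card_label_lt (L : DecreasingLabel w) (v : Fin w.semilength) :
    (Finset.univ.filter fun f : TreeEdge w => L f < v).card = v := by
  rw [← Fin.card_Iio v]
  exact Finset.card_bij (fun f _ => L f) (fun f hf => by simpa using hf)
    (fun f _ g _ h => L.1.injective h) fun x hx => ⟨L.1.symm x, by simpa using hx, by simp⟩

theorem eq_of_lt_iff_lt
    (h : ∀ e f : TreeEdge w, f.opening < e.opening → (L f < L e ↔ L' f < L' e)) : L = L' := by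
  have hall : ∀ e f : TreeEdge w, L f < L e ↔ L' f < L' e := by
    intro e f
    rcases lt_trichotomy f.opening e.opening with hfe | hfe | hef
    · exact h e f hfe
    · rw [opening_injective hfe]
      simp only [lt_self_iff_false]
    · have hne := ne_of_opening_lt hef
      have hle := not_congr (h f e hef)
      rwa [not_lt, not_lt, le_iff_lt_or_eq, le_iff_lt_or_eq,
        or_iff_left (L.1.injective.ne hne.symm), or_iff_left (L'.1.injective.ne hne.symm)] at hle
  refine Subtype.ext (Equiv.ext fun e => Fin.ext ?_)
  have hcard := L.card_label_lt (L e)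
  simp only [hall e] at hcard
  exact hcard.symm.trans (L'.card_label_lt (L' e))

theorem lt_iff_lt_of_code_eq (h : ∀ e, L.code e = L'.code e) (e f : TreeEdge w)
    (hfe : f.opening < e.opening) : L f < L e ↔ L' f < L' e := by
  induction hn : e.opening using Nat.strong_induction_on generalizing e f with
  | _ n ih =>
    have ih' : ∀ a b : TreeEdge w, b.opening < a.opening → a.opening < e.opening →
        (L b < L a ↔ L' b < L' a) := fun a b hba hae => ih a.opening (hn ▸ hae) a b hba rfl
    suffices hsets : (Finset.univ.filter fun f : TreeEdge w => f.opening < e.opening ∧ L f < L e) =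
        Finset.univ.filter fun f : TreeEdge w => f.opening < e.opening ∧ L' f < L' e by
      simpa [hfe] using Finset.ext_iff.1 hsets f
    by_contra hne
    have hcard := h e
    unfold code at hcard
    obtain ⟨a, ha, ha'⟩ := Finset.not_subset.1 fun hs =>
      hne (Finset.eq_of_subset_of_card_le hs hcard.ge)
    obtain ⟨b, hb, hb'⟩ := Finset.not_subset.1 fun hs =>
      hne (Finset.eq_of_subset_of_card_le hs hcard.le).symm
    simp only [Finset.mem_filter, Finset.mem_univ, true_and, not_and, not_lt] at ha ha' hb hb'
    have hab : L a < L b := ha.2.trans_le (hb' hb.1)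
    have hba : L' b < L' a := hb.2.trans_le (ha' ha.1)
    rcases lt_trichotomy a.opening b.opening with hlt | heq | hgt
    · exact ((ih' b a hlt hb.1).1 hab).not_gt hba
    · exact (opening_injective heq ▸ hab).false
    · exact ((ih' a b hgt ha.1).2 hba).not_gt hab

theorem code_injective : Function.Injective (code : DecreasingLabel w → TreeEdge w → ℕ) :=
  fun _ _ h => eq_of_lt_iff_lt (lt_iff_lt_of_code_eq (congrFun h))

end Code

section Order

variable {S : TreeEdge w → Prop} [DecidablePred S]

theorem CoveredBy.exists_eq_swap (h : L.CoveredBy L') :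
    ∃ l r : TreeEdge w, l.StrictlyLeft r ∧ L l < L r ∧ ∀ f, L' f = L (Equiv.swap l r f) := by
  obtain ⟨l, r, hleft, hother, hlt, hr, hl, -⟩ := h
  refine ⟨l, r, hleft, hlt, fun f => ?_⟩
  rcases eq_or_ne f l with rfl | hfl
  · rw [Equiv.swap_apply_left, hl]
  · rcases eq_or_ne f r with rfl | hfr
    · rw [Equiv.swap_apply_right, hr]
    · rw [Equiv.swap_apply_of_ne_of_ne hfl hfr, hother f hfl hfr]

theorem CoveredBy.card_filter_le (h : L.CoveredBy L')
    (hS : ∀ l r : TreeEdge w, l.StrictlyLeft r → S r → S l) (v : Fin w.semilength) :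
    (Finset.univ.filter fun f : TreeEdge w => S f ∧ L' f < v).card ≤
      (Finset.univ.filter fun f : TreeEdge w => S f ∧ L f < v).card := by
  obtain ⟨l, r, hleft, hlt, hswap⟩ := h.exists_eq_swap
  by_cases hr : S r
  · refine Finset.card_le_card_of_injOn (Equiv.swap l r) (fun f hf => ?_)
      (Equiv.injective _).injOn
    simp only [Finset.coe_filter, Finset.mem_univ, true_and, Set.mem_ofPred_eq] at hf ⊢
    refine ⟨?_, hswap f ▸ hf.2⟩
    rw [Equiv.swap_apply_def]
    split_ifs
    exacts [hr, hS l r hleft hr, hf.1]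
  · refine Finset.card_le_card fun f hf => ?_
    simp only [Finset.mem_filter, Finset.mem_univ, true_and, hswap] at hf ⊢
    refine ⟨hf.1, ?_⟩
    rcases eq_or_ne f l with rfl | hfl
    · exact hlt.trans (Equiv.swap_apply_left f r ▸ hf.2)
    · have hfr : f ≠ r := by rintro rfl; exact hr hf.1
      exact Equiv.swap_apply_of_ne_of_ne hfl hfr ▸ hf.2

theorem Le.card_filter_le (h : L.Le L')
    (hS : ∀ l r : TreeEdge w, l.StrictlyLeft r → S r → S l) (v : Fin w.semilength) :
    (Finset.univ.filter fun f : TreeEdge w => S f ∧ L' f < v).card ≤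
      (Finset.univ.filter fun f : TreeEdge w => S f ∧ L f < v).card := by
  induction h with
  | refl => exact le_rfl
  | tail _ hcov ih => exact (hcov.card_filter_le hS v).trans ih

theorem card_filter_add_card_filter_not (L : DecreasingLabel w) (S : TreeEdge w → Prop)
    [DecidablePred S] (v : Fin w.semilength) :
    (Finset.univ.filter fun f : TreeEdge w => S f ∧ L f < v).card +
      (Finset.univ.filter fun f : TreeEdge w => ¬ S f ∧ L f < v).card = v := by
  rw [← L.card_label_lt v, ← Finset.card_filter_add_card_filter_not
    (s := Finset.univ.filter fun f : TreeEdge w => L f < v) S, Finset.filter_filter,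
    Finset.filter_filter]
  simp only [and_comm]

omit [DecidablePred S] in
theorem Le.label_lt (h : L₀.Le L) {v : Fin w.semilength}
    (hS : ∀ l r : TreeEdge w, l.StrictlyLeft r → S r → S l) (hv : ∀ g, ¬ S g → L₀ g < v)
    (he : ¬ S e) : L e < v := by
  classical
  have hL := L.card_filter_add_card_filter_not S v
  have hL₀ := L₀.card_filter_add_card_filter_not S v
  have hle := h.card_filter_le hS v
  have hsub : ∀ M : DecreasingLabel w, (Finset.univ.filter fun f : TreeEdge w => ¬ S f ∧ M f < v) ⊆
      Finset.univ.filter fun f : TreeEdge w => ¬ S f := fun M =>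
    Finset.monotone_filter_right _ fun _ _ hf => hf.1
  have hall : (Finset.univ.filter fun f : TreeEdge w => ¬ S f ∧ L₀ f < v) =
      Finset.univ.filter fun f : TreeEdge w => ¬ S f :=
    (hsub L₀).antisymm fun f hf => by
      simp only [Finset.mem_filter, Finset.mem_univ, true_and] at hf ⊢
      exact ⟨hf, hv f hf⟩
  have heq := Finset.eq_of_subset_of_card_le (hsub L) (by rw [← hall]; omega)
  have hmem : e ∈ Finset.univ.filter fun f : TreeEdge w => ¬ S f := by simpa using he
  rw [← heq] at hmem
  exact (Finset.mem_filter.1 hmem).2.2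

theorem label_lt_of_not_contains312 (h : ¬ L.Contains312) (hleft : f.StrictlyLeft e)
    (hlt : L e < L f) (hg : e.opening ≤ g.opening) : L g < L f := by
  rcases hg.eq_or_lt with heq | heg
  · rwa [← opening_injective heq]
  · rcases isBelow_or_strictlyLeft heg with hbelow | hright
    · exact (L.2 g e hbelow).trans hlt
    · by_contra hle
      exact h ⟨g, e, f, hright, hleft, hlt, lt_of_le_of_ne (not_lt.1 hle)
        (L.1.injective.ne (ne_of_opening_lt (hleft.opening_lt.trans heg)))⟩

theorem Le.code_le (h₀ : ¬ L₀.Contains312) (h : L₀.Le L) (e : TreeEdge w) :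
    L.code e ≤ L₀.code e := by
  rw [code_eq_card_strictlyLeft, code_eq_card_strictlyLeft]
  refine (h.card_filter_le (fun l r hlr hre => hlr.trans hre) (L e)).trans
    (Finset.card_le_card fun f hf => ?_)
  simp only [Finset.mem_filter, Finset.mem_univ, true_and] at hf ⊢
  obtain ⟨hleft, hfe⟩ := hf
  refine ⟨hleft, ?_⟩
  by_contra hle
  have hlt : L₀ e < L₀ f := lt_of_le_of_ne (not_lt.1 hle) (L₀.1.injective.ne hleft.ne.symm)
  have hbelow : L e < L₀ f := h.label_lt (S := fun g => g.opening < e.opening)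
    (fun l r hlr hre => hlr.opening_lt.trans hre)
    (fun g hg => label_lt_of_not_contains312 h₀ hleft hlt (not_lt.1 hg)) (lt_irrefl _)
  exact hbelow.not_gt hfe

end Order

section Exchange

/-- Among the edges before `r` with a smaller label, `l` is the one with the largest label. -/
structure IsPredecessor (M : DecreasingLabel w) (l r : TreeEdge w) : Prop where
  opening_lt : l.opening < r.opening
  lt : M l < M r
  le_of_lt : ∀ f : TreeEdge w, f.opening < r.opening → M f < M r → M f ≤ M l

theorem exists_isPredecessor (hr : 0 < M.code r) : ∃ l, M.IsPredecessor l r := by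
  obtain ⟨l, hl, hmax⟩ := Finset.exists_max_image
    (Finset.univ.filter fun f : TreeEdge w => f.opening < r.opening ∧ M f < M r) M
    (Finset.card_pos.1 hr)
  simp only [Finset.mem_filter, Finset.mem_univ, true_and, and_imp] at hl hmax
  exact ⟨l, hl.1, hl.2, hmax⟩

namespace IsPredecessor

variable (h : M.IsPredecessor l r)

include h

theorem strictlyLeft : l.StrictlyLeft r := (opening_lt_and_lt_iff.1 ⟨h.opening_lt, h.lt⟩).1

theorem lt_of_lt (hfr : f.opening < r.opening) (hlf : M l < M f) : M r < M f :=
  lt_of_le_of_ne (not_lt.1 fun hlt => (h.le_of_lt f hfr hlt).not_gt hlf)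
    (M.1.injective.ne (ne_of_opening_lt hfr).symm)

theorem lt_iff_lt (hfl : f ≠ l) (hfr : f.opening < r.opening) : M f < M r ↔ M f < M l :=
  ⟨fun hlt => lt_of_le_of_ne (h.le_of_lt f hfr hlt) (M.1.injective.ne hfl), fun hlt =>
    hlt.trans h.lt⟩

/-- If `g` is the first edge below `r` with a label above `M l`, then the edges between the up steps
of `r` and `g` have smaller labels than `g`. -/
theorem leftLarger_eq (hgr : g.IsBelow r) (hlg : M l < M g)
    (hmin : ∀ f : TreeEdge w, f.IsBelow r → M l < M f → g.opening ≤ f.opening) :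
    M.leftLarger g = M.leftLarger r := by
  unfold leftLarger
  congr 1
  refine Finset.filter_congr fun f _ => ⟨fun ⟨hfg, hlt⟩ => ?_, fun ⟨hfr, hlt⟩ =>
    ⟨strictlyLeft_of_isBelow hfr hgr, (M.2 g r hgr).trans hlt⟩⟩
  rcases lt_trichotomy f.opening r.opening with hfr | hfr | hrf
  · refine ⟨(isBelow_or_strictlyLeft hfr).resolve_left fun hbelow => ?_,
      h.lt_of_lt hfr (hlg.trans hlt)⟩
    exact (hbelow.2.trans hfg).not_gt (g.opening_lt_closing.trans hgr.2)
  · exact absurd hfg (opening_injective hfr ▸ hgr.not_strictlyLeft)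
  · rcases isBelow_or_strictlyLeft hrf with hbelow | hleft
    · exact absurd hfg.opening_lt (hmin f hbelow (hlg.trans hlt)).not_gt
    · exact absurd (hleft.trans hfg) hgr.not_strictlyLeft

theorem lt_of_isBelow {c : TreeEdge w → ℕ} (hc : RowMonotone c) (hr : c r < M.code r)
    (hlast : ∀ g : TreeEdge w, r.opening < g.opening → c g = M.code g) (hg : g.IsBelow r) :
    M g < M l := by
  by_contra hle
  have hlg : M l < M g := lt_of_le_of_ne (not_lt.1 hle)
    (M.1.injective.ne (ne_of_opening_lt (h.opening_lt.trans hg.1)))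
  obtain ⟨f, hf, hmin⟩ := Finset.exists_min_image
    (Finset.univ.filter fun f : TreeEdge w => f.IsBelow r ∧ M l < M f) opening
    ⟨g, by simpa using ⟨hg, hlg⟩⟩
  simp only [Finset.mem_filter, Finset.mem_univ, true_and, and_imp] at hf hmin
  have hlarger := h.leftLarger_eq hf.1 hf.2 hmin
  have hcode_f := M.code_add_leftLarger f
  have hcode_r := M.code_add_leftLarger r
  have hmono := hc r f hf.1.1
  have hf_eq := hlast f hf.1.1
  omega

/-- The label obtained by exchanging the labels of `l` and `r`. -/
noncomputable def exchange (hbelow : ∀ g : TreeEdge w, g.IsBelow r → M g < M l) :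
    DecreasingLabel w :=
  ⟨(Equiv.swap l r).trans M.1, fun e f hef => by
    change M (Equiv.swap l r e) < M (Equiv.swap l r f)
    have hne : e ≠ f := (ne_of_opening_lt hef.1).symm
    rcases eq_or_ne f l with rfl | hfl
    · have her : e ≠ r := by rintro rfl; exact hef.not_strictlyLeft h.strictlyLeft
      rw [Equiv.swap_apply_left, Equiv.swap_apply_of_ne_of_ne hne her]
      exact (M.2 e f hef).trans h.lt
    rcases eq_or_ne f r with rfl | hfr
    · have hel : e ≠ l := by rintro rfl; exact lt_asymm hef.1 h.opening_lt
      rw [Equiv.swap_apply_right, Equiv.swap_apply_of_ne_of_ne hel hne]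
      exact hbelow e hef
    rw [Equiv.swap_apply_of_ne_of_ne hfl hfr]
    rcases eq_or_ne e l with rfl | hel
    · rw [Equiv.swap_apply_left]
      exact h.lt_of_lt (hef.1.trans h.opening_lt) (M.2 e f hef)
    rcases eq_or_ne e r with rfl | her
    · rw [Equiv.swap_apply_right]
      exact h.lt.trans (M.2 e f hef)
    rw [Equiv.swap_apply_of_ne_of_ne hel her]
    exact M.2 e f hef⟩

variable (hbelow : ∀ g : TreeEdge w, g.IsBelow r → M g < M l)

theorem exchange_apply (e : TreeEdge w) : h.exchange hbelow e = M (Equiv.swap l r e) := rfl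

theorem exchange_left : h.exchange hbelow l = M r := by
  rw [exchange_apply, Equiv.swap_apply_left]

theorem exchange_right : h.exchange hbelow r = M l := by
  rw [exchange_apply, Equiv.swap_apply_right]

theorem exchange_of_ne (hel : e ≠ l) (her : e ≠ r) : h.exchange hbelow e = M e := by
  rw [exchange_apply, Equiv.swap_apply_of_ne_of_ne hel her]

theorem coveredBy_exchange : M.CoveredBy (h.exchange hbelow) := by
  refine ⟨l, r, h.strictlyLeft, fun e hel her => (h.exchange_of_ne hbelow hel her).symm, h.lt,
    h.exchange_right hbelow, h.exchange_left hbelow, ?_⟩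
  rintro ⟨f, hlf, hfr, hle, hle'⟩
  have hlt : M l < M f := lt_of_le_of_ne hle (M.1.injective.ne hlf.ne)
  exact (h.lt_of_lt hfr.opening_lt hlt).not_ge hle'

theorem code_exchange_right : (h.exchange hbelow).code r + 1 = M.code r := by
  unfold code
  rw [← Finset.card_erase_add_one (a := l) (s := Finset.univ.filter fun f : TreeEdge w =>
    f.opening < r.opening ∧ M f < M r) (by simpa using ⟨h.opening_lt, h.lt⟩)]
  congr 2
  ext f
  simp only [Finset.mem_erase, Finset.mem_filter, Finset.mem_univ, true_and,
    h.exchange_right hbelow]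
  rcases eq_or_ne f l with rfl | hfl
  · simp [h.exchange_left hbelow, h.lt.le]
  · rw [and_iff_right hfl]
    refine and_congr_right fun hfr => ?_
    rw [h.exchange_of_ne hbelow hfl (ne_of_opening_lt hfr), h.lt_iff_lt hfl hfr]

theorem code_exchange_of_lt (her : e.opening < r.opening) :
    (h.exchange hbelow).code e = M.code e := by
  unfold code
  congr 1
  refine Finset.filter_congr fun f _ => and_congr_right fun hfe => ?_
  have hfr := hfe.trans her
  rcases eq_or_ne e l with rfl | hel
  · rw [h.exchange_of_ne hbelow (ne_of_opening_lt hfe) (ne_of_opening_lt hfr),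
      h.exchange_left hbelow, h.lt_iff_lt (ne_of_opening_lt hfe) hfr]
  rw [h.exchange_of_ne hbelow hel (ne_of_opening_lt her)]
  rcases eq_or_ne f l with rfl | hfl
  · rw [h.exchange_left hbelow]
    exact ⟨h.lt.trans, h.lt_of_lt her⟩
  · rw [h.exchange_of_ne hbelow hfl (ne_of_opening_lt hfr)]

theorem code_exchange_of_gt (hre : r.opening < e.opening) :
    (h.exchange hbelow).code e = M.code e := by
  have hopening : ∀ f : TreeEdge w,
      (Equiv.swap l r f).opening < e.opening ↔ f.opening < e.opening := by
    intro f
    have := h.opening_lt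
    rw [Equiv.swap_apply_def]
    split_ifs with hfl hfr
    · rw [hfl]; omega
    · rw [hfr]; omega
    · rfl
  have he : h.exchange hbelow e = M e := h.exchange_of_ne hbelow
    (ne_of_opening_lt (h.opening_lt.trans hre)).symm (ne_of_opening_lt hre).symm
  unfold code
  refine Finset.card_equiv (Equiv.swap l r) fun f => ?_
  simp only [Finset.mem_filter, Finset.mem_univ, true_and, hopening, he, exchange_apply]

end IsPredecessor

theorem exists_coveredBy_code (M : DecreasingLabel w) {c : TreeEdge w → ℕ} (hc : RowMonotone c)
    (hr : c r < M.code r) (hlast : ∀ g : TreeEdge w, r.opening < g.opening → c g = M.code g) :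
    ∃ M' : DecreasingLabel w, M.CoveredBy M' ∧ M'.code r + 1 = M.code r ∧
      ∀ e, e ≠ r → M'.code e = M.code e := by
  obtain ⟨l, h⟩ := exists_isPredecessor (Nat.zero_lt_of_lt hr)
  have hbelow : ∀ g : TreeEdge w, g.IsBelow r → M g < M l := fun g =>
    h.lt_of_isBelow hc hr hlast
  refine ⟨h.exchange hbelow, h.coveredBy_exchange hbelow, h.code_exchange_right hbelow,
    fun e hne => ?_⟩
  rcases lt_trichotomy e.opening r.opening with her | heq | hre
  · exact h.code_exchange_of_lt hbelow her
  · exact absurd (opening_injective heq) hne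
  · exact h.code_exchange_of_gt hbelow hre

/-- The excess of the code of `M` over `c` is removed by covers, from the last edge to the first. -/
theorem exists_le_code_eq (M : DecreasingLabel w) {c : TreeEdge w → ℕ} (hc : RowMonotone c)
    (hle : ∀ e, c e ≤ M.code e) : ∃ L : DecreasingLabel w, M.Le L ∧ ∀ e, L.code e = c e := by
  induction hn : ∑ e, M.code e using Nat.strong_induction_on generalizing M with
  | _ n ih =>
    by_cases heq : ∀ e, M.code e = c e
    · exact ⟨M, Relation.ReflTransGen.refl, heq⟩
    push Not at heq
    obtain ⟨e₀, he₀⟩ := heq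
    obtain ⟨r, hr, hmax⟩ := Finset.exists_max_image
      (Finset.univ.filter fun f : TreeEdge w => c f < M.code f) opening
      ⟨e₀, by simpa using lt_of_le_of_ne (hle e₀) he₀.symm⟩
    simp only [Finset.mem_filter, Finset.mem_univ, true_and] at hr hmax
    obtain ⟨M', hcov, hcode_r, hcode⟩ := M.exists_coveredBy_code hc hr fun g hg => by
      by_contra hne
      exact (hmax g (lt_of_le_of_ne (hle g) hne)).not_gt hg
    have hle' : ∀ e, c e ≤ M'.code e ∧ M'.code e ≤ M.code e := fun e => by
      have := hle e
      rcases eq_or_ne e r with rfl | hne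
      · omega
      · rw [hcode e hne]; omega
    have hsum : ∑ e, M'.code e < n := hn ▸
      Finset.sum_lt_sum (fun e _ => (hle' e).2) ⟨r, Finset.mem_univ _, by omega⟩
    obtain ⟨L, hL, hL'⟩ := ih _ hsum M' (fun e => (hle' e).1) rfl
    exact ⟨L, Relation.ReflTransGen.head hcov hL, hL'⟩

end Exchange

end DecreasingLabel

/-! ### Tiles as runs in a layer -/

theorem BinaryWord.eq_of_ofDyck_eq {w w' : DyckWord} (hw : w.semilength = w'.semilength)
    (h : ∀ i < w.toList.length, ofDyck w i = ofDyck w' i) : w = w' := by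
  have hlen : w.toList.length = w'.toList.length := by
    rw [← w.two_mul_semilength_eq_length, ← w'.two_mul_semilength_eq_length, hw]
  refine DyckWord.ext (List.ext_getElem? fun i => ?_)
  rcases lt_or_ge i w.toList.length with hi | hi
  · cases hup : ofDyck w i
    · rw [getElem?_eq_D_iff.2 ⟨hi, hup⟩, getElem?_eq_D_iff.2 ⟨hlen ▸ hi, h i hi ▸ hup⟩]
    · rw [getElem?_eq_U_iff.2 hup, getElem?_eq_U_iff.2 (h i hi ▸ hup)]
  · rw [List.getElem?_eq_none hi, List.getElem?_eq_none (hlen ▸ hi)]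

namespace TreeEdge

variable {w : DyckWord}

theorem upCount_le_row_iff (e : TreeEdge w) (k : ℕ) :
    upCount (ofDyck w) k ≤ e.row ↔ k ≤ e.opening := by
  rw [e.row_eq_upCount]
  refine ⟨fun h => ?_, fun h => upCount_mono h⟩
  by_contra! hlt
  have hmono := upCount_mono (a := ofDyck w) (Nat.succ_le_of_lt hlt)
  rw [Nat.succ_eq_add_one, upCount_succ_of_up e.ofDyck_opening] at hmono
  omega

theorem upCol_row (e : TreeEdge w) : w.upCol e.row = e.opening - e.row := by
  classical
  have hlen := lt_length_of_ofDyck e.ofDyck_opening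
  rw [e.row_eq_upCount, sub_upCount_eq_card_filter, ← e.row_eq_upCount, DyckWord.upCol]
  refine Finset.card_bij (fun j _ => (j : ℕ)) (fun j hj => ?_) (fun i _ j _ h => Fin.ext h)
    fun i hi => ?_
  · simp only [Finset.mem_filter, Finset.mem_univ, true_and, Finset.mem_range] at hj ⊢
    rw [count_U_take, upCount_le_row_iff] at hj
    have hdown : ofDyck w j = false := (getElem?_eq_D_iff.1 (by simpa using hj.1)).2
    refine ⟨lt_of_le_of_ne hj.2 fun h => ?_, hdown⟩
    simp [h, e.ofDyck_opening] at hdown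
  · simp only [Finset.mem_filter, Finset.mem_range] at hi
    have hD := getElem?_eq_D_iff.2 ⟨hi.1.trans hlen, hi.2⟩
    refine ⟨⟨i, hi.1.trans hlen⟩, ?_, rfl⟩
    simp only [Finset.mem_filter, Finset.mem_univ, true_and]
    rw [count_U_take, upCount_le_row_iff]
    exact ⟨by simpa [hi.1.trans hlen] using hD, hi.1.le⟩

end TreeEdge

namespace DyckTile

variable {w : DyckWord}

theorem boxAbove_iff (b : ℤ × ℤ) : w.BoxAbove b ↔
    0 ≤ b.2 ∧ b.2 < w.semilength ∧ (upCount (ofDyck w) (b.1 + b.2 + 1).toNat : ℤ) ≤ b.2 := by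
  have row_iff (r : ℕ) (hr : r < w.semilength) (hb : b.2 = r) :
      b.1 < w.upCol r ↔ (upCount (ofDyck w) (b.1 + b.2 + 1).toNat : ℤ) ≤ b.2 := by
    obtain ⟨e, rfl⟩ := exists_row_eq hr
    rw [upCol_row, hb, Nat.cast_le, upCount_le_row_iff]
    have : e.row ≤ e.opening := by rw [e.row_eq_upCount]; exact upCount_le _
    omega
  constructor
  · rintro ⟨r, hr, hb, h⟩
    exact ⟨by omega, by omega, (row_iff r hr hb).1 h⟩
  · rintro ⟨h₀, hlt, h⟩
    obtain ⟨r, hb⟩ := Int.eq_ofNat_of_zero_le h₀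
    exact ⟨r, by omega, hb, (row_iff r (by omega) hb).2 h⟩

/-- The box in the layer `j` above the step `k` of `w`, layer `0` being the boxes that touch `w`
from above. In the usual picture, the boxes above a fixed step form a vertical column. -/
def cell (w : DyckWord) (k j : ℕ) : ℤ × ℤ :=
  ((k : ℤ) - upCount (ofDyck w) k - 1 - j, (upCount (ofDyck w) k : ℤ) + j)

theorem cell_fst (k j : ℕ) : (cell w k j).1 = (k : ℤ) - upCount (ofDyck w) k - 1 - j := rfl

theorem cell_snd (k j : ℕ) : (cell w k j).2 = (upCount (ofDyck w) k : ℤ) + j := rfl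

theorem cell_fst_add_snd (k j : ℕ) : (cell w k j).1 + (cell w k j).2 + 1 = k := by
  rw [cell_fst, cell_snd]; ring

theorem cell_inj {k j k' j' : ℕ} : cell w k j = cell w k' j' ↔ k = k' ∧ j = j' := by
  refine ⟨fun h => ?_, fun ⟨hk, hj⟩ => hk ▸ hj ▸ rfl⟩
  have hk := cell_fst_add_snd (w := w) k j
  rw [h, cell_fst_add_snd] at hk
  obtain rfl : k = k' := by omega
  have hj := congrArg Prod.snd h
  rw [cell_snd, cell_snd] at hj
  exact ⟨rfl, by omega⟩

theorem cell_succ_add (k j : ℕ) : cell w k (j + 1) + (1, -1) = cell w k j := by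
  ext
  · simp only [Prod.fst_add, cell_fst]; push_cast; ring
  · simp only [Prod.snd_add, cell_snd]; push_cast; ring

theorem not_boxAbove_cell_zero_add (k : ℕ) : ¬ w.BoxAbove (cell w k 0 + (1, -1)) := by
  have hsum := cell_fst_add_snd (w := w) k 0
  rw [boxAbove_iff, Prod.fst_add, Prod.snd_add,
    show (cell w k 0).1 + 1 + ((cell w k 0).2 + -1) + 1 = k by omega, cell_snd, Int.toNat_natCast]
  omega

theorem boxAbove_and_not_boxAbove_iff {top : DyckWord} (hs : top.semilength = w.semilength)
    (b : ℤ × ℤ) : (w.BoxAbove b ∧ ¬ top.BoxAbove b) ↔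
      ∃ k j, j < gap (ofDyck w) (ofDyck top) k ∧ b = cell w k j := by
  rw [boxAbove_iff, boxAbove_iff]
  constructor
  · rintro ⟨⟨h₀, hlt, hw⟩, htop⟩
    have htop : b.2 < upCount (ofDyck top) (b.1 + b.2 + 1).toNat := by omega
    have hsum : 0 ≤ b.1 + b.2 + 1 := by
      by_contra hneg
      rw [Int.toNat_of_nonpos (by omega), upCount_zero] at htop
      omega
    obtain ⟨k, hk⟩ := Int.eq_ofNat_of_zero_le hsum
    rw [hk, Int.toNat_natCast] at hw htop
    refine ⟨k, (b.2 - upCount (ofDyck w) k).toNat, by unfold gap; omega, Prod.ext ?_ ?_⟩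
    · rw [cell_fst]; omega
    · rw [cell_snd]; omega
  · rintro ⟨k, j, hj, rfl⟩
    have := upCount_ofDyck_le_semilength top k
    unfold gap at hj
    rw [cell_fst_add_snd, cell_snd, Int.toNat_natCast]
    omega

variable {t : DyckTile}

/-- The number of steps of the tile, which is one less than its number of boxes. -/
def len (t : DyckTile) : ℕ := t.path.toList.length

theorem len_eq (t : DyckTile) : t.len = 2 * t.size := t.path.two_mul_semilength_eq_length.symm

/-- The box number `i` (from `0`) of the tile; a junk value if `t.len < i`. -/
def box (t : DyckTile) (i : ℕ) : ℤ × ℤ :=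
  t.start + ((i : ℤ) - upCount (ofDyck t.path) i, (upCount (ofDyck t.path) i : ℤ))

theorem mem_boxes_iff {b : ℤ × ℤ} : b ∈ t.boxes ↔ ∃ i ≤ t.len, b = t.box i := by
  refine exists_congr fun i => and_congr_right fun hi => ?_
  rw [count_U_take, count_D_take hi, box, Nat.cast_sub (upCount_le _)]

theorem box_fst_add_snd (i : ℕ) : (t.box i).1 + (t.box i).2 = t.start.1 + t.start.2 + i := by
  simp only [box, Prod.fst_add, Prod.snd_add]; ring

theorem box_mem_boxes {i : ℕ} (hi : i ≤ t.len) : t.box i ∈ t.boxes := mem_boxes_iff.2 ⟨i, hi, rfl⟩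

theorem box_zero : t.box 0 = t.start := by simp [box]

theorem start_mem_boxes : t.start ∈ t.boxes := box_zero (t := t) ▸ box_mem_boxes (Nat.zero_le _)

theorem start_snd_le {b : ℤ × ℤ} (hb : b ∈ t.boxes) : t.start.2 ≤ b.2 := by
  obtain ⟨i, -, rfl⟩ := mem_boxes_iff.1 hb
  simp [box]

/-- The tile consists of the boxes in the layer `j` above the steps `p, ..., p + t.len` of `w`. -/
def IsRun (w : DyckWord) (t : DyckTile) (p j : ℕ) : Prop :=
  ∀ i ≤ t.len, t.box i = cell w (p + i) j

theorem exists_isRun_of_forall_box {j : ℕ} (h : ∀ i ≤ t.len, ∃ k, t.box i = cell w k j) :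
    ∃ p, IsRun w t p j := by
  obtain ⟨p, hp⟩ := h 0 (Nat.zero_le _)
  refine ⟨p, fun i hi => ?_⟩
  obtain ⟨k, hk⟩ := h i hi
  have hi := box_fst_add_snd (t := t) i
  rw [← box_zero, hp, hk] at hi
  have hp' := cell_fst_add_snd (w := w) p j
  have hk' := cell_fst_add_snd (w := w) k j
  rw [hk, show k = p + i by omega]

namespace IsRun

variable {p j : ℕ}

theorem start_eq (h : IsRun w t p j) : t.start = cell w p j :=
  box_zero.symm.trans (h 0 (Nat.zero_le _))

theorem upCount_eq (h : IsRun w t p j) {i : ℕ} (hi : i ≤ t.len) :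
    upCount (ofDyck w) (p + i) = upCount (ofDyck w) p + upCount (ofDyck t.path) i := by
  have hsnd := congrArg Prod.snd (h i hi)
  simp only [box, Prod.snd_add, h.start_eq, cell_snd] at hsnd
  omega

theorem ofDyck_eq (h : IsRun w t p j) {i : ℕ} (hi : i < t.len) :
    ofDyck t.path i = ofDyck w (p + i) := by
  have hcount := h.upCount_eq hi.le
  have hcount_succ := h.upCount_eq (i := i + 1) hi
  rw [← add_assoc, upCount_succ, upCount_succ] at hcount_succ
  cases ht : ofDyck t.path i <;> cases hw : ofDyck w (p + i) <;>
    simp only [ht, hw, if_true, Bool.false_eq_true, if_false] at hcount_succ ⊢ <;> omega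

theorem cell_mem_boxes_iff (h : IsRun w t p j) {k j' : ℕ} :
    cell w k j' ∈ t.boxes ↔ j' = j ∧ p ≤ k ∧ k ≤ p + t.len := by
  rw [mem_boxes_iff]
  constructor
  · rintro ⟨i, hi, hbox⟩
    rw [h i hi, cell_inj] at hbox
    omega
  · rintro ⟨rfl, hpk, hk⟩
    exact ⟨k - p, by omega, by rw [h _ (by omega), Nat.add_sub_cancel' hpk]⟩

theorem entryEdge_eq (h : IsRun w t p j) : t.entryEdge = cell w (p + t.len) j + (1, 0) := by
  rw [← h t.len le_rfl, box, entryEdge, len, upCount_ofDyck_length,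
    ← DyckWord.two_mul_semilength_eq_length]
  ext
  · simp only [Prod.fst_add, size]; push_cast; ring
  · simp only [Prod.snd_add, size]; ring

theorem height_eq (h : IsRun w t p j) {i : ℕ} (hi : i ≤ t.len) :
    height (ofDyck w) (p + i) = height (ofDyck w) p + height (ofDyck t.path) i := by
  unfold height
  rw [h.upCount_eq hi]
  push_cast; ring

theorem isExcursion (h : IsRun w t p j) : IsExcursion (ofDyck w) p (p + t.len) := by
  refine ⟨?_, fun k hpk hk => ?_⟩
  · rw [h.height_eq le_rfl, len, height_ofDyck_length, add_zero]
  · obtain ⟨i, rfl⟩ := Nat.exists_eq_add_of_le hpk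
    rw [h.height_eq (by omega)]
    linarith [height_ofDyck_nonneg (w := t.path) (k := i) (by unfold len at hk; omega)]

theorem eq_of_len_eq {t' : DyckTile} (h : IsRun w t p j) (h' : IsRun w t' p j)
    (hlen : t.len = t'.len) : t = t' := by
  have hstart : t.start = t'.start := h.start_eq.trans h'.start_eq.symm
  have hpath : t.path = t'.path := by
    refine eq_of_ofDyck_eq ?_ fun i hi => ?_
    · have hsize := t.len_eq.symm.trans (hlen.trans t'.len_eq)
      unfold size at hsize
      omega
    · rw [h.ofDyck_eq hi, h'.ofDyck_eq (hlen ▸ hi)]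
  cases t; cases t'
  simp only at hstart hpath
  rw [hstart, hpath]

end IsRun

end DyckTile

open DyckTile

namespace DyckTiling

variable {w : DyckWord}

theorem eq_of_top_eq_of_tiles_eq {D₁ D₂ : DyckTiling w} (htop : D₁.top = D₂.top)
    (htiles : D₁.tiles = D₂.tiles) : D₁ = D₂ := by
  cases D₁; cases D₂
  simp only at htop htiles
  subst htop htiles
  rfl

variable (D : DyckTiling w) {t : DyckTile} {k p j : ℕ}

theorem upCount_le_upCount_top (k : ℕ) : upCount (ofDyck w) k ≤ upCount (ofDyck D.top) k := by
  simpa only [count_U_take] using D.top_above k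

theorem exists_mem_boxes_iff (b : ℤ × ℤ) :
    (∃ t ∈ D.tiles, b ∈ t.boxes) ↔ ∃ k j, j < gap (ofDyck w) (ofDyck D.top) k ∧ b = cell w k j := by
  rw [← boxAbove_and_not_boxAbove_iff D.semilength_top]
  simpa using Set.ext_iff.1 D.union b

theorem exists_cell_mem_boxes_iff :
    (∃ t ∈ D.tiles, cell w k j ∈ t.boxes) ↔ j < gap (ofDyck w) (ofDyck D.top) k := by
  rw [exists_mem_boxes_iff]
  refine ⟨?_, fun h => ⟨k, j, h, rfl⟩⟩
  rintro ⟨k', j', h, hcell⟩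
  obtain ⟨rfl, rfl⟩ := cell_inj.1 hcell
  exact h

theorem boxAbove_cell (h : j < gap (ofDyck w) (ofDyck D.top) k) : w.BoxAbove (cell w k j) :=
  ((boxAbove_and_not_boxAbove_iff D.semilength_top _).2 ⟨k, j, h, rfl⟩).1

theorem tile_unique {t' : DyckTile} (ht : t ∈ D.tiles) (ht' : t' ∈ D.tiles) {b : ℤ × ℤ}
    (hb : b ∈ t.boxes) (hb' : b ∈ t'.boxes) : t = t' := by
  by_contra hne
  exact Set.disjoint_left.1 (D.disjoint ht ht' hne) hb hb'

theorem start_snd_nonneg (ht : t ∈ D.tiles) : 0 ≤ t.start.2 := by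
  obtain ⟨k, j, -, hstart⟩ := (D.exists_mem_boxes_iff _).1 ⟨t, ht, start_mem_boxes⟩
  rw [hstart, cell_snd]
  positivity

theorem exists_isRun (ht : t ∈ D.tiles) : ∃ p j, IsRun w t p j := by
  induction hn : t.start.2.toNat using Nat.strong_induction_on generalizing t with
  | _ n ih =>
    rcases D.cover_inclusive t ht with ⟨t', ht', hsub⟩ | hbelow
    · have hstart := start_snd_le (hsub _ start_mem_boxes)
      rw [Prod.snd_add] at hstart
      have h₀ := D.start_snd_nonneg ht'
      obtain ⟨p', j', hrun⟩ := ih _ (by omega) ht' rfl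
      obtain ⟨p, hp⟩ := exists_isRun_of_forall_box (w := w) (t := t) (j := j' + 1) fun i hi => by
        obtain ⟨i', hi', hbox⟩ := mem_boxes_iff.1 (hsub _ (box_mem_boxes hi))
        rw [hrun i' hi', ← cell_succ_add] at hbox
        exact ⟨_, add_right_cancel hbox⟩
      exact ⟨p, _, hp⟩
    · obtain ⟨p, hp⟩ := exists_isRun_of_forall_box (w := w) (t := t) (j := 0) fun i hi => by
        obtain ⟨k, j, hj, hbox⟩ := (D.exists_mem_boxes_iff _).1 ⟨t, ht, box_mem_boxes hi⟩
        rcases j with - | j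
        · exact ⟨k, hbox⟩
        · have hcell := hbelow _ (box_mem_boxes hi)
          rw [hbox, cell_succ_add] at hcell
          exact absurd (D.boxAbove_cell (by omega)) hcell
      exact ⟨p, _, hp⟩

/-- The boxes above the steps `k` and `k + 1` in the layer `j` are in the same tile. -/
def Joint (k j : ℕ) : Prop := ∃ t ∈ D.tiles, cell w k j ∈ t.boxes ∧ cell w (k + 1) j ∈ t.boxes

variable {D}

theorem Joint.lt_gap (h : D.Joint k j) : j < gap (ofDyck w) (ofDyck D.top) k := by
  obtain ⟨t, ht, hmem, -⟩ := h
  exact D.exists_cell_mem_boxes_iff.1 ⟨t, ht, hmem⟩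

theorem Joint.lt_gap_succ (h : D.Joint k j) : j < gap (ofDyck w) (ofDyck D.top) (k + 1) := by
  obtain ⟨t, ht, -, hmem⟩ := h
  exact D.exists_cell_mem_boxes_iff.1 ⟨t, ht, hmem⟩

theorem Joint.of_succ (h : D.Joint k (j + 1)) : D.Joint k j := by
  have hlt := h.lt_gap
  obtain ⟨t, ht, hmem, hmem_succ⟩ := h
  rcases D.cover_inclusive t ht with ⟨t', ht', hsub⟩ | hbelow
  · refine ⟨t', ht', ?_, ?_⟩ <;> rw [← cell_succ_add]
    exacts [hsub _ hmem, hsub _ hmem_succ]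
  · have hcell := hbelow _ hmem
    rw [cell_succ_add] at hcell
    exact absurd (D.boxAbove_cell (by omega)) hcell

theorem Joint.mono {j' : ℕ} (h : D.Joint k j) (hj : j' ≤ j) : D.Joint k j' := by
  induction j, hj using Nat.le_induction with
  | base => exact h
  | succ j _ ih => exact ih h.of_succ

variable (D)

theorem exists_not_joint (k : ℕ) : ∃ j, ¬ D.Joint k j :=
  ⟨gap (ofDyck w) (ofDyck D.top) k, fun h => lt_irrefl _ h.lt_gap⟩

open Classical in
/-- The number of layers in which the boxes above the steps `k` and `k + 1` are in the same tile. By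
cover-inclusiveness, these are the lowest layers. -/
noncomputable def jointCount (k : ℕ) : ℕ := Nat.find (D.exists_not_joint k)

theorem joint_iff : D.Joint k j ↔ j < D.jointCount k := by
  classical
  simp only [jointCount, Nat.lt_find_iff, not_not]
  exact ⟨fun h _ => h.mono, fun h => h j le_rfl⟩

variable {D}

theorem jointCount_add_len_le (ht : t ∈ D.tiles) (h : IsRun w t p j) :
    D.jointCount (p + t.len) ≤ j := by
  by_contra! hlt
  obtain ⟨t', ht', hmem, hmem_succ⟩ := D.joint_iff.2 hlt
  obtain rfl := D.tile_unique ht ht' (h.cell_mem_boxes_iff.2 ⟨rfl, by omega, le_rfl⟩) hmem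
  have := (h.cell_mem_boxes_iff.1 hmem_succ).2.2
  omega

theorem lt_jointCount (ht : t ∈ D.tiles) (h : IsRun w t p j) (hpk : p ≤ k) (hk : k < p + t.len) :
    j < D.jointCount k :=
  D.joint_iff.1 ⟨t, ht, h.cell_mem_boxes_iff.2 ⟨rfl, hpk, hk.le⟩,
    h.cell_mem_boxes_iff.2 ⟨rfl, by omega, by omega⟩⟩

theorem jointCount_le_of_isRun_succ (ht : t ∈ D.tiles) (h : IsRun w t (p + 1) j) :
    D.jointCount p ≤ j := by
  by_contra! hlt
  obtain ⟨t', ht', hmem, hmem_succ⟩ := D.joint_iff.2 hlt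
  obtain rfl := D.tile_unique ht ht' (h.cell_mem_boxes_iff.2 ⟨rfl, le_rfl, by omega⟩) hmem_succ
  have := (h.cell_mem_boxes_iff.1 hmem).2.1
  omega

theorem exists_tile_of_isMaxRun {r : ℕ} (h : IsMaxRun D.jointCount j p r) (hpr : p + 1 < r) :
    ∃ t ∈ D.tiles, IsRun w t (p + 1) j ∧ r = p + 1 + t.len := by
  obtain ⟨-, hp, hr, hlt⟩ := h
  obtain ⟨t, ht, hmem, -⟩ := D.joint_iff.2 (hlt (p + 1) (by omega) hpr)
  obtain ⟨q, j', hrun⟩ := D.exists_isRun ht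
  obtain ⟨rfl, hq, hlen⟩ := hrun.cell_mem_boxes_iff.1 hmem
  have hend := jointCount_add_len_le ht hrun
  obtain rfl : q = p + 1 := by
    by_contra hne
    have := lt_jointCount ht hrun (k := p) (by omega) (by omega)
    omega
  refine ⟨t, ht, hrun, ?_⟩
  rcases lt_trichotomy r (p + 1 + t.len) with hlt' | heq | hgt
  · have := lt_jointCount ht hrun (k := r) (by omega) hlt'
    omega
  · exact heq
  · have := hlt _ (by omega) hgt
    omega

variable (D)

theorem runsAreExcursions_jointCount : RunsAreExcursions (ofDyck w) D.jointCount := by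
  intro j p r hrun
  rcases Nat.eq_or_lt_of_le (show p + 1 ≤ r from hrun.1) with rfl | hpr
  · exact isExcursion_self _ _
  · obtain ⟨t, -, ht, rfl⟩ := exists_tile_of_isMaxRun hrun hpr
    exact ht.isExcursion

theorem tilingData : TilingData (ofDyck w) (ofDyck D.top) D.jointCount where
  eventually_eq := by
    have hs := D.semilength_top
    have hlen : D.top.toList.length = w.toList.length := by
      rw [← DyckWord.two_mul_semilength_eq_length, ← DyckWord.two_mul_semilength_eq_length, hs]
    refine ⟨w.toList.length, fun k hk => ⟨ofDyck_of_length_le hk, ofDyck_of_length_le (by omega),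
      ?_⟩⟩
    have hw := upCount_mono (a := ofDyck w) hk
    have htop := upCount_mono (a := ofDyck D.top) (hlen ▸ hk)
    have hw' := upCount_ofDyck_le_semilength w k
    have htop' := upCount_ofDyck_le_semilength D.top k
    rw [upCount_ofDyck_length] at hw htop
    omega
  joint_left k := by
    have hle := D.upCount_le_upCount_top k
    rcases h : D.jointCount k with - | j
    · simpa using hle
    · have := (D.joint_iff.2 (show j < D.jointCount k by omega)).lt_gap
      unfold gap at this
      omega
  joint_right k := by
    have hle := D.upCount_le_upCount_top (k + 1)
    rcases h : D.jointCount k with - | j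
    · simpa using hle
    · have := (D.joint_iff.2 (show j < D.jointCount k by omega)).lt_gap_succ
      unfold gap at this
      omega
  runs := D.runsAreExcursions_jointCount

theorem isTrivial_iff : D.IsTrivial ↔ ∀ k, D.jointCount k = 0 := by
  constructor
  · intro h k
    by_contra hne
    obtain ⟨t, ht, hmem, hmem_succ⟩ := D.joint_iff.2 (Nat.pos_of_ne_zero hne)
    obtain ⟨p, j, hrun⟩ := D.exists_isRun ht
    have := hrun.cell_mem_boxes_iff.1 hmem
    have := hrun.cell_mem_boxes_iff.1 hmem_succ
    have := h t ht
    have := t.len_eq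
    omega
  · intro h t ht
    by_contra hne
    obtain ⟨p, j, hrun⟩ := D.exists_isRun ht
    have := t.len_eq
    have := lt_jointCount ht hrun le_rfl (by omega)
    have := h p
    omega

variable {D}

theorem mem_tiles_of_jointCount_eq {D' : DyckTiling w} (htop : D.top = D'.top)
    (hJ : D.jointCount = D'.jointCount) (ht : t ∈ D.tiles) : t ∈ D'.tiles := by
  obtain ⟨p, j, hrun⟩ := D.exists_isRun ht
  have hmem : cell w p j ∈ t.boxes := hrun.cell_mem_boxes_iff.2 ⟨rfl, le_rfl, by omega⟩
  have hgap := D.exists_cell_mem_boxes_iff.1 ⟨t, ht, hmem⟩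
  rw [htop] at hgap
  obtain ⟨t', ht', hmem'⟩ := D'.exists_cell_mem_boxes_iff.2 hgap
  obtain ⟨p', j', hrun'⟩ := D'.exists_isRun ht'
  obtain ⟨rfl, hp', hp⟩ := hrun'.cell_mem_boxes_iff.1 hmem'
  have hend := jointCount_add_len_le ht hrun
  have hend' := jointCount_add_len_le ht' hrun'
  rw [hJ] at hend
  obtain rfl : p' = p := by
    by_contra hne
    obtain ⟨q, rfl⟩ := Nat.exists_eq_succ_of_ne_zero (show p ≠ 0 by omega)
    have hstart := jointCount_le_of_isRun_succ ht hrun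
    rw [hJ] at hstart
    have := lt_jointCount ht' hrun' (k := q) (by omega) (by omega)
    omega
  have hlen : t'.len = t.len := by
    rcases lt_trichotomy t'.len t.len with hlt | heq | hgt
    · have := lt_jointCount ht hrun (k := p' + t'.len) (by omega) (by omega)
      rw [hJ] at this
      omega
    · exact heq
    · have := lt_jointCount ht' hrun' (k := p' + t.len) (by omega) (by omega)
      omega
  rwa [← hrun'.eq_of_len_eq hrun hlen]

theorem eq_of_jointCount_eq {D' : DyckTiling w} (htop : ofDyck D.top = ofDyck D'.top)
    (hJ : D.jointCount = D'.jointCount) : D = D' := by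
  have htop : D.top = D'.top :=
    eq_of_ofDyck_eq (D.semilength_top.trans D'.semilength_top.symm) fun i _ => congrFun htop i
  refine eq_of_top_eq_of_tiles_eq htop (Finset.ext fun t => ?_)
  exact ⟨mem_tiles_of_jointCount_eq htop hJ, mem_tiles_of_jointCount_eq htop.symm hJ.symm⟩

end DyckTiling

/-! ### Lines of the Hermite history -/

namespace DyckTile

variable {w : DyckWord} {k j k' j' : ℕ}

/-- The right side of the box in the layer `j` above the step `k` of `w`, as an edge. -/
def rightEdge (w : DyckWord) (k j : ℕ) : ℤ × ℤ := cell w k j + (1, 0)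

theorem rightEdge_inj : rightEdge w k j = rightEdge w k' j' ↔ k = k' ∧ j = j' := by
  rw [rightEdge, rightEdge, add_left_inj, cell_inj]

theorem rightEdge_add_neg_one_zero : rightEdge w k j + (-1, 0) = cell w k j := by
  rw [rightEdge, add_assoc]; simp

theorem rightEdge_add_neg_one_one : rightEdge w k j + (-1, 1) = rightEdge w k (j + 1) := by
  ext
  · simp only [rightEdge, Prod.fst_add, cell_fst]; push_cast; ring
  · simp only [rightEdge, Prod.snd_add, cell_snd]; push_cast; ring

theorem cell_succ_of_up (h : ofDyck w k = true) : cell w (k + 1) j = rightEdge w k (j + 1) := by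
  ext
  · simp only [rightEdge, Prod.fst_add, cell_fst, upCount_succ_of_up h]; push_cast; ring
  · simp only [rightEdge, Prod.snd_add, cell_snd, upCount_succ_of_up h]; push_cast; ring

theorem cell_succ_of_down (h : ofDyck w k = false) : cell w (k + 1) j = rightEdge w k j := by
  ext
  · simp only [rightEdge, Prod.fst_add, cell_fst, upCount_succ_of_down h]; push_cast; ring
  · simp only [rightEdge, Prod.snd_add, cell_snd, upCount_succ_of_down h]; ring

theorem rightEdge_opening (e : TreeEdge w) :
    ((w.upCol e.row : ℤ), (e.row : ℤ)) = rightEdge w e.opening 0 := by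
  have h := upCount_le (a := ofDyck w) e.opening
  rw [upCol_row, e.row_eq_upCount, Nat.cast_sub h]
  ext
  · simp only [rightEdge, Prod.fst_add, cell_fst]; push_cast; ring
  · simp only [rightEdge, Prod.snd_add, cell_snd]; push_cast; ring

end DyckTile

namespace DyckTiling

variable {w : DyckWord} {D : DyckTiling w} {t t' : DyckTile} {p k j : ℕ} {v v' : ℤ × ℤ}

theorem exists_isRun_succ (ht : t ∈ D.tiles) : ∃ p j, IsRun w t (p + 1) j := by
  obtain ⟨p, j, h⟩ := D.exists_isRun ht
  have hgap := D.exists_cell_mem_boxes_iff.1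
    ⟨t, ht, h.cell_mem_boxes_iff.2 ⟨rfl, le_rfl, Nat.le_add_right _ _⟩⟩
  cases p with
  | zero => simp [gap] at hgap
  | succ p => exact ⟨p, j, h⟩

theorem eq_of_entryEdge_eq (ht : t ∈ D.tiles) (ht' : t' ∈ D.tiles)
    (h : t.entryEdge = t'.entryEdge) : t = t' := by
  obtain ⟨p, j, hrun⟩ := D.exists_isRun ht
  obtain ⟨p', j', hrun'⟩ := D.exists_isRun ht'
  rw [hrun.entryEdge_eq, hrun'.entryEdge_eq, add_left_inj] at h
  refine D.tile_unique ht ht' (hrun.cell_mem_boxes_iff.2 ⟨rfl, Nat.le_add_right _ _, le_rfl⟩) ?_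
  exact h ▸ hrun'.cell_mem_boxes_iff.2 ⟨rfl, Nat.le_add_right _ _, le_rfl⟩

theorem mem_boxes_of_entryEdge_eq (ht : t ∈ D.tiles) (h : t.entryEdge = rightEdge w k j) :
    cell w k j ∈ t.boxes ∧ cell w (k + 1) j ∉ t.boxes := by
  obtain ⟨p, j', hrun⟩ := D.exists_isRun ht
  rw [hrun.entryEdge_eq] at h
  obtain ⟨rfl, rfl⟩ := rightEdge_inj.1 h
  rw [hrun.cell_mem_boxes_iff, hrun.cell_mem_boxes_iff]
  exact ⟨⟨rfl, by omega, le_rfl⟩, by omega⟩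

variable (D)

open Classical in
/-- The total weight of the tiles that a line passing through the edge `v` meets after `v`. -/
noncomputable def crossSum (v : ℤ × ℤ) : ℕ :=
  ∑ t ∈ D.tiles.filter fun t => Relation.ReflTransGen D.Cross v t.entryEdge, t.weight

variable {D}

theorem exists_entryEdge_eq_of_cross (ht : t ∈ D.tiles)
    (h : Relation.ReflTransGen D.Cross v t.entryEdge) : ∃ t' ∈ D.tiles, t'.entryEdge = v := by
  rcases Relation.ReflTransGen.cases_head h with heq | ⟨v', ⟨t', ht', hv, -⟩, -⟩
  · exact ⟨t, ht, heq.symm⟩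
  · exact ⟨t', ht', hv⟩

theorem crossSum_eq_zero (h : ∀ t ∈ D.tiles, t.entryEdge ≠ v) : D.crossSum v = 0 := by
  classical
  rw [crossSum, Finset.filter_eq_empty_iff.2, Finset.sum_empty]
  intro t ht hcross
  obtain ⟨t', ht', hv⟩ := exists_entryEdge_eq_of_cross ht hcross
  exact h t' ht' hv

theorem fst_le_of_cross (h : Relation.ReflTransGen D.Cross v v') : v'.1 ≤ v.1 := by
  induction h with
  | refl => exact le_rfl
  | tail _ h ih =>
    obtain ⟨t, -, rfl, rfl⟩ := h
    simp only [entryEdge, Prod.fst_add] at ih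
    unfold exitEdge
    omega

theorem crossSum_entryEdge (ht : t ∈ D.tiles) :
    D.crossSum t.entryEdge = t.weight + D.crossSum t.exitEdge := by
  classical
  unfold crossSum
  rw [← Finset.sum_insert]
  · refine Finset.sum_congr (Finset.ext fun t' => ?_) fun _ _ => rfl
    simp only [Finset.mem_filter, Finset.mem_insert]
    constructor
    · rintro ⟨ht', hcross⟩
      rcases Relation.ReflTransGen.cases_head hcross with heq | ⟨v', ⟨t'', ht'', heq, rfl⟩, hcross⟩
      · exact Or.inl (eq_of_entryEdge_eq ht' ht heq.symm)
      · rw [eq_of_entryEdge_eq ht'' ht heq] at hcross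
        exact Or.inr ⟨ht', hcross⟩
    · rintro (rfl | ⟨ht', hcross⟩)
      · exact ⟨ht, Relation.ReflTransGen.refl⟩
      · exact ⟨ht', Relation.ReflTransGen.head ⟨t, ht, rfl, rfl⟩ hcross⟩
  · simp only [Finset.mem_filter, not_and]
    intro _ hcross
    have := fst_le_of_cross hcross
    simp only [entryEdge, exitEdge, Prod.fst_add] at this
    omega

theorem lt_gap_of_isRun (ht : t ∈ D.tiles) (h : IsRun w t p j) {i : ℕ} (hi : i ≤ t.len) :
    j < gap (ofDyck w) (ofDyck D.top) (p + i) :=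
  D.exists_cell_mem_boxes_iff.1 ⟨t, ht, h.cell_mem_boxes_iff.2 ⟨rfl, by omega, by omega⟩⟩

theorem lineWeight_add_upCount_of_isRun (ht : t ∈ D.tiles) (h : IsRun w t p j) {i : ℕ}
    (hi : i ≤ t.len) :
    lineWeight (ofDyck w) (ofDyck D.top) D.jointCount (p + i) j + upCount (ofDyck t.path) i =
      i + lineWeight (ofDyck w) (ofDyck D.top) D.jointCount p j := by
  induction i with
  | zero => simp [upCount_zero]
  | succ i ih =>
    have ih := ih (by omega)
    have hgap : j < gap (ofDyck w) (ofDyck D.top) (p + i + 1) := lt_gap_of_isRun ht h hi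
    have hjoint := lt_jointCount ht h (Nat.le_add_right p i) (by omega)
    have hstep := h.ofDyck_eq (show i < t.len by omega)
    rw [← add_assoc]
    cases hk : ofDyck w (p + i)
    · rw [lineWeight_of_down hgap hk, upCount_succ_of_down (hstep.trans hk)]
      omega
    · rw [lineWeight_of_joint hgap hk hjoint, upCount_succ_of_up (hstep.trans hk)]
      omega

theorem upCount_path_len (t : DyckTile) : upCount (ofDyck t.path) t.len = t.size :=
  upCount_ofDyck_length t.path

theorem lineWeight_of_isRun (ht : t ∈ D.tiles) (h : IsRun w t (p + 1) j) :
    lineWeight (ofDyck w) (ofDyck D.top) D.jointCount (p + 1 + t.len) j = t.weight +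
      lineWeight (ofDyck w) (ofDyck D.top) D.jointCount p (if ofDyck w p then j + 1 else j) := by
  have hline := lineWeight_add_upCount_of_isRun ht h le_rfl
  have hgap := lt_gap_of_isRun ht h (Nat.zero_le _)
  have hlen := t.len_eq
  rw [upCount_path_len] at hline
  unfold DyckTile.weight
  cases hp : ofDyck w p
  · rw [lineWeight_of_down hgap hp] at hline
    simp only [Bool.false_eq_true, if_false]
    omega
  · rw [lineWeight_of_not_joint hgap hp (jointCount_le_of_isRun_succ ht h)] at hline
    simp only [if_true]
    omega

theorem crossSum_rightEdge (hk : D.jointCount k ≤ j) :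
    D.crossSum (rightEdge w k j) = lineWeight (ofDyck w) (ofDyck D.top) D.jointCount k j := by
  induction k using Nat.strong_induction_on generalizing j with
  | _ k ih =>
    rcases lt_or_ge j (gap (ofDyck w) (ofDyck D.top) k) with hgap | hgap
    · obtain ⟨t, ht, hmem⟩ := D.exists_cell_mem_boxes_iff.2 hgap
      obtain ⟨p, j', hrun⟩ := exists_isRun_succ ht
      obtain ⟨rfl, hpk, hlen⟩ := hrun.cell_mem_boxes_iff.1 hmem
      obtain rfl : k = p + 1 + t.len := by
        by_contra hne
        have := lt_jointCount ht hrun hpk (by omega)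
        omega
      have hp := jointCount_le_of_isRun_succ ht hrun
      have hentry : rightEdge w (p + 1 + t.len) j = t.entryEdge := hrun.entryEdge_eq.symm
      rw [lineWeight_of_isRun ht hrun, hentry, crossSum_entryEdge ht, exitEdge, hrun.start_eq]
      split_ifs with hup
      · rw [cell_succ_of_up hup, ih p (by omega) (by omega)]
      · rw [cell_succ_of_down (Bool.eq_false_of_not_eq_true hup), ih p (by omega) hp]
    · rw [lineWeight_eq_zero hgap, crossSum_eq_zero]
      intro t ht hentry
      have := D.exists_cell_mem_boxes_iff.1 ⟨t, ht, (mem_boxes_of_entryEdge_eq ht hentry).1⟩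
      omega

theorem lift_rightEdge_iff :
    D.Lift (rightEdge w k j) v ↔ j < D.jointCount k ∧ v = rightEdge w k (j + 1) := by
  unfold Lift
  rw [rightEdge_add_neg_one_zero, rightEdge_add_neg_one_one, ← joint_iff]
  refine and_congr_left fun _ => ⟨?_, ?_⟩
  · rintro ⟨t, ht, hmem, hentry⟩
    obtain ⟨p, j', hrun⟩ := D.exists_isRun ht
    obtain ⟨rfl, hpk, hk⟩ := hrun.cell_mem_boxes_iff.1 hmem
    refine ⟨t, ht, hmem, hrun.cell_mem_boxes_iff.2 ⟨rfl, by omega, ?_⟩⟩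
    by_contra hlt
    rw [hrun.entryEdge_eq, show p + t.len = k by omega] at hentry
    exact hentry rfl
  · rintro ⟨t, ht, hmem, hmem_succ⟩
    exact ⟨t, ht, hmem, fun hentry => (mem_boxes_of_entryEdge_eq ht hentry).2 hmem_succ⟩

theorem reflTransGen_lift_iff :
    Relation.ReflTransGen D.Lift (rightEdge w k 0) v ↔
      ∃ i ≤ D.jointCount k, v = rightEdge w k i := by
  constructor
  · intro h
    induction h with
    | refl => exact ⟨0, Nat.zero_le _, rfl⟩
    | tail _ h ih =>
      obtain ⟨i, -, rfl⟩ := ih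
      obtain ⟨hlt, rfl⟩ := lift_rightEdge_iff.1 h
      exact ⟨i + 1, hlt, rfl⟩
  · rintro ⟨i, hi, rfl⟩
    induction i with
    | zero => exact Relation.ReflTransGen.refl
    | succ i ih => exact (ih (by omega)).tail (lift_rightEdge_iff.2 ⟨hi, rfl⟩)

theorem lineMeets_iff (ht : t ∈ D.tiles) (k : ℕ) :
    D.LineMeets (rightEdge w k 0) t ↔
      Relation.ReflTransGen D.Cross (rightEdge w k (D.jointCount k)) t.entryEdge := by
  refine ⟨?_, fun h => ⟨_, reflTransGen_lift_iff.2 ⟨_, le_rfl, rfl⟩, h⟩⟩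
  rintro ⟨v', hlift, hcross⟩
  obtain ⟨i, hi, rfl⟩ := reflTransGen_lift_iff.1 hlift
  rcases Nat.eq_or_lt_of_le hi with rfl | hlt
  · exact hcross
  · obtain ⟨t', ht', hentry⟩ := exists_entryEdge_eq_of_cross ht hcross
    obtain ⟨hmem, hnot_mem⟩ := mem_boxes_of_entryEdge_eq ht' hentry
    obtain ⟨t'', ht'', hmem'', hmem_succ⟩ := D.joint_iff.2 hlt
    rw [D.tile_unique ht' ht'' hmem hmem''] at hnot_mem
    exact absurd hmem_succ hnot_mem

variable (D)

theorem sum_lineTiles (e : TreeEdge w) : ∑ t ∈ D.lineTiles e.row, t.weight =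
    lineWeight (ofDyck w) (ofDyck D.top) D.jointCount e.opening (D.jointCount e.opening) := by
  classical
  rw [← crossSum_rightEdge le_rfl, lineTiles, crossSum, rightEdge_opening]
  refine Finset.sum_congr (Finset.filter_congr fun t ht => lineMeets_iff ht _) fun _ _ => rfl

theorem hasLabel_iff (L : DecreasingLabel w) :
    D.HasLabel L ↔ HasWordLabel (ofDyck w) (ofDyck D.top) D.jointCount L.wordLabel := by
  constructor
  · intro h k hk
    obtain ⟨e, rfl⟩ := exists_opening_eq hk
    rw [L.wordCode_eq_code, ← D.sum_lineTiles, h e]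
  · intro h e
    rw [D.sum_lineTiles, h _ e.ofDyck_opening, L.wordCode_eq_code]

/-- The boxes between the two paths that are not preceded by an up step of their tile. The box in
the layer `j` above the step `k + 1` is encoded as `⟨k, j⟩`. -/
noncomputable def lightBoxes : Finset (Σ _ : ℕ, ℕ) :=
  (Finset.range w.toList.length).sigma fun k =>
    Finset.Ico (if ofDyck w k then D.jointCount k else 0) (gap (ofDyck w) (ofDyck D.top) (k + 1))

theorem gap_eq_zero (hk : w.toList.length ≤ k) : gap (ofDyck w) (ofDyck D.top) k = 0 := by
  have hmono := upCount_mono (a := ofDyck w) hk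
  have hle := upCount_ofDyck_le_semilength D.top k
  rw [upCount_ofDyck_length] at hmono
  have := D.semilength_top
  unfold gap
  omega

theorem mem_lightBoxes_iff : ⟨k, j⟩ ∈ D.lightBoxes ↔
    j < gap (ofDyck w) (ofDyck D.top) (k + 1) ∧ (ofDyck w k = true → D.jointCount k ≤ j) := by
  rw [lightBoxes, Finset.mem_sigma, Finset.mem_range, Finset.mem_Ico]
  have hlen : j < gap (ofDyck w) (ofDyck D.top) (k + 1) → k < w.toList.length := by
    intro hj
    by_contra! hle
    rw [D.gap_eq_zero (by omega)] at hj
    omega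
  cases ofDyck w k <;> simp only [Bool.false_eq_true, if_true, if_false] <;> grind

theorem card_lightBoxes : D.lightBoxes.card = ∑ k ∈ Finset.range w.toList.length,
    (if ofDyck w k then gap (ofDyck w) (ofDyck D.top) (k + 1) - D.jointCount k
      else gap (ofDyck w) (ofDyck D.top) (k + 1)) := by
  rw [lightBoxes, Finset.card_sigma]
  refine Finset.sum_congr rfl fun k _ => ?_
  rw [Nat.card_Ico]
  split_ifs <;> rfl

open Classical in
theorem card_lightBoxes_mem_boxes (ht : t ∈ D.tiles) :
    (D.lightBoxes.filter fun x => cell w (x.1 + 1) x.2 ∈ t.boxes).card = t.weight := by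
  obtain ⟨p, j, hrun⟩ := exists_isRun_succ ht
  have heq : (D.lightBoxes.filter fun x => cell w (x.1 + 1) x.2 ∈ t.boxes) =
      insert ⟨p, j⟩ (((Finset.range t.len).filter fun i => ofDyck t.path i = false).image
        fun i => ⟨p + 1 + i, j⟩) := by
    ext ⟨k, j'⟩
    simp only [Finset.mem_filter, Finset.mem_insert, Finset.mem_image, Finset.mem_range,
      Sigma.mk.injEq, heq_eq_eq, hrun.cell_mem_boxes_iff, mem_lightBoxes_iff]
    constructor
    · rintro ⟨⟨-, hlight⟩, rfl, hpk, hk⟩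
      rcases Nat.eq_or_lt_of_le hpk with hpk | hpk
      · exact Or.inl ⟨by omega, rfl⟩
      · obtain ⟨i, rfl⟩ := Nat.exists_eq_add_of_le (show p + 1 ≤ k by omega)
        have hjoint := lt_jointCount ht hrun (k := p + 1 + i) (by omega) (by omega)
        refine Or.inr ⟨i, ⟨by omega, ?_⟩, rfl, rfl⟩
        rw [hrun.ofDyck_eq (by omega), ← Bool.not_eq_true]
        exact fun hup => absurd (hlight hup) (by omega)
    · rintro (⟨rfl, rfl⟩ | ⟨i, ⟨hi, hdown⟩, rfl, rfl⟩)
      · exact ⟨⟨lt_gap_of_isRun ht hrun (Nat.zero_le _),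
          fun _ => jointCount_le_of_isRun_succ ht hrun⟩, rfl, le_rfl, by omega⟩
      · rw [hrun.ofDyck_eq hi] at hdown
        exact ⟨⟨lt_gap_of_isRun ht hrun hi, by simp [hdown]⟩, rfl, by omega, by omega⟩
  rw [heq, Finset.card_insert_of_notMem, Finset.card_image_of_injective,
    ← sub_upCount_eq_card_filter, upCount_path_len, t.len_eq, DyckTile.weight]
  · omega
  · intro i i' h
    simpa using h
  · simp only [Finset.mem_image, not_exists, not_and, Sigma.mk.injEq]
    omega

theorem weight_eq_card_lightBoxes : D.weight = D.lightBoxes.card := by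
  classical
  have hweight (t) (ht : t ∈ D.tiles) :
      t.weight = (D.lightBoxes.bipartiteAbove (fun t x => cell w (x.1 + 1) x.2 ∈ t.boxes) t).card :=
    (D.card_lightBoxes_mem_boxes ht).symm
  rw [weight, Finset.sum_congr rfl hweight,
    Finset.sum_card_bipartiteAbove_eq_sum_card_bipartiteBelow, Finset.card_eq_sum_ones]
  refine Finset.sum_congr rfl fun ⟨k, j⟩ hx => ?_
  obtain ⟨t, ht, hmem⟩ := D.exists_cell_mem_boxes_iff.2 (D.mem_lightBoxes_iff.1 hx).1
  refine Finset.card_eq_one.2 ⟨t, Finset.ext fun t' => ?_⟩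
  rw [Finset.mem_bipartiteBelow, Finset.mem_singleton]
  refine ⟨fun ⟨ht', hmem'⟩ => D.tile_unique ht' ht hmem' hmem, ?_⟩
  rintro rfl
  exact ⟨ht, hmem⟩

variable {D}

theorem HasLabel.weight_eq_inv {L : DecreasingLabel w} (h : D.HasLabel L) : D.weight = L.inv := by
  rw [weight_eq_card_lightBoxes, card_lightBoxes, D.tilingData.sum_lineWeight,
    D.gap_eq_zero le_rfl, Finset.range_zero, Finset.sum_empty, Nat.add_zero,
    sum_opening w fun k => lineWeight (ofDyck w) (ofDyck D.top) D.jointCount k (D.jointCount k)]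
  exact Finset.sum_congr rfl fun e _ => by rw [← D.sum_lineTiles, h e]

end DyckTiling

/-! ### Tilings from layered data -/

namespace BinaryWord

section Shift

variable {a : BinaryWord} {J : ℕ → ℕ} {p p' r r' i j k m : ℕ}

theorem upCount_add (a : BinaryWord) (p i : ℕ) :
    upCount a (p + i) = upCount a p + upCount (fun k => a (p + k)) i := by
  induction i with
  | zero => rfl
  | succ i ih => rw [← add_assoc, upCount_succ, upCount_succ, ih, add_assoc]

theorem height_add (a : BinaryWord) (p i : ℕ) :
    height a (p + i) = height a p + height (fun k => a (p + k)) i := by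
  unfold height
  rw [upCount_add]
  push_cast; ring

theorem sub_upCount_mono (a : BinaryWord) : Monotone fun k => k - upCount a k := by
  refine monotone_nat_of_le_succ fun k => ?_
  have := upCount_succ_le a k
  omega

theorem IsMaxRun.unique (h : IsMaxRun J j p r) (h' : IsMaxRun J j p' r') (hpk : p < k) (hkr : k ≤ r)
    (hpk' : p' < k) (hkr' : k ≤ r') : p = p' ∧ r = r' := by
  obtain ⟨-, hp, hr, hlt⟩ := h
  obtain ⟨-, hp', hr', hlt'⟩ := h'
  constructor
  · rcases lt_trichotomy p p' with h | h | h
    · exact absurd (hlt p' h (by omega)) (by omega)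
    · exact h
    · exact absurd (hlt' p h (by omega)) (by omega)
  · rcases lt_trichotomy r r' with h | h | h
    · exact absurd (hlt' r (by omega) h) (by omega)
    · exact h
    · exact absurd (hlt r' (by omega) h) (by omega)

/-- The first `m` steps of the word, as a list; used to turn words into Dyck words. -/
def steps (a : BinaryWord) (m : ℕ) : List DyckStep :=
  (List.range m).map fun i => if a i then U else D

theorem length_steps : (steps a m).length = m := by simp [steps]

theorem take_steps (hi : i ≤ m) : (steps a m).take i = steps a i := by
  rw [steps, ← List.map_take, List.take_range, min_eq_left hi, steps]

theorem count_U_steps : (steps a m).count U = upCount a m := by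
  induction m with
  | zero => rfl
  | succ m ih =>
    rw [steps, List.range_succ, List.map_append, List.count_append, ← steps, ih, upCount_succ]
    cases h : a m <;> simp [h]

theorem count_D_steps : (steps a m).count D = m - upCount a m := by
  have h := count_U_add_count_D (steps a m)
  rw [count_U_steps, length_steps] at h
  omega

theorem exists_ofDyck_eq (hm : height a m = 0) (hpos : ∀ i ≤ m, 0 ≤ height a i) :
    ∃ w : DyckWord, w.toList.length = m ∧ ∀ i < m, ofDyck w i = a i := by
  unfold height at hm hpos
  refine ⟨⟨steps a m, by rw [count_U_steps, count_D_steps]; omega, fun i => ?_⟩, length_steps,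
    fun i hi => ?_⟩
  · rcases le_or_gt i m with hi | hi
    · rw [take_steps hi, count_U_steps, count_D_steps]
      have := hpos i hi
      omega
    · rw [List.take_of_length_le (by rw [length_steps]; exact hi.le), count_U_steps, count_D_steps]
      omega
  · cases h : a i <;> simp [ofDyck, steps, hi, h]

end Shift

end BinaryWord

theorem DyckTile.IsRun.exists_eq_cell {w : DyckWord} {t : DyckTile} {p j : ℕ} {x : ℤ × ℤ}
    (h : IsRun w t p j) (hx : x ∈ t.boxes) : ∃ k, x = cell w k j := by
  obtain ⟨i, hi, rfl⟩ := mem_boxes_iff.1 hx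
  exact ⟨_, h i hi⟩

namespace TilingData

section TilingOfData

variable {w : DyckWord} {b : BinaryWord} {J : ℕ → ℕ} {p p' k j j' : ℕ} {t t' : DyckTile} {x : ℤ × ℤ}

theorem upCount_le_semilength (h : TilingData (ofDyck w) b J) (k : ℕ) :
    upCount b k ≤ w.semilength := by
  obtain ⟨N, hN⟩ := h.eventually_eq
  have hmono := upCount_mono (a := b) (le_max_left k N)
  have heq := (hN (max k N) (le_max_right _ _)).2.2
  have hle := upCount_ofDyck_le_semilength w (max k N)
  omega

theorem upCount_eq_semilength (h : TilingData (ofDyck w) b J) (hk : w.toList.length ≤ k) :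
    upCount b k = w.semilength := by
  refine le_antisymm (h.upCount_le_semilength k) ?_
  rw [← upCount_ofDyck_length]
  exact (upCount_mono hk).trans (h.above k)

theorem exists_top (h : TilingData (ofDyck w) b J) :
    ∃ top : DyckWord, top.semilength = w.semilength ∧ ofDyck top = b := by
  have hlen := w.two_mul_semilength_eq_length
  obtain ⟨top, htop_len, htop⟩ := exists_ofDyck_eq (a := b) (m := w.toList.length)
    (by rw [height, h.upCount_eq_semilength le_rfl]; omega)
    (fun i hi => by
      have hw := height_ofDyck_nonneg hi
      have := h.above i
      unfold height at *
      omega)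
  refine ⟨top, by have := top.two_mul_semilength_eq_length; omega, funext fun k => ?_⟩
  rcases lt_or_ge k w.toList.length with hk | hk
  · exact htop k hk
  · rw [ofDyck_of_length_le (by omega), eq_comm, ← Bool.not_eq_true]
    intro hup
    have hcount := upCount_succ_of_up hup
    rw [h.upCount_eq_semilength hk, h.upCount_eq_semilength (by omega)] at hcount
    omega

/-- The tile `t` belongs to the tiling with the data `b` and `J`: it lies in the layer `j` and
fills a maximal run of `J`, which starts at `p`. -/
structure IsTile (w : DyckWord) (b : BinaryWord) (J : ℕ → ℕ) (p j : ℕ) (t : DyckTile) : Prop where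
  lt_gap_start : j < gap (ofDyck w) b (p + 1)
  isMaxRun : IsMaxRun J j p (p + 1 + t.len)
  isRun : IsRun w t (p + 1) j

theorem IsTile.lt_gap (ht : IsTile w b J p j t) (h : TilingData (ofDyck w) b J) (hpk : p + 1 ≤ k)
    (hk : k ≤ p + 1 + t.len) : j < gap (ofDyck w) b k := by
  rcases Nat.eq_or_lt_of_le hpk with rfl | hlt
  · exact ht.lt_gap_start
  · obtain ⟨i, rfl⟩ : ∃ i, k = i + 1 := ⟨k - 1, by omega⟩
    exact (ht.isMaxRun.2.2.2 i (by omega) (by omega)).trans_le (h.joint_le_gap_succ i)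

theorem IsTile.unique (ht : IsTile w b J p j t) (ht' : IsTile w b J p' j' t') (hx : x ∈ t.boxes)
    (hx' : x ∈ t'.boxes) : t = t' := by
  obtain ⟨k, rfl⟩ := ht.isRun.exists_eq_cell hx
  obtain ⟨-, hpk, hk⟩ := ht.isRun.cell_mem_boxes_iff.1 hx
  obtain ⟨rfl, hpk', hk'⟩ := ht'.isRun.cell_mem_boxes_iff.1 hx'
  obtain ⟨rfl, hlen⟩ := ht.isMaxRun.unique ht'.isMaxRun hpk hk hpk' hk'
  exact ht.isRun.eq_of_len_eq ht'.isRun (by omega)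

theorem exists_isMaxRun (h : TilingData (ofDyck w) b J) (j : ℕ) (hk : 0 < k) :
    ∃ p r, IsMaxRun J j p r ∧ p < k ∧ k ≤ r := by
  obtain ⟨p, hpk, hp, hlt_start⟩ := h.exists_run_start j hk
  obtain ⟨r, hkr, hr, hlt_end⟩ := h.exists_run_end k j
  refine ⟨p, r, ⟨by omega, hp, hr, fun i hpi hir => ?_⟩, hpk, hkr⟩
  rcases lt_or_ge i k with hik | hki
  · exact hlt_start i hpi hik
  · exact hlt_end i hki hir

theorem exists_isRun {r : ℕ} (h : IsExcursion (ofDyck w) p r) (hpr : p ≤ r) (j : ℕ) :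
    ∃ t, IsRun w t p j ∧ r = p + t.len := by
  obtain ⟨m, rfl⟩ := Nat.exists_eq_add_of_le hpr
  obtain ⟨hend, hpos⟩ := h
  obtain ⟨path, hlen, hpath⟩ := exists_ofDyck_eq (a := fun i => ofDyck w (p + i)) (m := m)
    (by rw [height_add] at hend; omega)
    (fun i hi => by
      have := hpos (p + i) (by omega) (by omega)
      rw [height_add (ofDyck w) p i] at this; omega)
  refine ⟨⟨cell w p j, path⟩, fun i hi => ?_, by rw [len, hlen]⟩
  have hcount : upCount (ofDyck path) i = upCount (fun k => ofDyck w (p + k)) i :=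
    upCount_congr fun k hk => hpath k (by rw [len, hlen] at hi; omega)
  have hadd := upCount_add (ofDyck w) p i
  ext
  · simp only [box, Prod.fst_add, cell_fst, hcount, hadd]; push_cast; ring
  · simp only [box, Prod.snd_add, cell_snd, hcount, hadd]; push_cast; ring

theorem exists_isTile (h : TilingData (ofDyck w) b J) (hj : j < gap (ofDyck w) b k) :
    ∃ p t, IsTile w b J p j t ∧ cell w k j ∈ t.boxes := by
  have hk : 0 < k := by
    by_contra hk
    rw [Nat.eq_zero_of_not_pos hk] at hj
    simp [gap] at hj
  obtain ⟨p, r, hrun, hpk, hkr⟩ := h.exists_isMaxRun j hk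
  obtain ⟨t, ht, rfl⟩ := exists_isRun (h.runs j p r hrun) hrun.1 j
  refine ⟨p, t, ⟨?_, hrun, ht⟩, ht.cell_mem_boxes_iff.2 ⟨rfl, hpk, hkr⟩⟩
  rcases Nat.eq_or_lt_of_le (show p + 1 ≤ k from hpk) with rfl | hlt
  · exact hj
  · exact (hrun.2.2.2 (p + 1) (by omega) (by omega)).trans_le (h.joint_le_gap (p + 1))

theorem exists_isTile_mem_boxes_iff (h : TilingData (ofDyck w) b J) (x : ℤ × ℤ) :
    (∃ t, (∃ p j, IsTile w b J p j t) ∧ x ∈ t.boxes) ↔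
      ∃ k j, j < gap (ofDyck w) b k ∧ x = cell w k j := by
  constructor
  · rintro ⟨t, ⟨p, j, ht⟩, hx⟩
    obtain ⟨k, rfl⟩ := ht.isRun.exists_eq_cell hx
    obtain ⟨-, hpk, hk⟩ := ht.isRun.cell_mem_boxes_iff.1 hx
    exact ⟨k, j, ht.lt_gap h hpk hk, rfl⟩
  · rintro ⟨k, j, hj, rfl⟩
    obtain ⟨p, t, ht, hx⟩ := h.exists_isTile hj
    exact ⟨t, ⟨p, j, ht⟩, hx⟩

theorem IsTile.exists_below (ht : IsTile w b J p (j + 1) t) (h : TilingData (ofDyck w) b J) :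
    ∃ q t', IsTile w b J q j t' ∧ ∀ x ∈ t.boxes, x + (1, -1) ∈ t'.boxes := by
  obtain ⟨q, t', ht', hmem⟩ := h.exists_isTile (k := p + 1) (j := j)
    (by have := ht.lt_gap_start; omega)
  obtain ⟨-, hq, hp⟩ := ht'.isRun.cell_mem_boxes_iff.1 hmem
  refine ⟨q, t', ht', fun x hx => ?_⟩
  obtain ⟨k, rfl⟩ := ht.isRun.exists_eq_cell hx
  obtain ⟨-, hpk, hk⟩ := ht.isRun.cell_mem_boxes_iff.1 hx
  rw [cell_succ_add]
  refine ht'.isRun.cell_mem_boxes_iff.2 ⟨rfl, by omega, ?_⟩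
  by_contra! hlt
  have hend := ht'.isMaxRun.2.2.1
  have := ht.isMaxRun.2.2.2 (q + 1 + t'.len) (by omega) (by omega)
  omega

theorem finite_setOf_isTile (h : TilingData (ofDyck w) b J) :
    {t | ∃ p j, IsTile w b J p j t}.Finite := by
  have hregion : {x : ℕ × ℕ | x.2 < gap (ofDyck w) b x.1}.Finite := by
    refine ((Set.finite_Iio w.toList.length).prod (Set.finite_Iio w.semilength)).subset ?_
    rintro ⟨k, j⟩ hj
    have hle := h.upCount_le_semilength k
    refine ⟨?_, ?_⟩ <;> simp only [Set.mem_ofPred_eq, Set.mem_Iio, gap] at hj ⊢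
    · by_contra! hk
      have := upCount_mono (a := ofDyck w) hk
      rw [upCount_ofDyck_length] at this
      omega
    · omega
  refine Set.Finite.of_injOn (f := start) ?_ ?_ (hregion.image fun x => cell w x.1 x.2)
  · rintro t ⟨p, j, ht⟩
    exact ⟨(p + 1, j), ht.lt_gap_start, ht.isRun.start_eq.symm⟩
  · rintro t ⟨p, j, ht⟩ t' ⟨p', j', ht'⟩ hstart
    exact ht.unique ht' start_mem_boxes (hstart ▸ start_mem_boxes)

theorem exists_dyckTiling_mem_tiles_iff (h : TilingData (ofDyck w) b J) :
    ∃ D : DyckTiling w, ofDyck D.top = b ∧ ∀ t, t ∈ D.tiles ↔ ∃ p j, IsTile w b J p j t := by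
  obtain ⟨top, hs, rfl⟩ := h.exists_top
  have hmem (t) : t ∈ h.finite_setOf_isTile.toFinset ↔
      ∃ p j, IsTile w (ofDyck top) J p j t := by simp
  refine ⟨{ top, tiles := h.finite_setOf_isTile.toFinset, semilength_top := hs
            top_above := fun k => ?_, disjoint := ?_, union := ?_, cover_inclusive := ?_ },
    rfl, hmem⟩
  · rw [count_U_take, count_U_take]
    exact h.above k
  · intro t ht t' ht' hne
    obtain ⟨p, j, hT⟩ := (hmem t).1 ht
    obtain ⟨p', j', hT'⟩ := (hmem t').1 ht'
    exact Set.disjoint_left.2 fun x hx hx' => hne (hT.unique hT' hx hx')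
  · ext x
    simp only [Set.mem_iUnion, exists_prop, hmem, Set.mem_ofPred_eq]
    rw [h.exists_isTile_mem_boxes_iff, boxAbove_and_not_boxAbove_iff hs]
  · intro t ht
    obtain ⟨p, j, hT⟩ := (hmem t).1 ht
    cases j with
    | zero =>
      refine Or.inr fun x hx => ?_
      obtain ⟨k, rfl⟩ := hT.isRun.exists_eq_cell hx
      exact not_boxAbove_cell_zero_add k
    | succ j =>
      obtain ⟨q, t', hT', hsub⟩ := hT.exists_below h
      exact Or.inl ⟨t', (hmem t').2 ⟨q, j, hT'⟩, hsub⟩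

theorem joint_iff_of_mem_tiles_iff (h : TilingData (ofDyck w) b J) {D : DyckTiling w}
    (hD : ∀ t, t ∈ D.tiles ↔ ∃ p j, IsTile w b J p j t) : D.Joint k j ↔ j < J k := by
  constructor
  · rintro ⟨t, ht, hmem, hmem_succ⟩
    obtain ⟨p, j, hT⟩ := (hD t).1 ht
    obtain ⟨rfl, hpk, -⟩ := hT.isRun.cell_mem_boxes_iff.1 hmem
    obtain ⟨-, -, hk⟩ := hT.isRun.cell_mem_boxes_iff.1 hmem_succ
    exact hT.isMaxRun.2.2.2 k hpk hk
  · intro hj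
    obtain ⟨p, t, hT, hmem⟩ := h.exists_isTile (hj.trans_le (h.joint_le_gap k))
    obtain ⟨-, hpk, hk⟩ := hT.isRun.cell_mem_boxes_iff.1 hmem
    have hne : k ≠ p + 1 + t.len := by
      rintro rfl
      exact absurd hT.isMaxRun.2.2.1 (by omega)
    exact ⟨t, (hD t).2 ⟨p, j, hT⟩, hmem, hT.isRun.cell_mem_boxes_iff.2 ⟨rfl, by omega, by omega⟩⟩

theorem exists_dyckTiling (h : TilingData (ofDyck w) b J) :
    ∃ D : DyckTiling w, ofDyck D.top = b ∧ D.jointCount = J := by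
  obtain ⟨D, htop, hD⟩ := h.exists_dyckTiling_mem_tiles_iff
  refine ⟨D, htop, funext fun k => eq_of_forall_lt_iff fun j => ?_⟩
  rw [← D.joint_iff, h.joint_iff_of_mem_tiles_iff hD]

end TilingOfData

end TilingData

namespace TreeEdge

variable {w : DyckWord} {c : TreeEdge w → ℕ} {e f : TreeEdge w}

/-- The position of the up step in the row of `e` of the upper boundary path, when this row has
`c e` boxes. -/
def topPosition (c : TreeEdge w → ℕ) (e : TreeEdge w) : ℕ := e.opening - c e

open Classical in
/-- The upper boundary path of the region with `c e` boxes in the row of each edge `e`. -/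
noncomputable def topWord (c : TreeEdge w → ℕ) : BinaryWord :=
  fun k => decide (∃ e, topPosition c e = k)

theorem topWord_eq_true_iff {k : ℕ} : topWord c k = true ↔ ∃ e, topPosition c e = k :=
  decide_eq_true_iff

theorem topWord_topPosition (e : TreeEdge w) : topWord c (topPosition c e) = true :=
  topWord_eq_true_iff.2 ⟨e, rfl⟩

theorem row_add_leftCount (e : TreeEdge w) : e.row + e.leftCount = e.opening := by
  rw [leftCount_eq, row_eq_upCount]
  exact Nat.add_sub_of_le (upCount_le _)

theorem leftCount_le_opening (e : TreeEdge w) : e.leftCount ≤ e.opening :=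
  (Nat.le_add_left _ _).trans_eq e.row_add_leftCount

theorem leftCount_le_leftCount (h : e.opening ≤ f.opening) : e.leftCount ≤ f.leftCount := by
  rw [leftCount_eq, leftCount_eq, row_eq_upCount, row_eq_upCount]
  exact sub_upCount_mono _ h

theorem topPosition_lt (hle : ∀ e, c e ≤ e.leftCount) (hc : RowMonotone c)
    (h : e.opening < f.opening) : topPosition c e < topPosition c f := by
  have hmono := hc e f h
  have hrow := row_lt_row h
  have he := e.row_add_leftCount
  have hf := f.row_add_leftCount
  have := hle e
  have := hle f
  unfold topPosition
  omega

theorem topPosition_lt_iff (hle : ∀ e, c e ≤ e.leftCount) (hc : RowMonotone c) :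
    topPosition c e < topPosition c f ↔ e.opening < f.opening := by
  refine ⟨fun h => ?_, topPosition_lt hle hc⟩
  by_contra! hge
  rcases hge.eq_or_lt with heq | hlt
  · exact h.ne (congrArg _ (opening_injective heq.symm))
  · exact h.not_gt (topPosition_lt hle hc hlt)

theorem topPosition_injective (hle : ∀ e, c e ≤ e.leftCount) (hc : RowMonotone c) :
    Function.Injective (topPosition c) := fun e f h => by
  rcases lt_trichotomy e.opening f.opening with hlt | heq | hgt
  · exact absurd h (topPosition_lt hle hc hlt).ne
  · exact opening_injective heq
  · exact absurd h (topPosition_lt hle hc hgt).ne'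

theorem upCount_eq_card_of_injective {a : BinaryWord} {P : TreeEdge w → ℕ}
    (hinj : Function.Injective P) (ha : ∀ k, a k = true ↔ ∃ e, P e = k) (k : ℕ) :
    upCount a k = (Finset.univ.filter fun e => P e < k).card := by
  rw [upCount_eq_card_filter, ← Finset.card_image_of_injective _ hinj]
  congr 1
  ext i
  simp only [Finset.mem_filter, Finset.mem_range, ha, Finset.mem_image, Finset.mem_univ, true_and]
  constructor
  · rintro ⟨hik, e, rfl⟩
    exact ⟨e, hik, rfl⟩
  · rintro ⟨e, hek, rfl⟩
    exact ⟨hek, e, rfl⟩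

theorem upCount_ofDyck_eq_card (k : ℕ) :
    upCount (ofDyck w) k = (Finset.univ.filter fun e : TreeEdge w => e.opening < k).card :=
  upCount_eq_card_of_injective opening_injective
    (fun _ => ⟨exists_opening_eq, fun ⟨e, he⟩ => he ▸ e.ofDyck_opening⟩) k

theorem upCount_topWord (hle : ∀ e, c e ≤ e.leftCount) (hc : RowMonotone c) (k : ℕ) :
    upCount (topWord c) k = (Finset.univ.filter fun e => topPosition c e < k).card :=
  upCount_eq_card_of_injective (topPosition_injective hle hc) (fun _ => topWord_eq_true_iff) k

theorem lineWeight_topWord (hle : ∀ e, c e ≤ e.leftCount) (hc : RowMonotone c) (e : TreeEdge w) :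
    lineWeight (ofDyck w) (topWord c) (fun _ => 0) e.opening 0 = c e := by
  rw [TilingData.lineWeight_eq_sub (topWord_topPosition e), topPosition,
    Nat.sub_sub_self ((hle e).trans e.leftCount_le_opening)]
  rw [upCount_topWord hle hc, upCount_ofDyck_eq_card]
  simp only [topPosition_lt_iff hle hc, add_zero]

theorem tilingData_topWord (hle : ∀ e, c e ≤ e.leftCount) (hc : RowMonotone c) :
    TilingData (ofDyck w) (topWord c) fun _ => 0 := by
  have htop_le (e : TreeEdge w) : topPosition c e ≤ e.opening := Nat.sub_le _ _
  refine .of_joint_eq_zero (fun k => ?_) ⟨w.toList.length, fun k hk => ?_⟩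
  · rw [upCount_topWord hle hc, upCount_ofDyck_eq_card]
    exact Finset.card_le_card (Finset.monotone_filter_right _ fun e _ => (htop_le e).trans_lt)
  · have hlt (e : TreeEdge w) : e.opening < k :=
      (lt_length_of_ofDyck e.ofDyck_opening).trans_le hk
    refine ⟨ofDyck_of_length_le hk, ?_, ?_⟩
    · rw [← Bool.not_eq_true, topWord_eq_true_iff]
      rintro ⟨e, he⟩
      exact absurd (hlt e) (he ▸ htop_le e).not_gt
    · rw [upCount_topWord hle hc, upCount_ofDyck_eq_card]
      simp only [hlt, (htop_le _).trans_lt (hlt _)]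

end TreeEdge

namespace DyckTiling

variable {w : DyckWord} {D : DyckTiling w} {L L' : DecreasingLabel w}

theorem existsUnique_hasLabel (L : DecreasingLabel w) : ∃! D : DyckTiling w, D.HasLabel L := by
  obtain ⟨b, J, h, hL⟩ := L.isPeakGrowth.exists_tilingData
  obtain ⟨D, rfl, rfl⟩ := h.exists_dyckTiling
  refine ⟨D, (D.hasLabel_iff L).2 hL, fun D' hD' => ?_⟩
  obtain ⟨htop, hJ⟩ :=
    L.isPeakGrowth.tilingData_unique D'.tilingData h ((D'.hasLabel_iff L).1 hD') hL
  exact eq_of_jointCount_eq htop hJ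

theorem HasLabel.unique (h : D.HasLabel L) (h' : D.HasLabel L') : L = L' :=
  DecreasingLabel.code_injective (funext fun e => (h e).trans (h' e).symm)

theorem HasLabel.contains312 (h : D.HasLabel L) (hD : ¬ D.IsTrivial) : L.Contains312 := by
  rw [D.isTrivial_iff] at hD
  push Not at hD
  obtain ⟨k, hk⟩ := hD
  obtain ⟨f, e, g, hf, he, hg, hfe, heg, hlt, hlt'⟩ :=
    D.tilingData.contains312 L.isPeakGrowth ((D.hasLabel_iff L).1 h) (Nat.pos_of_ne_zero hk)
  obtain ⟨f, rfl⟩ := exists_opening_eq hf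
  obtain ⟨e, rfl⟩ := exists_opening_eq he
  obtain ⟨g, rfl⟩ := exists_opening_eq hg
  simp only [DecreasingLabel.wordLabel_opening, Fin.val_fin_lt] at hlt hlt'
  exact ⟨g, e, f, strictlyLeft_iff_closedBefore.2 heg, strictlyLeft_iff_closedBefore.2 hfe,
    hlt, hlt'⟩

theorem HasLabel.card_lineTiles (h : D.HasLabel L) (hD : D.IsTrivial) (e : TreeEdge w) :
    (D.lineTiles e.row).card = L.code e := by
  classical
  rw [h e, Finset.card_eq_sum_ones]
  refine Finset.sum_congr rfl fun t ht => ?_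
  unfold lineTiles at ht
  rw [DyckTile.weight, hD t (Finset.mem_filter.1 ht).1]

theorem HasLabel.exists_top_edge (h : D.HasLabel L) (hD : D.IsTrivial) (e : TreeEdge w) :
    ∃ e' : TreeEdge D.top, e'.row = e.row ∧ e.leftCount = L.code e + e'.leftCount := by
  have hJ : D.jointCount = fun _ => 0 := funext (D.isTrivial_iff.1 hD)
  obtain ⟨e', he'⟩ := exists_row_eq (w := D.top) (r := e.row)
    (by rw [D.semilength_top]; exact e.row_lt_semilength)
  have hcode := (D.hasLabel_iff L).1 h _ e.ofDyck_opening
  rw [L.wordCode_eq_code, hJ, TilingData.lineWeight_eq_sub e'.ofDyck_opening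
    (by rw [← e'.row_eq_upCount, he', e.row_eq_upCount, add_zero])] at hcode
  have hle : e'.opening ≤ e.opening := by
    rw [← upCount_le_row_iff e, ← he', e'.row_eq_upCount]
    exact D.upCount_le_upCount_top _
  have hw := e.row_add_leftCount
  have htop := e'.row_add_leftCount
  exact ⟨e', he', by omega⟩

theorem HasLabel.rowMonotone (h : D.HasLabel L) (hD : D.IsTrivial) : RowMonotone L.code := by
  intro e f hef
  obtain ⟨e', he', he⟩ := h.exists_top_edge hD e
  obtain ⟨f', hf', hf⟩ := h.exists_top_edge hD f
  have hrow := row_lt_row hef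
  have hle : e'.leftCount ≤ f'.leftCount :=
    leftCount_le_leftCount (row_lt_row_iff.1 (by omega)).le
  omega

theorem HasLabel.isTrivial (h : D.HasLabel L) (hL : RowMonotone L.code) : D.IsTrivial := by
  have hle (e : TreeEdge w) : L.code e ≤ e.leftCount :=
    (Nat.le_add_right _ _).trans_eq (L.code_add_leftLarger e)
  have hlabel : HasWordLabel (ofDyck w) (topWord L.code) (fun _ => 0) L.wordLabel := by
    intro k hk
    obtain ⟨e, rfl⟩ := exists_opening_eq hk
    rw [L.wordCode_eq_code, lineWeight_topWord hle hL]
  obtain ⟨-, hJ⟩ := L.isPeakGrowth.tilingData_unique D.tilingData (tilingData_topWord hle hL)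
    ((D.hasLabel_iff L).1 h) hlabel
  exact D.isTrivial_iff.2 (congrFun hJ)

end DyckTiling

/-! ### The determinant as a count of increasing sequences -/

namespace LatticePath

/-- The generating function of the chains `x ≤ u₁ ≤ ⋯ ≤ uₘ ≤ τ`, weighted by `u₁ + ⋯ + uₘ`. The
`uᵢ` are the `x`-coordinates of the down steps of a right-down path, up to normalization. -/
noncomputable def chain (τ : ℤ) : ℕ → ℤ → ℤ[T;T⁻¹]
  | 0, x => if x ≤ τ then 1 else 0
  | m + 1, x => ∑ u ∈ Finset.Icc x τ, T u * chain τ m u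

section Chain

variable {τ σ x y z : ℤ}

theorem chain_of_lt (h : τ < x) (m : ℕ) : chain τ m x = 0 := by
  cases m with
  | zero => rw [chain, if_neg (by omega)]
  | succ m => rw [chain, Finset.Icc_eq_empty (by omega), Finset.sum_empty]

theorem chain_succ (h : x ≤ τ) (m : ℕ) :
    chain τ (m + 1) x = T x * chain τ m x + chain τ (m + 1) (x + 1) := by
  rw [chain, chain, ← Finset.insert_Icc_add_one_left_eq_Icc h, Finset.sum_insert (by simp)]

theorem sum_Icc_mul_chain (h : τ ≤ σ) (m : ℕ) :
    ∑ u ∈ Finset.Icc x σ, T u * chain τ m u = chain τ (m + 1) x := by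
  rw [chain]
  refine (Finset.sum_subset (Finset.Icc_subset_Icc_right h) fun u hu hu' => ?_).symm
  rw [Finset.mem_Icc] at hu hu'
  rw [chain_of_lt (by omega), mul_zero]

theorem sum_rdWeight_right (l : List (List RDStep)) (y : ℤ) :
    ((l.map (RDStep.right :: ·)).map (rdWeight y)).sum =
      T (y + 1) * (l.map (rdWeight y)).sum := by
  rw [List.map_map, ← List.sum_map_mul_left]
  rfl

theorem sum_rdWeight_down (l : List (List RDStep)) (y : ℤ) :
    ((l.map (RDStep.down :: ·)).map (rdWeight y)).sum = (l.map (rdWeight (y - 1))).sum := by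
  rw [List.map_map]
  rfl

/-- Summation by parts: a down step at `u` lowers the weight of the right steps after it, so that
it contributes `q ^ u` relative to the path which takes its down steps at the origin. -/
theorem sum_rdPaths (τ : ℤ) (a b : ℕ) (y : ℤ) :
    ((rdPaths a b).map (rdWeight y)).sum =
      T ((y - b + 1) * τ - (y + 1) * (τ - a)) * chain τ b (τ - a) := by
  induction a, b using rdPaths.induct generalizing y with
  | case1 => simp [rdPaths, rdWeight, chain]
  | case2 a ih =>
    rw [rdPaths, sum_rdWeight_right, ih, chain, chain, if_pos (by omega), if_pos (by omega),
      mul_one, mul_one, ← T_add]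
    congr 1
    push_cast; ring
  | case3 b ih =>
    rw [rdPaths, sum_rdWeight_down, ih, chain_succ (by simp),
      chain_of_lt (x := τ - ((0 : ℕ) : ℤ) + 1) (by simp), add_zero, ← mul_assoc, ← T_add]
    congr 2
    push_cast; ring
  | case4 a b ih_right ih_down =>
    have hx : τ - ((a + 1 : ℕ) : ℤ) + 1 = τ - a := by push_cast; ring
    rw [rdPaths, List.map_append, List.sum_append, sum_rdWeight_right, sum_rdWeight_down,
      ih_right, ih_down, chain_succ (x := τ - ((a + 1 : ℕ) : ℤ)) (by push_cast; omega), hx,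
      mul_add, ← mul_assoc, ← mul_assoc, ← T_add, ← T_add, add_comm]
    congr 3 <;> (push_cast; ring)

theorem rdWeightSum_eq (x y τ : ℤ) (m : ℕ) :
    rdWeightSum (x, y) (τ, y - m) = T ((y - m + 1) * τ - (y + 1) * x) * chain τ m x := by
  unfold rdWeightSum
  by_cases h : x ≤ τ
  · have hx : τ - (((τ - x).toNat : ℕ) : ℤ) = x := by omega
    have hm : (y - (y - m)).toNat = m := by omega
    rw [if_pos ⟨h, by simp⟩]
    simp only [hm]
    rw [sum_rdPaths τ, hx]
  · rw [if_neg (fun h' => h h'.1), chain_of_lt (by omega), mul_zero]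

theorem rdWeightSum_eq_zero (h : y < z) : rdWeightSum (x, y) (τ, z) = 0 :=
  if_neg fun h' => h.not_ge h'.2

end Chain

/-- The generating function of the sequences `u₀ < ⋯ < u_{b-1} < v` with `sᵢ ≤ uᵢ ≤ tᵢ`. -/
noncomputable def below (s t : ℕ → ℤ) : ℕ → ℤ → ℤ[T;T⁻¹]
  | 0, _ => 1
  | b + 1, v => ∑ u ∈ (Finset.Icc (s b) (t b)).filter (· < v), T u * below s t b u

/-- The generating function of the sequences `u₀ < ⋯ < u_{b-1}` with `sᵢ ≤ uᵢ ≤ tᵢ`. -/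
noncomputable def total (s t : ℕ → ℤ) : ℕ → ℤ[T;T⁻¹]
  | 0 => 1
  | b + 1 => ∑ u ∈ Finset.Icc (s b) (t b), T u * below s t b u

variable {s t : ℕ → ℤ} {b n N : ℕ} {v : ℤ}

theorem sum_Icc_mul_below (ht : ∀ a ≤ b, t a ≤ t b)
    (h : ∀ u, v ≤ u → u ≤ t b → below s t b u =
      ∑ a ∈ Finset.range (b + 1), (-1) ^ (b - a) * total s t a * chain (t a) (b - a) u) :
    ∑ u ∈ Finset.Icc v (t b), T u * below s t b u =
      ∑ a ∈ Finset.range (b + 1),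
        (-1) ^ (b - a) * total s t a * chain (t a) (b + 1 - a) v := by
  have hterm : ∀ u ∈ Finset.Icc v (t b), T u * below s t b u = ∑ a ∈ Finset.range (b + 1),
      (-1) ^ (b - a) * total s t a * (T u * chain (t a) (b - a) u) := by
    intro u hu
    rw [Finset.mem_Icc] at hu
    rw [h u hu.1 hu.2, Finset.mul_sum]
    exact Finset.sum_congr rfl fun a _ => by ring
  rw [Finset.sum_congr rfl hterm, Finset.sum_comm]
  refine Finset.sum_congr rfl fun a ha => ?_
  have hab : a ≤ b := Finset.mem_range_succ_iff.1 ha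
  rw [← Finset.mul_sum, sum_Icc_mul_chain (ht a hab), show b + 1 - a = b - a + 1 by omega]

/-- Inclusion-exclusion on the length of the final weakly decreasing run `v ≤ u_{b-1} ≤ ⋯ ≤ u_a`
of a sequence whose first `a` terms increase. -/
theorem below_eq_sum_chain (ht : MonotoneOn t (Set.Iic b)) (hv : ∀ a < b, s a ≤ v)
    (hvt : v ≤ t b) : below s t b v =
      ∑ a ∈ Finset.range (b + 1), (-1) ^ (b - a) * total s t a * chain (t a) (b - a) v := by
  induction b generalizing v with
  | zero => simp [below, total, chain, hvt]
  | succ c ih =>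
    have ht' : MonotoneOn t (Set.Iic c) := ht.mono (Set.Iic_subset_Iic.2 c.le_succ)
    have habove : ∑ u ∈ Finset.Icc v (t c), T u * below s t c u = _ :=
      sum_Icc_mul_below (s := s) (fun a ha => ht' ha Set.self_mem_Iic ha) fun u hu hut =>
        ih ht' (fun a ha => (hv a (by omega)).trans hu) hut
    have hsplit : total s t (c + 1) = below s t (c + 1) v +
        ∑ u ∈ Finset.Icc v (t c), T u * below s t c u := by
      have hvc := hv c c.lt_succ_self
      rw [total, below, ← Finset.sum_filter_add_sum_filter_not _ (· < v)]
      congr 2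
      ext u
      simp only [Finset.mem_filter, Finset.mem_Icc, not_lt]
      omega
    rw [Finset.sum_range_succ, eq_sub_of_add_eq hsplit.symm, habove, Nat.sub_self, pow_zero,
      one_mul, chain, if_pos hvt, mul_one, sub_eq_add_neg, add_comm, ← Finset.sum_neg_distrib]
    congr 1
    refine Finset.sum_congr rfl fun a ha => ?_
    rw [Nat.succ_sub (Finset.mem_range_succ_iff.1 ha), pow_succ]
    ring

theorem total_succ (hs : MonotoneOn s (Set.Iic b)) (ht : MonotoneOn t (Set.Iic b)) :
    total s t (b + 1) = ∑ a ∈ Finset.range (b + 1),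
      (-1) ^ (b - a) * total s t a * chain (t a) (b + 1 - a) (s b) :=
  sum_Icc_mul_below (fun _ ha => ht ha Set.self_mem_Iic ha) fun _ hu hut =>
    below_eq_sum_chain ht (fun _ ha => (hs ha.le Set.self_mem_Iic ha.le).trans hu) hut

/-- The Hessenberg matrix of the chain generating functions, which is the matrix of the path
generating functions up to monomial factors in its rows and columns. -/
noncomputable def chainMatrix (s t : ℕ → ℤ) (n : ℕ) : Matrix (Fin n) (Fin n) ℤ[T;T⁻¹] :=
  Matrix.of fun i j => if (j : ℕ) ≤ i + 1 then chain (t j) (i + 1 - j) (s i) else 0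

theorem sum_range_total_mul_chain (hs : MonotoneOn s (Set.Iic b)) (ht : MonotoneOn t (Set.Iic b)) :
    ∑ a ∈ Finset.range (b + 1), (-1) ^ a * total s t a * chain (t a) (b + 1 - a) (s b) =
      (-1) ^ b * total s t (b + 1) := by
  rw [total_succ hs ht, Finset.mul_sum]
  refine Finset.sum_congr rfl fun a ha => ?_
  have hab : a ≤ b := Finset.mem_range_succ_iff.1 ha
  have hsign : ((-1) ^ b * (-1) ^ (b - a) : ℤ[T;T⁻¹]) = (-1) ^ a := by
    rw [← pow_add, show b + (b - a) = 2 * (b - a) + a by omega, pow_add, pow_mul]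
    simp
  rw [← hsign]
  ring

theorem sum_total_smul_chainMatrix (hs : MonotoneOn s (Set.Iio (N + 1)))
    (ht : MonotoneOn t (Set.Iio (N + 1))) (hst : ∀ i < N, s i ≤ t (i + 1)) (i : Fin (N + 1)) :
    ∑ j : Fin (N + 1), ((-1) ^ (j : ℕ) * total s t j) • chainMatrix s t (N + 1) i j =
      if i = Fin.last N then (-1) ^ N * total s t (N + 1) else 0 := by
  let entry (j : ℕ) : ℤ[T;T⁻¹] :=
    (-1) ^ j * total s t j * if j ≤ i + 1 then chain (t j) (i + 1 - j) (s i) else 0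
  have hIic : Set.Iic (i : ℕ) ⊆ Set.Iio (N + 1) := fun a ha => lt_of_le_of_lt ha i.2
  have hhead : ∑ j ∈ Finset.range ((i : ℕ) + 1), entry j =
      (-1) ^ (i : ℕ) * total s t (i + 1) := by
    rw [← sum_range_total_mul_chain (hs.mono hIic) (ht.mono hIic)]
    refine Finset.sum_congr rfl fun j hj => ?_
    simp only [entry]
    rw [if_pos (Finset.mem_range.1 hj).le]
  have hsum : ∑ j : Fin (N + 1), ((-1) ^ (j : ℕ) * total s t j) • chainMatrix s t (N + 1) i j =
      ∑ j ∈ Finset.range (N + 1), entry j := by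
    rw [Finset.sum_range]; rfl
  rw [hsum]
  by_cases hi : i = Fin.last N
  · rw [if_pos hi]
    rw [hi, Fin.val_last] at hhead
    exact hhead
  · have hiN : (i : ℕ) < N := Fin.val_lt_last hi
    have htail : ∀ j ∈ Finset.range (N + 1), j ∉ Finset.range ((i : ℕ) + 2) → entry j = 0 := by
      intro j _ hj
      rw [Finset.mem_range] at hj
      simp only [entry]
      rw [if_neg (by omega), mul_zero]
    rw [if_neg hi, ← Finset.sum_subset (Finset.range_mono (by omega)) htail,
      Finset.sum_range_succ, hhead]
    simp only [entry]
    rw [if_pos le_rfl, Nat.sub_self, chain, if_pos (hst i hiN), pow_succ]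
    ring

theorem det_submatrix_chainMatrix (hst : ∀ i < N, s i ≤ t (i + 1)) :
    ((chainMatrix s t (N + 1)).submatrix (Fin.last N).succAbove Fin.succ).det = 1 := by
  have hentry : ∀ i j : Fin N,
      (chainMatrix s t (N + 1)).submatrix (Fin.last N).succAbove Fin.succ i j =
        if (j : ℕ) ≤ i then chain (t (j + 1)) (i - j) (s i) else 0 := by
    intro i j
    rw [Matrix.submatrix_apply, Fin.succAbove_last_apply]
    simp [chainMatrix]
  rw [Matrix.det_of_isLowerTriangular]
  · refine Finset.prod_eq_one fun i _ => ?_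
    rw [hentry, if_pos le_rfl, Nat.sub_self, chain, if_pos (hst i i.2)]
  · intro i j hij
    rw [hentry, if_neg (not_le.2 (show (i : ℕ) < j from hij))]

/-- Adding to the first column the other ones with the coefficients `(-1) ^ j * total s t j` leaves
only its last entry, by the recursion for `total`. -/
theorem det_chainMatrix (hs : MonotoneOn s (Set.Iio n)) (ht : MonotoneOn t (Set.Iio n))
    (hst : ∀ i, i + 1 < n → s i ≤ t (i + 1)) : (chainMatrix s t n).det = total s t n := by
  cases n with
  | zero => simp [total]
  | succ N =>
    have hst' : ∀ i < N, s i ≤ t (i + 1) := fun i hi => hst i (by omega)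
    let z : Fin (N + 1) → ℤ[T;T⁻¹] := fun j => (-1) ^ (j : ℕ) * total s t j
    have hdet := Matrix.det_updateCol_sum (chainMatrix s t (N + 1)) 0 z
    rw [show z 0 = 1 by simp [z, total], one_smul] at hdet
    have hcol := sum_total_smul_chainMatrix hs ht hst'
    have hminor : ((chainMatrix s t (N + 1)).updateCol 0 fun k =>
        ∑ j, z j • chainMatrix s t (N + 1) k j).submatrix (Fin.last N).succAbove Fin.succ =
        (chainMatrix s t (N + 1)).submatrix (Fin.last N).succAbove Fin.succ := by
      ext i j
      rw [Matrix.submatrix_apply, Matrix.updateCol_ne (Fin.succ_ne_zero j), Matrix.submatrix_apply]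
    rw [← hdet, Matrix.det_succ_column_zero, Finset.sum_eq_single (Fin.last N)]
    · rw [Matrix.updateCol_self, hcol, if_pos rfl, hminor, det_submatrix_chainMatrix hst',
        mul_one, ← mul_assoc, Fin.val_last, ← pow_add, (Even.add_self N).neg_one_pow, one_mul]
    · intro i _ hi
      rw [Matrix.updateCol_self, hcol, if_neg hi, mul_zero, zero_mul]
    · exact fun h => absurd (Finset.mem_univ _) h

open Classical in
/-- The sequences `u₀ < ⋯ < u_{b-1}` with `sᵢ ≤ uᵢ ≤ tᵢ`, which parametrize the labels with a
monotone code. -/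
noncomputable def increasing (s t : ℕ → ℤ) (b : ℕ) : Finset (Fin b → ℤ) :=
  (Fintype.piFinset fun i : Fin b => Finset.Icc (s i) (t i)).filter StrictMono

theorem mem_increasing {u : Fin b → ℤ} :
    u ∈ increasing s t b ↔ (∀ i : Fin b, s i ≤ u i ∧ u i ≤ t i) ∧ StrictMono u := by
  simp [increasing]

theorem strictMono_snoc {u : Fin b → ℤ} {x : ℤ} :
    StrictMono (Fin.snoc u x : Fin (b + 1) → ℤ) ↔ StrictMono u ∧ ∀ i, u i < x := by
  constructor
  · exact fun h => ⟨fun i j hij => by simpa using h (Fin.castSucc_lt_castSucc_iff.2 hij),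
      fun i => by simpa using h (Fin.castSucc_lt_last i)⟩
  · rintro ⟨hu, hx⟩ i j
    induction i using Fin.lastCases with
    | last => exact fun hij => absurd hij (Fin.le_last j).not_gt
    | cast i =>
      induction j using Fin.lastCases with
      | last => simpa using hx i
      | cast j => simpa using @hu i j

theorem sum_increasing_succ (P : ℤ → Prop) [DecidablePred P] :
    ∑ u ∈ (increasing s t (b + 1)).filter (fun u => P (u (Fin.last b))), T (∑ i, u i) =
      ∑ x ∈ (Finset.Icc (s b) (t b)).filter P, T x *
        ∑ u ∈ (increasing s t b).filter (fun u => ∀ i, u i < x), (T (∑ i, u i) : ℤ[T;T⁻¹]) := by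
  simp_rw [Finset.mul_sum]
  rw [Finset.sum_sigma']
  symm
  refine Finset.sum_bij' (fun x _ => Fin.snoc x.2 x.1)
    (fun u _ => ⟨u (Fin.last b), Fin.init u⟩) ?_ ?_ ?_ ?_ ?_
  · rintro ⟨x, u⟩ hx
    simp only [Finset.mem_sigma, Finset.mem_filter, Finset.mem_Icc, mem_increasing] at hx ⊢
    refine ⟨⟨fun i => ?_, strictMono_snoc.2 ⟨hx.2.1.2, hx.2.2⟩⟩, by simpa using hx.1.2⟩
    induction i using Fin.lastCases with
    | last => simpa using hx.1.1
    | cast i => simpa using hx.2.1.1 i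
  · intro u hu
    simp only [Finset.mem_sigma, Finset.mem_filter, Finset.mem_Icc, mem_increasing] at hu ⊢
    obtain ⟨hinit, hlast⟩ := strictMono_snoc.1 ((Fin.snoc_init_self u).symm ▸ hu.1.2)
    exact ⟨⟨by simpa using hu.1.1 (Fin.last b), hu.2⟩,
      ⟨fun i => by simpa [Fin.init] using hu.1.1 i.castSucc, hinit⟩, hlast⟩
  · rintro ⟨x, u⟩ _
    simp
  · exact fun u _ => Fin.snoc_init_self u
  · rintro ⟨x, u⟩ _
    rw [Fin.sum_univ_castSucc, ← T_add, add_comm]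
    simp

theorem sum_increasing_zero (P : (Fin 0 → ℤ) → Prop) [DecidablePred P] (hP : ∀ u, P u) :
    ∑ u ∈ (increasing s t 0).filter P, (T (∑ i, u i) : ℤ[T;T⁻¹]) = 1 := by
  have huniv : (increasing s t 0).filter P = {default} := by
    ext u
    simp [mem_increasing, hP, Subsingleton.elim u default, Subsingleton.strictMono]
  rw [huniv]
  simp

theorem below_eq_sum_increasing (b : ℕ) (v : ℤ) : below s t b v =
    ∑ u ∈ (increasing s t b).filter (fun u => ∀ i, u i < v), T (∑ i, u i) := by
  induction b generalizing v with
  | zero => rw [below, sum_increasing_zero _ fun u i => i.elim0]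
  | succ b ih =>
    have hlast : ∀ u ∈ increasing s t (b + 1), (∀ i, u i < v) ↔ u (Fin.last b) < v :=
      fun u hu => ⟨fun h => h _, fun h i =>
        ((mem_increasing.1 hu).2.monotone (Fin.le_last i)).trans_lt h⟩
    simp_rw [below, ih]
    rw [Finset.filter_congr hlast, sum_increasing_succ (· < v)]

theorem total_eq_sum_increasing (b : ℕ) :
    total s t b = ∑ u ∈ increasing s t b, T (∑ i, u i) := by
  cases b with
  | zero =>
    have h := sum_increasing_zero (s := s) (t := t) (fun _ => True) fun _ => trivial
    rwa [Finset.filter_true, eq_comm] at h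
  | succ b =>
    have h := sum_increasing_succ (s := s) (t := t) (b := b) (fun _ => True)
    simp only [Finset.filter_true, ← below_eq_sum_increasing] at h
    exact h.symm

theorem prod_T {ι : Type*} (S : Finset ι) (g : ι → ℤ) :
    (∏ i ∈ S, T (g i) : ℤ[T;T⁻¹]) = T (∑ i ∈ S, g i) := by
  classical
  induction S using Finset.induction_on with
  | empty => simp
  | insert a S ha ih => rw [Finset.prod_insert ha, Finset.sum_insert ha, T_add, ih]

theorem rdWeightSum_eq_chainMatrix (i j : Fin n) :
    rdWeightSum (s i, ((i : ℕ) : ℤ)) (t j, ((j : ℕ) : ℤ) - 1) =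
      T (-((((i : ℕ) : ℤ) + 1) * s i)) * (T (((j : ℕ) : ℤ) * t j) * chainMatrix s t n i j) := by
  rw [chainMatrix, Matrix.of_apply]
  split_ifs with h
  · have hheight : ((j : ℕ) : ℤ) - 1 = ((i : ℕ) : ℤ) - ((i + 1 - j : ℕ) : ℤ) := by omega
    rw [hheight, rdWeightSum_eq, ← mul_assoc, ← T_add, ← hheight]
    congr 2
    ring
  · rw [rdWeightSum_eq_zero (by omega), mul_zero, mul_zero]

theorem det_rdWeightSum (hs : MonotoneOn s (Set.Iio n)) (ht : MonotoneOn t (Set.Iio n))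
    (hst : ∀ i, i + 1 < n → s i ≤ t (i + 1)) :
    (Matrix.of fun i j : Fin n =>
      rdWeightSum (s i, ((i : ℕ) : ℤ)) (t j, ((j : ℕ) : ℤ) - 1)).det =
      T (∑ i : Fin n, (((i : ℕ) : ℤ) * t i - (((i : ℕ) : ℤ) + 1) * s i)) *
        ∑ u ∈ increasing s t n, T (∑ i, u i) := by
  have hscale : (Matrix.of fun i j : Fin n =>
      rdWeightSum (s i, ((i : ℕ) : ℤ)) (t j, ((j : ℕ) : ℤ) - 1)) =
      Matrix.of fun i j : Fin n => T (-((((i : ℕ) : ℤ) + 1) * s i)) *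
        (Matrix.of fun i j : Fin n => T (((j : ℕ) : ℤ) * t j) * chainMatrix s t n i j) i j :=
    Matrix.ext fun i j => rdWeightSum_eq_chainMatrix i j
  rw [hscale, Matrix.det_mul_column, Matrix.det_mul_row, det_chainMatrix hs ht hst,
    total_eq_sum_increasing, ← mul_assoc, prod_T, prod_T, ← T_add, ← Finset.sum_add_distrib]
  exact congrArg₂ _ (congrArg T (Finset.sum_congr rfl fun i _ => by ring)) rfl

end LatticePath

/-! ### Trivial tilings and the determinant -/

namespace TreeEdge

variable {w : DyckWord}

theorem upCol_mono (w : DyckWord) : Monotone w.upCol := by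
  classical
  exact fun r r' h => Finset.card_le_card <| Finset.monotone_filter_right _
    fun _ _ hj => ⟨hj.1, hj.2.trans h⟩

/-- The edges, numbered from the last up step to the first one, as in the determinant. -/
noncomputable def ofTop (w : DyckWord) : Fin w.semilength ≃ TreeEdge w :=
  Fin.revPerm.trans (rowEquiv w).symm

theorem row_ofTop (i : Fin w.semilength) : (ofTop w i).row = w.semilength - 1 - i := by
  have h : ((rowEquiv w (ofTop w i)) : ℕ) = w.semilength - 1 - i := by
    simp only [ofTop, Equiv.trans_apply, Equiv.apply_symm_apply, Fin.revPerm_apply, Fin.val_rev]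
    omega
  exact h

theorem opening_ofTop_lt {i j : Fin w.semilength} :
    (ofTop w j).opening < (ofTop w i).opening ↔ i < j := by
  rw [← row_lt_row_iff, row_ofTop, row_ofTop, Fin.lt_def]
  omega

theorem leftCount_ofTop (i : Fin w.semilength) :
    ((ofTop w i).leftCount : ℤ) = DyckTiling.stepX w i := by
  rw [DyckTiling.stepX, ← row_ofTop, upCol_row, leftCount_eq]

end TreeEdge

theorem LatticePath.strictMono_iff_monotone_sub {n : ℕ} {u : Fin n → ℤ} :
    StrictMono u ↔ Monotone fun i : Fin n => u i - ((i : ℕ) : ℤ) := by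
  cases n with
  | zero => exact ⟨fun _ i => i.elim0, fun _ i => i.elim0⟩
  | succ n =>
    rw [Fin.strictMono_iff_lt_succ, Fin.monotone_iff_le_succ]
    refine forall_congr' fun i => ?_
    rw [Fin.val_castSucc, Fin.val_succ]
    omega

namespace DyckTiling

variable {w : DyckWord} {D : DyckTiling w} {L₀ : DecreasingLabel w}

/-- The `x`-coordinate of the starting point `source w i`, in closed form. -/
noncomputable def sourceX (w : DyckWord) (i : ℕ) : ℤ := (i : ℤ) + stepX w 0 - stepX w i

/-- The `x`-coordinate of the end point `D.sink i`, in closed form. -/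
noncomputable def sinkX (D : DyckTiling w) (i : ℕ) : ℤ := sourceX w i + D.stepTiles i

/-- The sequence of integers that encodes the Lehmer code `c`; a monotone code becomes a strictly
increasing sequence. -/
noncomputable def codeSeq (c : TreeEdge w → ℕ) (i : Fin w.semilength) : ℤ :=
  sourceX w i + c (ofTop w i)

theorem source_eq (w : DyckWord) (i : ℕ) : source w i = (sourceX w i, (i : ℤ)) := by
  unfold sourceX
  induction i with
  | zero => simp [source]
  | succ i ih =>
    rw [source, ih]
    ext
    · simp only [Prod.fst_add]
      push_cast
      ring
    · simp

theorem sink_eq (D : DyckTiling w) (i : ℕ) : D.sink i = (D.sinkX i, (i : ℤ) - 1) := by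
  rw [sink, source_eq, sinkX]
  ext <;> simp

theorem sourceX_mono (w : DyckWord) : Monotone (sourceX w) := by
  intro i j hij
  have h : stepX w j ≤ stepX w i := by
    unfold stepX
    exact_mod_cast upCol_mono w (by omega)
  unfold sourceX
  omega

theorem strictMono_codeSeq_iff {c : TreeEdge w → ℕ} :
    StrictMono (codeSeq c) ↔ RowMonotone c := by
  rw [LatticePath.strictMono_iff_monotone_sub]
  simp only [codeSeq, sourceX]
  constructor
  · intro h e f hef
    obtain ⟨j, rfl⟩ := (ofTop w).surjective e
    obtain ⟨i, rfl⟩ := (ofTop w).surjective f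
    have hij := h (opening_ofTop_lt.1 hef).le
    zify
    rw [leftCount_ofTop, leftCount_ofTop]
    dsimp only at hij
    omega
  · intro h i j hij
    rcases hij.eq_or_lt with rfl | hij
    · exact le_rfl
    have hrow := h _ _ (opening_ofTop_lt.2 hij)
    zify at hrow
    rw [leftCount_ofTop, leftCount_ofTop] at hrow
    dsimp only
    omega

theorem codeSeq_injective : Function.Injective (codeSeq (w := w)) := by
  intro c c' h
  funext e
  obtain ⟨i, rfl⟩ := (ofTop w).surjective e
  simpa [codeSeq] using congrFun h i

theorem exists_codeSeq_eq {u : Fin w.semilength → ℤ}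
    (hu : ∀ i : Fin w.semilength, sourceX w i ≤ u i) : ∃ c, codeSeq c = u := by
  refine ⟨fun e => (u ((ofTop w).symm e) - sourceX w ((ofTop w).symm e)).toNat, ?_⟩
  funext i
  rw [codeSeq, Equiv.symm_apply_apply, Int.toNat_of_nonneg (sub_nonneg.2 (hu i))]
  ring

theorem sinkX_eq_codeSeq (h : D.HasLabel L₀) (hD : D.IsTrivial) (i : Fin w.semilength) :
    D.sinkX i = codeSeq L₀.code i := by
  rw [sinkX, codeSeq, stepTiles, ← row_ofTop, h.card_lineTiles hD]

theorem sinkX_monotoneOn (h : D.HasLabel L₀) (hD : D.IsTrivial) :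
    MonotoneOn D.sinkX (Set.Iio w.semilength) := by
  intro i hi j hj hij
  have hmono := (strictMono_codeSeq_iff.2 (h.rowMonotone hD)).monotone
    (show (⟨i, hi⟩ : Fin w.semilength) ≤ ⟨j, hj⟩ from hij)
  rwa [← sinkX_eq_codeSeq h hD, ← sinkX_eq_codeSeq h hD] at hmono

theorem Y_eq_sum_increasing (h : D.HasLabel L₀) (hD : D.IsTrivial) :
    D.Y = ∑ u ∈ LatticePath.increasing (sourceX w) D.sinkX w.semilength,
      T (∑ i, (u i - sourceX w i)) := by
  have hst : ∀ i, i + 1 < w.semilength → sourceX w i ≤ D.sinkX (i + 1) := fun i _ =>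
    (sourceX_mono w i.le_succ).trans (by simp [sinkX])
  simp only [Y, source_eq, sink_eq]
  rw [LatticePath.det_rdWeightSum ((sourceX_mono w).monotoneOn _) (sinkX_monotoneOn h hD) hst,
    ← mul_assoc, ← T_add, Finset.mul_sum]
  refine Finset.sum_congr rfl fun u _ => ?_
  rw [← T_add, ← Finset.sum_neg_distrib, ← Finset.sum_add_distrib, ← Finset.sum_add_distrib]
  refine congrArg T (Finset.sum_congr rfl fun i _ => ?_)
  rw [sinkX]
  ring

theorem sum_codeSeq_sub (L : DecreasingLabel w) :
    ∑ i : Fin w.semilength, (codeSeq L.code i - sourceX w i) = L.inv := by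
  rw [DecreasingLabel.inv, ← (ofTop w).sum_comp]
  push_cast
  exact Finset.sum_congr rfl fun i _ => by rw [codeSeq, add_sub_cancel_left]

open Classical in
theorem image_codeSeq (hL₀ : ¬ L₀.Contains312) (h : D.HasLabel L₀) (hD : D.IsTrivial) :
    (Finset.univ.filter fun L : DecreasingLabel w => L₀.Le L ∧ RowMonotone L.code).image
      (codeSeq ∘ DecreasingLabel.code) =
      LatticePath.increasing (sourceX w) D.sinkX w.semilength := by
  ext u
  simp only [Finset.mem_image, Finset.mem_filter, Finset.mem_univ, true_and,
    LatticePath.mem_increasing, sinkX_eq_codeSeq h hD]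
  constructor
  · rintro ⟨L, ⟨hle, hmono⟩, rfl⟩
    refine ⟨fun i => ⟨by simp [codeSeq], ?_⟩, strictMono_codeSeq_iff.2 hmono⟩
    have hcode := DecreasingLabel.Le.code_le hL₀ hle (ofTop w i)
    simp only [Function.comp_apply, codeSeq]
    omega
  · rintro ⟨hbounds, hmono⟩
    obtain ⟨c, rfl⟩ := exists_codeSeq_eq fun i : Fin w.semilength => (hbounds i).1
    have hc : RowMonotone c := strictMono_codeSeq_iff.1 hmono
    have hcL₀ : ∀ e, c e ≤ L₀.code e := by
      intro e
      obtain ⟨i, rfl⟩ := (ofTop w).surjective e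
      simpa [codeSeq] using (hbounds i).2
    obtain ⟨L, hle, hL⟩ := L₀.exists_le_code_eq hc hcL₀
    obtain rfl : L.code = c := funext hL
    exact ⟨L, ⟨hle, hc⟩, rfl⟩

open Classical in
theorem Y_eq (hL₀ : ¬ L₀.Contains312) (h : D.HasLabel L₀) (hD : D.IsTrivial) :
    D.Y = ∑ L ∈ Finset.univ.filter (fun L : DecreasingLabel w =>
      L₀.Le L ∧ RowMonotone L.code), T (L.inv : ℤ) := by
  rw [Y_eq_sum_increasing h hD, ← image_codeSeq hL₀ h hD,
    Finset.sum_image (codeSeq_injective.comp DecreasingLabel.code_injective).injOn]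
  exact Finset.sum_congr rfl fun L _ => congrArg T (sum_codeSeq_sub L)

open Classical in
theorem W_eq (hL₀ : ¬ L₀.Contains312) (h : D.HasLabel L₀) (hD : D.IsTrivial) :
    W L₀ D = ∑ L ∈ Finset.univ.filter (fun L : DecreasingLabel w =>
      L₀.Le L ∧ ¬ RowMonotone L.code), T (L.inv : ℤ) := by
  rw [W, Y_eq hL₀ h hD, DecreasingLabel.Z, sub_eq_iff_eq_add', ← Finset.filter_filter,
    ← Finset.filter_filter, Finset.sum_filter_add_sum_filter_not]

/-- The unique Dyck tiling with a given label. -/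
noncomputable def ofLabel (L : DecreasingLabel w) : DyckTiling w :=
  (existsUnique_hasLabel L).choose

theorem hasLabel_ofLabel (L : DecreasingLabel w) : (ofLabel L).HasLabel L :=
  (existsUnique_hasLabel L).choose_spec.1

theorem HasLabel.eq_ofLabel {L : DecreasingLabel w} (h : D.HasLabel L) : D = ofLabel L :=
  (existsUnique_hasLabel L).choose_spec.2 D h

theorem ofLabel_injective : Function.Injective (ofLabel (w := w)) := fun L L' h =>
  (hasLabel_ofLabel L).unique (h ▸ hasLabel_ofLabel L')

theorem isTrivial_ofLabel_iff (L : DecreasingLabel w) :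
    (ofLabel L).IsTrivial ↔ RowMonotone L.code :=
  ⟨(hasLabel_ofLabel L).rowMonotone, (hasLabel_ofLabel L).isTrivial⟩

open Classical in
theorem nontrivialAbove_eq (L₀ : DecreasingLabel w) :
    nontrivialAbove L₀ = ((Finset.univ.filter (fun L : DecreasingLabel w =>
      L₀.Le L ∧ ¬ RowMonotone L.code)).image ofLabel : Finset (DyckTiling w)) := by
  ext D
  rw [Finset.mem_coe, Finset.mem_image]
  constructor
  · rintro ⟨hD, L, hL, hle⟩
    rw [hL.eq_ofLabel, isTrivial_ofLabel_iff] at hD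
    exact ⟨L, by simp [hle, hD], hL.eq_ofLabel.symm⟩
  · rintro ⟨L, hL, rfl⟩
    obtain ⟨hle, hmono⟩ := (Finset.mem_filter.1 hL).2
    exact ⟨mt (isTrivial_ofLabel_iff L).1 hmono, L, hasLabel_ofLabel L, hle⟩

end DyckTiling

theorem mainTheorem9 (w : DyckWord) (L₀ : DecreasingLabel w) (hL₀ : ¬ L₀.Contains312) :
    (∃! D₀ : DyckTiling w, D₀.HasLabel L₀) ∧
    ∀ D₀ : DyckTiling w, D₀.HasLabel L₀ →
      D₀.IsTrivial ∧
      (∃ P : Polynomial ℕ,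
        DyckTiling.W L₀ D₀ = Polynomial.toLaurent (P.map (Nat.castRingHom ℤ))) ∧
      (DyckTiling.nontrivialAbove L₀).Finite ∧
      DyckTiling.W L₀ D₀ =
        ∑ᶠ D ∈ DyckTiling.nontrivialAbove L₀, LaurentPolynomial.T (D.weight : ℤ) ∧
      ∀ D ∈ DyckTiling.nontrivialAbove L₀, ∀ L : DecreasingLabel w,
        D.HasLabel L → L.Contains312 := by
  classical
  refine ⟨DyckTiling.existsUnique_hasLabel L₀, fun D₀ h => ?_⟩
  have hD₀ : D₀.IsTrivial := not_not.1 fun hD => hL₀ (h.contains312 hD)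
  have hW := DyckTiling.W_eq hL₀ h hD₀
  refine ⟨hD₀, ⟨∑ L with L₀.Le L ∧ ¬ RowMonotone L.code, Polynomial.X ^ L.inv, ?_⟩, ?_, ?_,
    fun D hD L hL => hL.contains312 hD.1⟩
  · rw [hW, Polynomial.map_sum, map_sum]
    simp
  · rw [DyckTiling.nontrivialAbove_eq]
    exact Finset.finite_toSet _
  · rw [DyckTiling.nontrivialAbove_eq, finsum_mem_coe_finset,
      Finset.sum_image DyckTiling.ofLabel_injective.injOn, hW]
    exact Finset.sum_congr rfl fun L _ => by
      rw [(DyckTiling.hasLabel_ofLabel L).weight_eq_inv]
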